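/- List the nontrivial zeros of the Riemann zeta function $\zeta$, repeated according to multiplicity, in pairs $\rho=\tfrac12\pm \mathrm i\tau_k$ $(k=1,2,\dots)$ with $\operatorname{Re}\tau_k>0$ (the Riemann Hypothesis is not assumed, so the $\tau_k$ may be complex). For $\operatorname{Re}\sigma>\tfrac12$ the series $$\mathcal Z(\sigma)=\sum_{k\ge 1}\tau_k^{-2\sigma}$$ (principal powers) converges absolutely, and it extends to a meromorphic function $\mathcal Z$ on $\mathbb C$. This function is holomorphic at every point other than $\sigma=\tfrac12-m$, $m=0,1,2,\dots$. It has a double pole at $\sigma=\tfrac12$, and for each integer $m\ge1$ it has a simple pole at $\sigma=\tfrac12-m$, with residue $$\mathcal R_m=\frac{(-1)^m}{2\pi}\bigl[\mathbf Z(1-2m)+2^{1-2m}\bigr]=\frac{(-1)^m}{8\pi m}\,(1-2^{1-2m})\,B_{2m}.$$ Here $B_{2m}$ are the Bernoulli numbers ($B_2=\tfrac16$), and $\mathbf Z(s)$ denotes the analytic continuation to $\mathbb C\setminus\{1\}$ of $\sum_{k\ge1}(\tfrac12+2k)^{-s}$ $(\operatorname{Re}s>1)$, i.e. $\mathbf Z(s)=2^{-s}\zeta(s,\tfrac54)$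 with $\zeta(s,a)$ the Hurwitz zeta function. -/

import Mathlib

open Filter Topology

/-- The nontrivial zeros `ρ` of the Riemann zeta function lying in the upper half-plane.
Each pair `1/2 ± i τ` of nontrivial zeros contains exactly one of these, the one for which
`ρ = 1/2 + i τ` with `0 < Re τ`. -/
def upperZeros : Set ℂ :=
  {ρ : ℂ | riemannZeta ρ = 0 ∧ 0 < ρ.re ∧ ρ.re < 1 ∧ 0 < ρ.im}

/-- The parameter `τ` of a zero, defined by `ρ = 1/2 + i τ`. -/
noncomputable def tau (ρ : ℂ) : ℂ := (ρ - 1 / 2) / Complex.I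

/-- The contribution of a zero `ρ = 1/2 + i τ` to the Dirichlet series `∑ τ_k ^ (-2σ)`, in which
every zero is repeated according to its multiplicity (the order of vanishing of `ζ` at `ρ`).
As `0 < Re τ`, the principal branch of the power is the natural one. -/
noncomputable def zeroTerm (σ : ℂ) (ρ : upperZeros) : ℂ :=
  (analyticOrderNatAt riemannZeta (ρ : ℂ) : ℂ) * tau (ρ : ℂ) ^ (-2 * σ)

/-- The zeta function `𝐙(s)` of the shifted trivial zeros: the analytic continuation to `ℂ \ {1}`
of `∑_{k ≥ 1} (1/2 + 2k) ^ (-s)`, that is `2 ^ (-s) * ζ(s, 5/4)`, where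
`ζ(s, 5/4) = ζ(s, 1/4) - (1/4) ^ (-s)`. The two facts that characterize it follow below. -/
noncomputable def shadowZeta (s : ℂ) : ℂ :=
  2 ^ (-s) * (HurwitzZeta.hurwitzZeta ((1 / 4 : ℝ) : UnitAddCircle) s - (1 / 4 : ℂ) ^ (-s))

theorem hasSum_shadowZeta {s : ℂ} (hs : 1 < s.re) :
    HasSum (fun k : ℕ => (1 / 2 + 2 * ((k : ℂ) + 1)) ^ (-s)) (shadowZeta s) := by
  have h := HurwitzZeta.hasSum_hurwitzZeta_of_one_lt_re (a := 1 / 4)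
    (by constructor <;> norm_num) hs
  rw [← hasSum_nat_add_iff' 1] at h
  have h2 := h.mul_left ((2 : ℂ) ^ (-s))
  have e : (2 : ℂ) ^ (-s) * (HurwitzZeta.hurwitzZeta ((1 / 4 : ℝ) : UnitAddCircle) s -
      ∑ i ∈ Finset.range 1, 1 / ((i : ℂ) + ((1 / 4 : ℝ) : ℂ)) ^ s) = shadowZeta s := by
    simp [shadowZeta, Complex.cpow_neg]
  rw [e] at h2
  refine h2.congr_fun ?_
  intro k
  have e1 : (1 / 2 + 2 * ((k : ℂ) + 1)) = ((2 : ℝ) : ℂ) * (((k : ℝ) + 1 + 1 / 4 : ℝ) : ℂ) := by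
    push_cast; ring
  rw [e1, Complex.mul_cpow_ofReal_nonneg (by norm_num) (by positivity)]
  simp [Complex.cpow_neg]

theorem differentiableAt_shadowZeta {s : ℂ} (hs : s ≠ 1) :
    DifferentiableAt ℂ shadowZeta s := by
  have h := HurwitzZeta.differentiableAt_hurwitzZeta ((1 / 4 : ℝ) : UnitAddCircle) hs
  have h2 : DifferentiableAt ℂ (fun s : ℂ => (2 : ℂ) ^ (-s)) s :=
    (differentiableAt_id.neg).const_cpow (Or.inl (by norm_num))
  have h4 : DifferentiableAt ℂ (fun s : ℂ => (1 / 4 : ℂ) ^ (-s)) s :=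
    (differentiableAt_id.neg).const_cpow (Or.inl (by norm_num))
  exact h2.mul (h.sub h4)

/-! ### Entire functions: dividing out finitely many zeros. -/

section EntireFunctions

open Metric Set

/-! Write `xiHalf z` for ξ(1/2 + z), an even entire function of order one whose zeros are ± i τ_k
with the multiplicities of ζ. An entire function of order less than two has a Mittag-Leffler
expansion of its logarithmic derivative (`hasSum_order_mul_logDeriv`); pairing opposite zeros gives
ξ'/ξ(1/2 + t) = ∑ 2t / (t² + τ_k²). For 0 < Re σ < 1 the Mellin integral of 2t / (t² + τ²) against
t^(-2σ) is τ^(-2σ) π / sin πσ. Hence, for 1/2 < Re σ < 1, the Dirichlet series times π / sin πσ is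
the Mellin transform of ξ'/ξ(1/2 + t), and its continuation is governed by the behaviour of that
function at infinity.

There ξ'/ξ(1/2 + t) is the sum of an elementary part, a digamma function and ζ'/ζ(1/2 + t). Up to a
constant the digamma part is ∑ t / (x (t + x)) over x = 2k + 1/2, k ≥ 0. This series also transforms
termwise, into -(π / sin 2πσ) 2^(-2σ) ζ(2σ, 1/4), which is already continued
(`tsum_zeroTerm_mul_eq`). What is left, `zerosRemainder`, is O(t) at 0, and for t > 1/2 it equals
1/(t + 1/2) + 1/(t - 1/2), plus a constant, plus ζ'/ζ(1/2 + t), which decays exponentially. On (0,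
1] its transform is holomorphic for Re σ < 1. On (1, ∞) the constant gives c / (2σ - 1), the ζ'/ζ
term is entire, and the rational part gives ∑ 4^(-j) / (σ + j), whose poles are killed by the factor
sin πσ.

So for Re σ < 1 the continuation is -2^(-2σ) ζ(2σ, 1/4) / (2 cos πσ) plus a function with at most a
simple pole at 1/2. The zeros of the cosine give the poles at 1/2 - m; at 1/2 the pole of the
Hurwitz zeta function makes the pole double. The residue for m ≥ 1 involves 2^(2m-1) ζ(1 - 2m, 1/4),
that is B_{2m}(1/4), which is reduced to B_{2m} through the Fourier series of Bernoulli polynomials.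
It is nonzero because ζ(2m) is, so these poles are genuine. -/

/-- The product of the linear factors of `G` attached to a finite set of its zeros. -/
noncomputable def zeroProd (G : ℂ → ℂ) (S : Finset ℂ) (z : ℂ) : ℂ :=
  ∏ a ∈ S, (1 - z / a) ^ analyticOrderNatAt G a

theorem differentiable_zeroProd (G : ℂ → ℂ) (S : Finset ℂ) : Differentiable ℂ (zeroProd G S) := by
  unfold zeroProd
  fun_prop

theorem zeroProd_zero (G : ℂ → ℂ) (S : Finset ℂ) : zeroProd G S 0 = 1 := by
  simp [zeroProd]

theorem zeroProd_ne_zero {G : ℂ → ℂ} {S : Finset ℂ} (hS : (0 : ℂ) ∉ S) {z : ℂ} (hz : z ∉ S) :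
    zeroProd G S z ≠ 0 := by
  refine Finset.prod_ne_zero_iff.mpr fun a ha => pow_ne_zero _ fun h => hz ?_
  have ha0 : a ≠ 0 := fun h => hS (h ▸ ha)
  rw [sub_eq_zero, eq_comm, div_eq_one_iff_eq ha0] at h
  exact h ▸ ha

theorem exists_entire_eq_pow_mul {g : ℂ → ℂ} (hg : Differentiable ℂ g) {a : ℂ}
    (ha : analyticOrderAt g a ≠ ⊤) :
    ∃ h : ℂ → ℂ, Differentiable ℂ h ∧ h a ≠ 0 ∧
      ∀ z, g z = (z - a) ^ analyticOrderNatAt g a * h z := by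
  set n := analyticOrderNatAt g a
  obtain ⟨k, hk, hka, hgk⟩ := (hg.analyticAt a).analyticOrderAt_ne_top.mp ha
  set h : ℂ → ℂ := Function.update (fun z => g z / (z - a) ^ n) a (k a) with hh
  have hne : ∀ z, z ≠ a → h z = g z / (z - a) ^ n := fun z hz => by simp [hh, hz]
  have hha : h a = k a := by simp [hh]
  have hloc : h =ᶠ[𝓝 a] k := by
    filter_upwards [hgk] with z hz
    rcases eq_or_ne z a with rfl | hza
    · exact hha
    · rw [hne z hza, hz, smul_eq_mul, mul_div_cancel_left₀]
      exact pow_ne_zero _ (sub_ne_zero.mpr hza)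
  refine ⟨h, fun z => ?_, by rwa [hha], fun z => ?_⟩
  · rcases eq_or_ne z a with rfl | hza
    · exact (hk.differentiableAt).congr_of_eventuallyEq hloc
    · have : h =ᶠ[𝓝 z] fun z => g z / (z - a) ^ n := by
        filter_upwards [isOpen_ne.mem_nhds hza] with w hw using hne w hw
      refine DifferentiableAt.congr_of_eventuallyEq ?_ this
      exact (hg z).div (by fun_prop) (pow_ne_zero _ (sub_ne_zero.mpr hza))
  · rcases eq_or_ne z a with rfl | hza
    · rw [hha]; exact hgk.self_of_nhds
    · rw [hne z hza, mul_div_cancel₀]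
      exact pow_ne_zero _ (sub_ne_zero.mpr hza)

theorem analyticOrderAt_ne_top_of_entire {G : ℂ → ℂ} (hG : Differentiable ℂ G) {b : ℂ}
    (hb : G b ≠ 0) (a : ℂ) : analyticOrderAt G a ≠ ⊤ := by
  have h1 : AnalyticOnNhd ℂ G univ := fun z _ => hG.analyticAt z
  intro h
  have := h1.eqOn_zero_of_preconnected_of_eventuallyEq_zero isPreconnected_univ (mem_univ a)
    (analyticOrderAt_eq_top.mp h)
  exact hb (this (mem_univ b))

/-- The zeros are divided out one at a time. Factors already removed do not vanish at the next zero
`a`, so the current cofactor has the same order there as `G`. The power of `-a` passes from z - a to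
the normalised factor 1 - z/a. -/
theorem exists_eq_zeroProd_mul {G : ℂ → ℂ} (hG : Differentiable ℂ G) (hG0 : G 0 ≠ 0)
    (S : Finset ℂ) (hS : (0 : ℂ) ∉ S) :
    ∃ g : ℂ → ℂ, Differentiable ℂ g ∧ (∀ z, G z = zeroProd G S z * g z) ∧ ∀ a ∈ S, g a ≠ 0 := by
  induction S using Finset.induction_on with
  | empty => exact ⟨G, hG, by simp [zeroProd], by simp⟩
  | insert a S ha ih =>
    rw [Finset.mem_insert, not_or] at hS
    obtain ⟨g, hg, hGg, hgS⟩ := ih hS.2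
    have ha0 : a ≠ 0 := Ne.symm hS.1
    have hP : zeroProd G S a ≠ 0 := zeroProd_ne_zero hS.2 ha
    have hg0 : g 0 ≠ 0 := by
      have := hGg 0
      rw [zeroProd_zero, one_mul] at this
      rwa [← this]
    have htop := analyticOrderAt_ne_top_of_entire hg hg0 a
    have hord : analyticOrderAt G a = analyticOrderAt g a := by
      have h1 : G = zeroProd G S • g := by ext z; simp [hGg z]
      rw [h1, analyticOrderAt_smul ((differentiable_zeroProd _ _).analyticAt a) (hg.analyticAt a),
        ((differentiable_zeroProd _ _).analyticAt a).analyticOrderAt_eq_zero.mpr hP, zero_add]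
    have hordN : analyticOrderNatAt G a = analyticOrderNatAt g a := by
      simp [analyticOrderNatAt, hord]
    obtain ⟨h, hh, hha, hgh⟩ := exists_entire_eq_pow_mul hg htop
    refine ⟨fun z => (-a) ^ analyticOrderNatAt G a * h z, by fun_prop, fun z => ?_, fun b hb => ?_⟩
    · rw [hGg z, hgh z]
      simp only [zeroProd]
      rw [Finset.prod_insert ha, ← hordN]
      have : (z - a) ^ analyticOrderNatAt G a =
          (1 - z / a) ^ analyticOrderNatAt G a * (-a) ^ analyticOrderNatAt G a := by
        rw [← mul_pow]; congr 1; field_simp; ring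
      rw [this]; ring
    · refine mul_ne_zero (pow_ne_zero _ (neg_ne_zero.mpr ha0)) ?_
      rcases Finset.mem_insert.mp hb with rfl | hb
      · exact hha
      · intro h0
        apply hgS b hb
        rw [hgh b, h0, mul_zero]

/-- On the circle of radius 3R every quotient z/a has modulus at least 3, so each factor 1 - z/a has
modulus at least 2. -/
theorem two_pow_le_norm_zeroProd {G : ℂ → ℂ} {S : Finset ℂ} {R : ℝ}
    (h0 : (0 : ℂ) ∉ S) (hS : ∀ a ∈ S, ‖a‖ ≤ R) {z : ℂ} (hz : ‖z‖ = 3 * R) :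
    2 ^ (∑ a ∈ S, analyticOrderNatAt G a) ≤ ‖zeroProd G S z‖ := by
  rw [zeroProd, norm_prod, ← Finset.prod_pow_eq_pow_sum]
  refine Finset.prod_le_prod (fun _ _ => by positivity) fun a ha => ?_
  rw [norm_pow]
  have ha0 : 0 < ‖a‖ := norm_pos_iff.mpr fun h => h0 (h ▸ ha)
  have h1 : 3 ≤ ‖z / a‖ := by
    rw [norm_div, hz, le_div_iff₀ ha0]
    nlinarith [hS a ha]
  have h2 : ‖z / a‖ - ‖(1 : ℂ)‖ ≤ ‖1 - z / a‖ := by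
    rw [norm_sub_rev]; exact norm_sub_norm_le _ _
  rw [norm_one] at h2
  gcongr
  linarith

/-- The lower bound for the product on the circle of radius 3R bounds the cofactor there, and the
maximum principle carries this bound inside. -/
theorem norm_cofactor_le {G g : ℂ → ℂ} (hg : Differentiable ℂ g) {S : Finset ℂ} {R B : ℝ}
    (hR : 0 < R) (h0 : (0 : ℂ) ∉ S) (hS : ∀ a ∈ S, ‖a‖ ≤ R)
    (hGg : ∀ z, G z = zeroProd G S z * g z) (hB : ∀ z, ‖z‖ = 3 * R → ‖G z‖ ≤ Real.exp B)
    {z : ℂ} (hz : ‖z‖ ≤ 3 * R) :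
    ‖g z‖ * 2 ^ (∑ a ∈ S, analyticOrderNatAt G a) ≤ Real.exp B := by
  rw [← le_div_iff₀ (by positivity)]
  refine Complex.norm_le_of_forall_mem_frontier_norm_le (U := ball 0 (3 * R)) isBounded_ball
    hg.diffContOnCl (fun w hw => ?_) ?_
  · rw [frontier_ball _ (by positivity), mem_sphere_zero_iff_norm] at hw
    rw [le_div_iff₀ (by positivity)]
    calc _ ≤ ‖g w‖ * ‖zeroProd G S w‖ := by
          gcongr; exact two_pow_le_norm_zeroProd h0 hS hw
      _ = ‖G w‖ := by rw [hGg w, norm_mul, mul_comm]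
      _ ≤ _ := hB w hw
  · rw [closure_ball _ (by positivity)]
    simpa using hz

/-- A Jensen-type count of zeros: the cofactor takes the value `G 0` at the origin, so its upper
bound there limits the power of 2. -/
theorem sum_order_mul_log_two_le {G : ℂ → ℂ} (hG : Differentiable ℂ G) (hG0 : G 0 ≠ 0)
    {S : Finset ℂ} {R B : ℝ} (hR : 0 < R) (h0 : (0 : ℂ) ∉ S) (hS : ∀ a ∈ S, ‖a‖ ≤ R)
    (hB : ∀ z, ‖z‖ = 3 * R → ‖G z‖ ≤ Real.exp B) :
    ((∑ a ∈ S, analyticOrderNatAt G a : ℕ) : ℝ) * Real.log 2 ≤ B - Real.log ‖G 0‖ := by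
  obtain ⟨g, hg, hGg, -⟩ := exists_eq_zeroProd_mul hG hG0 S h0
  have h1 := norm_cofactor_le hg hR h0 hS hGg hB (z := 0) (by simp; positivity)
  have h2 : g 0 = G 0 := by rw [hGg 0, zeroProd_zero, one_mul]
  have hpos : 0 < ‖G 0‖ := norm_pos_iff.mpr hG0
  rw [h2, ← Real.exp_log hpos] at h1
  have h3 : (2 : ℝ) ^ (∑ a ∈ S, analyticOrderNatAt G a) =
      Real.exp ((∑ a ∈ S, analyticOrderNatAt G a : ℕ) * Real.log 2) := by
    rw [mul_comm, Real.exp_mul, Real.exp_log (by norm_num), Real.rpow_natCast]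
  rw [h3, ← Real.exp_add, Real.exp_le_exp] at h1
  linarith

theorem logDeriv_zeroProd {G : ℂ → ℂ} {S : Finset ℂ} (h0 : (0 : ℂ) ∉ S) {z : ℂ} (hz : z ∉ S) :
    logDeriv (zeroProd G S) z = ∑ a ∈ S, analyticOrderNatAt G a * (1 / (z - a)) := by
  have hne : ∀ a ∈ S, 1 - z / a ≠ 0 := fun a ha h => by
    have ha0 : a ≠ 0 := fun h => h0 (h ▸ ha)
    rw [sub_eq_zero, eq_comm, div_eq_one_iff_eq ha0] at h
    exact hz (h ▸ ha)
  unfold zeroProd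
  rw [logDeriv_prod (𝕜 := ℂ) (f := fun a z => (1 - z / a) ^ analyticOrderNatAt G a)
    (fun a ha => pow_ne_zero _ (hne a ha)) (fun a _ => by fun_prop)]
  refine Finset.sum_congr rfl fun a ha => ?_
  have ha0 : a ≠ 0 := fun h => h0 (h ▸ ha)
  have hza : z - a ≠ 0 := sub_ne_zero.mpr fun h => hz (h ▸ ha)
  rw [logDeriv_fun_pow (by fun_prop)]
  congr 1
  have hd : HasDerivAt (fun x : ℂ => 1 - x / a) (-(1 / a)) z := by
    simpa using ((hasDerivAt_id z).div_const a).const_sub 1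
  have := hne a ha
  rw [logDeriv_apply, hd.deriv]
  have h2 : a - z ≠ 0 := by rw [← neg_sub]; exact neg_ne_zero.mpr hza
  field_simp
  ring

/-- A zero-free entire cofactor of small growth has a slowly varying logarithmic derivative. -/
theorem norm_logDeriv_sub_le {g : ℂ → ℂ} (hg : Differentiable ℂ g) {R M : ℝ} (hR : 0 < R)
    (hM : 0 < M) (hne : ∀ z ∈ ball (0 : ℂ) R, g z ≠ 0)
    (hle : ∀ z ∈ ball (0 : ℂ) R, ‖g z‖ ≤ ‖g 0‖ * Real.exp M) {z : ℂ} (hz : ‖z‖ < R / 4) :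
    ‖logDeriv g z - logDeriv g 0‖ ≤ 64 * M / R ^ 2 * ‖z‖ := by
  have hdg : DifferentiableOn ℂ (logDeriv g) (ball 0 R) := by
    intro w hw
    have h1 : DifferentiableAt ℂ (deriv g) w := (hg.analyticAt w).deriv.differentiableAt
    exact (h1.div (hg w) (hne w hw)).differentiableWithinAt
  -- A primitive of the logarithmic derivative vanishing at 0 is a branch of log (g / g 0); the
  -- growth hypothesis bounds its real part by M.
  obtain ⟨h, hh0, hh⟩ := hdg.isExactOn_ball.with_val_at 0 0
  have hexp : ∀ w ∈ ball (0 : ℂ) R, g w = g 0 * Complex.exp (h w) := by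
    have hd : ∀ w ∈ ball (0 : ℂ) R,
        HasDerivAt (fun w => g w * Complex.exp (-h w)) 0 w := by
      intro w hw
      have := ((hg w).hasDerivAt).mul ((hh w hw).neg.cexp)
      convert! this using 1
      rw [logDeriv_apply]
      have := hne w hw
      field_simp
      ring
    intro w hw
    have := (convex_ball (0 : ℂ) R).is_const_of_fderivWithin_eq_zero (𝕜 := ℂ)
      (f := fun w => g w * Complex.exp (-h w))
      (fun w hw => (hd w hw).differentiableAt.differentiableWithinAt) (fun w hw => by
        rw [fderivWithin_of_isOpen isOpen_ball hw]
        ext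
        simpa using (hd w hw).deriv) hw (mem_ball_self hR)
    simp only [hh0, neg_zero, Complex.exp_zero, mul_one] at this
    rw [← this, mul_assoc, ← Complex.exp_add]
    simp
  have hhd : DifferentiableOn ℂ h (ball 0 R) := fun w hw =>
    (hh w hw).differentiableAt.differentiableWithinAt
  have hre : MapsTo h (ball 0 R) {z | z.re ≤ M} := by
    intro w hw
    have h1 := hle w hw
    rw [hexp w hw, norm_mul, Complex.norm_exp] at h1
    exact Real.exp_le_exp.mp (le_of_mul_le_mul_left h1
      (norm_pos_iff.mpr (hne 0 (mem_ball_self hR))))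
  -- Borel–Carathéodory gives 2M‖w‖ / (R - ‖w‖), which is at most 2M when ‖w‖ ≤ R/2.
  have hbound : ∀ w, ‖w‖ ≤ R / 2 → ‖h w‖ ≤ 2 * M := by
    intro w hw
    have hwR : w ∈ ball (0 : ℂ) R := by rw [mem_ball_zero_iff]; linarith
    refine (Complex.borelCaratheodory_zero hM hhd hre hR hwR hh0).trans ?_
    rw [div_le_iff₀ (by linarith)]
    nlinarith
  -- Cauchy's estimate on circles of radius R/4, which stay inside the disc of radius R/2.
  have hder : ∀ w ∈ ball (0 : ℂ) (R / 4), ‖logDeriv g w‖ ≤ 8 * M / R := by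
    intro w hw
    rw [mem_ball_zero_iff] at hw
    have hwR : w ∈ ball (0 : ℂ) R := by rw [mem_ball_zero_iff]; linarith
    rw [← (hh w hwR).deriv]
    have := Complex.norm_deriv_le_of_forall_mem_sphere_norm_le (c := w) (R := R / 4) (f := h)
      (C := 2 * M) (by linarith) ?_ ?_
    · refine this.trans_eq ?_
      field_simp
      norm_num
    · refine DifferentiableOn.diffContOnCl (hhd.mono fun v hv => ?_)
      rw [closure_ball _ (by linarith), mem_closedBall, dist_eq_norm] at hv
      rw [mem_ball_zero_iff]
      have := norm_le_norm_add_norm_sub' v w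
      linarith
    · intro v hv
      rw [mem_sphere, dist_eq_norm] at hv
      refine hbound v ?_
      have := norm_le_norm_add_norm_sub' v w
      linarith
  have hsub : ball (0 : ℂ) (R / 4) ⊆ ball 0 R := ball_subset_ball (by linarith)
  -- Schwarz's lemma on the disc of radius R/4: the values lie within 16M/R of the value at 0, and
  -- (16M/R) / (R/4) = 64M/R².
  have := Complex.dist_le_div_mul_dist_of_mapsTo_ball (f := logDeriv g) (c := 0) (R₁ := R / 4)
    (R₂ := 16 * M / R) (z := z) (hdg.mono hsub) (fun w hw => ?_) (by simpa using hz)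
  · rw [dist_eq_norm, dist_zero_right] at this
    refine this.trans_eq ?_
    field_simp
    ring
  · rw [mem_closedBall, dist_eq_norm]
    have h1 := hder w hw
    have h2 := hder 0 (mem_ball_self (by linarith))
    calc _ ≤ ‖logDeriv g w‖ + ‖logDeriv g 0‖ := norm_sub_le _ _
      _ ≤ 8 * M / R + 8 * M / R := add_le_add h1 h2
      _ = _ := by ring

end EntireFunctions

/-! ### Entire functions of finite order: density of zeros and the Mittag-Leffler expansion. -/

section EntireFunctions

open Metric Set MeasureTheory

/-- Partial summation in integral form: ρ^(-q) = q ∫_ρ^∞ x^(-q-1) dx, so a finite sum becomes the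
integral of the counting function against q x^(-q-1), and the count C x^p makes it converge. -/
theorem summable_mul_rpow_neg_of_count {ι : Type*} {w ρ : ι → ℝ} {r₀ C p q : ℝ} (hr₀ : 0 < r₀)
    (hw : ∀ i, 0 ≤ w i) (hρ : ∀ i, r₀ ≤ ρ i) (hp : 0 ≤ p) (hpq : p < q)
    (hcount : ∀ r, r₀ ≤ r → ∀ S : Finset ι, (∀ i ∈ S, ρ i ≤ r) → ∑ i ∈ S, w i ≤ C * r ^ p) :
    Summable fun i => w i * ρ i ^ (-q) := by
  have hq : 0 < q := hp.trans_lt hpq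
  refine summable_of_sum_le (c := q * ∫ x in Ioi r₀, C * x ^ (p - q - 1)) (fun i =>
    mul_nonneg (hw i) (Real.rpow_nonneg (hr₀.le.trans (hρ i)) _)) fun S => ?_
  have hint : ∀ i, IntegrableOn (fun x : ℝ => w i * (Ioi (ρ i)).indicator (fun x => x ^ (-q - 1)) x)
      (Ioi r₀) := fun i => by
    refine (Integrable.indicator ?_ measurableSet_Ioi).const_mul _
    exact integrableOn_Ioi_rpow_of_lt (by linarith) hr₀
  have heq : ∀ i, w i * ρ i ^ (-q) =
      q * ∫ x in Ioi r₀, w i * (Ioi (ρ i)).indicator (fun x => x ^ (-q - 1)) x := by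
    intro i
    rw [integral_const_mul, setIntegral_indicator measurableSet_Ioi, Ioi_inter_Ioi,
      sup_eq_right.mpr (hρ i), integral_Ioi_rpow_of_lt (by linarith) (hr₀.trans_le (hρ i))]
    rw [show -q - 1 + 1 = -q by ring]
    field_simp
  rw [Finset.sum_congr rfl fun i _ => heq i, ← Finset.mul_sum,
    ← integral_finsetSum _ fun i _ => hint i]
  refine mul_le_mul_of_nonneg_left ?_ hq.le
  refine setIntegral_mono_on (integrable_finsetSum _ fun i _ => hint i)
    ((integrableOn_Ioi_rpow_of_lt (by linarith) hr₀).const_mul _) measurableSet_Ioi fun x hx => ?_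
  have hx0 : 0 < x := hr₀.trans hx
  have h1 : ∑ i ∈ S, w i * (Ioi (ρ i)).indicator (fun x => x ^ (-q - 1)) x =
      (∑ i ∈ S with ρ i < x, w i) * x ^ (-q - 1) := by
    rw [Finset.sum_filter, Finset.sum_mul]
    refine Finset.sum_congr rfl fun i _ => ?_
    by_cases h : ρ i < x <;> simp [indicator, h]
  rw [h1, show p - q - 1 = p + (-q - 1) by ring, Real.rpow_add hx0, ← mul_assoc]
  gcongr
  exact hcount x hx.le _ fun i hi => (Finset.mem_filter.mp hi).2.le

variable {G : ℂ → ℂ}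

theorem finite_zeros_closedBall (hG : Differentiable ℂ G) (hG0 : G 0 ≠ 0) (R : ℝ) :
    (closedBall (0 : ℂ) R ∩ {a | G a = 0}).Finite := by
  have h1 : AnalyticOnNhd ℂ G univ := fun z _ => hG.analyticAt z
  by_contra hinf
  obtain ⟨x, -, hx⟩ := Set.Infinite.exists_accPt_of_subset_isCompact hinf
    (isCompact_closedBall (0 : ℂ) R) inter_subset_left
  have h2 : ∃ᶠ z in 𝓝[≠] x, G z = 0 := by
    rw [accPt_iff_frequently_nhdsNE] at hx
    exact hx.mono fun z hz => hz.2
  have := h1.eqOn_zero_of_preconnected_of_frequently_eq_zero isPreconnected_univ (mem_univ x) h2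
  exact hG0 (this (mem_univ 0))

theorem exists_pos_le_norm_zeros (hG : Differentiable ℂ G) (hG0 : G 0 ≠ 0) :
    ∃ r₀ : ℝ, 0 < r₀ ∧ ∀ a, G a = 0 → r₀ ≤ ‖a‖ := by
  have h1 : {z | G z ≠ 0} ∈ 𝓝 (0 : ℂ) := hG.continuous.continuousAt.eventually_ne hG0
  obtain ⟨r, hr, h⟩ := Metric.mem_nhds_iff.mp h1
  refine ⟨r, hr, fun a ha => ?_⟩
  by_contra hlt
  exact h (mem_ball_zero_iff.mpr (not_le.mp hlt)) ha

theorem exists_sum_order_le (hG : Differentiable ℂ G) (hG0 : G 0 ≠ 0) {K p r₀ : ℝ} (hK : 0 ≤ K)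
    (hp : 0 ≤ p) (hr₀ : 0 < r₀) (hgrow : ∀ z, ‖G z‖ ≤ Real.exp (K * (1 + ‖z‖) ^ p)) :
    ∃ C : ℝ, ∀ r, r₀ ≤ r → ∀ S : Finset {a // G a = 0}, (∀ a ∈ S, ‖(a : ℂ)‖ ≤ r) →
      ∑ a ∈ S, (analyticOrderNatAt G a : ℝ) ≤ C * r ^ p := by
  have hl2 : 0 < Real.log 2 := Real.log_pos (by norm_num)
  -- For r ≥ r₀ one has 1 ≤ r / r₀, so both 1 + 3r and the constant log ‖G 0‖ can be absorbed into
  -- multiples of powers of r.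
  refine ⟨(K * (1 / r₀ + 3) ^ p + |Real.log ‖G 0‖| * (1 / r₀) ^ p) / Real.log 2,
    fun r hr S hS => ?_⟩
  have hr0 : 0 < r := hr₀.trans_le hr
  have h1 : 1 ≤ 1 / r₀ * r := by rw [one_div_mul_eq_div, le_div_iff₀ hr₀]; linarith
  have h0 : (0 : ℂ) ∉ S.map (Function.Embedding.subtype _) := by
    simp [hG0]
  have := sum_order_mul_log_two_le hG hG0 hr0 (S := S.map (Function.Embedding.subtype _))
    (B := K * (1 + 3 * r) ^ p) h0 (by simpa using fun a ha ha' => hS ⟨a, ha⟩ ha')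
    (fun z hz => by simpa [hz] using hgrow z)
  rw [Finset.sum_map] at this
  push_cast at this
  rw [div_mul_eq_mul_div, le_div_iff₀ hl2]
  refine this.trans ?_
  rw [add_mul, mul_assoc, mul_assoc, ← Real.mul_rpow (by positivity) hr0.le,
    ← Real.mul_rpow (by positivity) hr0.le, sub_eq_add_neg]
  have h2 : 1 ≤ (1 / r₀ * r) ^ p := Real.one_le_rpow h1 hp
  have h3 : (1 + 3 * r) ^ p ≤ ((1 / r₀ + 3) * r) ^ p := by
    refine Real.rpow_le_rpow (by positivity) ?_ hp
    linarith
  refine add_le_add (by gcongr) ?_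
  calc -Real.log ‖G 0‖ ≤ |Real.log ‖G 0‖| * 1 := by rw [mul_one]; exact neg_le_abs _
    _ ≤ _ := by gcongr

/-- The exponent of convergence of the zeros of an entire function is at most its order. -/
theorem summable_order_mul_norm_rpow (hG : Differentiable ℂ G) (hG0 : G 0 ≠ 0) {K p q : ℝ}
    (hK : 0 ≤ K) (hp : 0 ≤ p) (hpq : p < q)
    (hgrow : ∀ z, ‖G z‖ ≤ Real.exp (K * (1 + ‖z‖) ^ p)) :
    Summable fun a : {a // G a = 0} => (analyticOrderNatAt G a : ℝ) * ‖(a : ℂ)‖ ^ (-q) := by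
  obtain ⟨r₀, hr₀, hr⟩ := exists_pos_le_norm_zeros hG hG0
  obtain ⟨C, hC⟩ := exists_sum_order_le hG hG0 hK hp hr₀ hgrow
  exact summable_mul_rpow_neg_of_count hr₀ (fun _ => Nat.cast_nonneg _) (fun a => hr a a.2) hp hpq hC

theorem logDeriv_eq_sum_add {g : ℂ → ℂ} (hg : Differentiable ℂ g) {S : Finset ℂ}
    (h0 : (0 : ℂ) ∉ S) (hGg : ∀ z, G z = zeroProd G S z * g z) {z : ℂ} (hz : z ∉ S)
    (hgz : g z ≠ 0) :
    logDeriv G z = ∑ a ∈ S, analyticOrderNatAt G a * (1 / (z - a)) + logDeriv g z := by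
  rw [← logDeriv_zeroProd h0 hz, ← logDeriv_mul z (zeroProd_ne_zero h0 hz) hgz
    (differentiable_zeroProd _ _ z) (hg z)]
  congr 1
  exact funext hGg

/-- After the zeros of modulus at most R are divided out, the cofactor has no zero in the disc, so
its logarithmic derivative varies slowly there. That variation is exactly the error of the finite
partial fraction sum. -/
theorem norm_sum_sub_logDeriv_le (hG : Differentiable ℂ G) (hG0 : G 0 ≠ 0) {K p R : ℝ}
    (hK : 0 ≤ K) (hgrow : ∀ z, ‖G z‖ ≤ Real.exp (K * (1 + ‖z‖) ^ p)) (hR : 0 < R)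
    {S : Finset ℂ} (hS : ∀ a, a ∈ S ↔ ‖a‖ ≤ R ∧ G a = 0) {z : ℂ} (hz : ‖z‖ < R / 4)
    (hGz : G z ≠ 0) :
    ‖∑ a ∈ S, analyticOrderNatAt G a * (1 / (z - a) + 1 / a) - (logDeriv G z - logDeriv G 0)‖ ≤
      64 * (K * (1 + 3 * R) ^ p + |Real.log ‖G 0‖| + 1) / R ^ 2 * ‖z‖ := by
  have h0 : (0 : ℂ) ∉ S := fun h => hG0 ((hS 0).mp h).2
  have hzS : z ∉ S := fun h => hGz ((hS z).mp h).2
  obtain ⟨g, hg, hGg, hgS⟩ := exists_eq_zeroProd_mul hG hG0 S h0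
  have hg0 : g 0 = G 0 := by rw [hGg 0, zeroProd_zero, one_mul]
  have hne : ∀ w ∈ ball (0 : ℂ) R, g w ≠ 0 := by
    intro w hw h
    have hGw : G w = 0 := by rw [hGg w, h, mul_zero]
    exact hgS w ((hS w).mpr ⟨(mem_ball_zero_iff.mp hw).le, hGw⟩) h
  have hgz : g z ≠ 0 := hne z (mem_ball_zero_iff.mpr (by linarith))
  -- The summand 1 only serves to make M strictly positive.
  have key := norm_logDeriv_sub_le hg hR
    (M := K * (1 + 3 * R) ^ p + |Real.log ‖G 0‖| + 1) (by positivity) hne (fun w hw => ?_) hz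
  · rw [logDeriv_eq_sum_add hg h0 hGg hzS hgz,
      logDeriv_eq_sum_add hg h0 hGg h0 (by rwa [hg0])]
    rw [← norm_neg]
    refine Eq.trans_le (congrArg norm ?_) key
    simp only [mul_add, Finset.sum_add_distrib, zero_sub, one_div, inv_neg, mul_neg,
      Finset.sum_neg_distrib]
    ring
  · have h1 := norm_cofactor_le hg hR h0 (fun a ha => ((hS a).mp ha).1) hGg
      (B := K * (1 + 3 * R) ^ p) (fun z hz => by simpa [hz] using hgrow z) (z := w)
      (by rw [mem_ball_zero_iff] at hw; linarith)
    have h2 : ‖g w‖ * 1 ≤ ‖g w‖ * 2 ^ (∑ a ∈ S, analyticOrderNatAt G a) := by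
      gcongr
      exact one_le_pow₀ (by norm_num)
    rw [mul_one] at h2
    refine (h2.trans h1).trans ?_
    rw [hg0]
    have hpos : 0 < ‖G 0‖ := norm_pos_iff.mpr hG0
    have h3 : ‖G 0‖ * Real.exp (K * (1 + 3 * R) ^ p + |Real.log ‖G 0‖| + 1) = Real.exp
        (Real.log ‖G 0‖ + (K * (1 + 3 * R) ^ p + |Real.log ‖G 0‖| + 1)) := by
      rw [Real.exp_add (Real.log ‖G 0‖), Real.exp_log hpos]
    rw [h3, Real.exp_le_exp]
    linarith [neg_le_abs (Real.log ‖G 0‖)]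

/-- The Mittag-Leffler expansion of the logarithmic derivative of an entire function of order less
than two. -/
theorem hasSum_order_mul_logDeriv (hG : Differentiable ℂ G) (hG0 : G 0 ≠ 0) {K p : ℝ}
    (hK : 0 ≤ K) (hp : 0 ≤ p) (hp2 : p < 2)
    (hgrow : ∀ z, ‖G z‖ ≤ Real.exp (K * (1 + ‖z‖) ^ p)) {z : ℂ} (hGz : G z ≠ 0) :
    HasSum (fun a : {a // G a = 0} => (analyticOrderNatAt G a : ℂ) * (1 / (z - a) + 1 / a))
      (logDeriv G z - logDeriv G 0) := by
  classical
  have hsum : Summable fun a : {a // G a = 0} =>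
      (analyticOrderNatAt G a : ℂ) * (1 / (z - a) + 1 / a) := by
    -- The bracket equals z / ((z - a) a). Outside the finitely many zeros with ‖a‖ ≤ 2‖z‖ it is at
    -- most 2‖z‖ ‖a‖^(-2), and the exponent 2 exceeds the order p.
    have h1 := (summable_order_mul_norm_rpow hG hG0 hK hp hp2 hgrow).mul_left (2 * ‖z‖)
    refine Summable.of_norm_bounded_eventually h1 ?_
    have hfin : {a : {a // G a = 0} | ‖(a : ℂ)‖ ≤ 2 * ‖z‖}.Finite := by
      refine Set.Finite.of_finite_image (f := Subtype.val) ?_ Subtype.val_injective.injOn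
      refine (finite_zeros_closedBall hG hG0 (2 * ‖z‖)).subset ?_
      rintro _ ⟨a, ha, rfl⟩
      exact ⟨by simpa using ha, a.2⟩
    filter_upwards [hfin.compl_mem_cofinite] with a ha
    have ha : 2 * ‖z‖ < ‖(a : ℂ)‖ := not_le.mp ha
    have ha0 : (a : ℂ) ≠ 0 := fun h => hG0 (by have := a.2; rwa [h] at this)
    have hza : z - a ≠ 0 := sub_ne_zero.mpr fun h => hGz (by have := a.2; rwa [← h] at this)
    have e : (1 / (z - a) + 1 / a : ℂ) = z / ((z - a) * a) := by
      field_simp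
      ring
    have hapos : 0 < ‖(a : ℂ)‖ := norm_pos_iff.mpr ha0
    have h2 : ‖(a : ℂ)‖ / 2 ≤ ‖z - a‖ := by
      have := norm_sub_norm_le (a : ℂ) z
      rw [norm_sub_rev] at this
      linarith
    rw [e, norm_mul, norm_div, norm_mul, Complex.norm_natCast, Real.rpow_neg hapos.le,
      Real.rpow_two]
    calc (analyticOrderNatAt G a : ℝ) * (‖z‖ / (‖z - a‖ * ‖(a : ℂ)‖))
        ≤ analyticOrderNatAt G a * (‖z‖ / (‖(a : ℂ)‖ / 2 * ‖(a : ℂ)‖)) := by gcongr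
      _ = _ := by field_simp
  let S : ℕ → Finset ℂ := fun n => (finite_zeros_closedBall hG hG0 n).toFinset
  have hS : ∀ n a, a ∈ S n ↔ ‖a‖ ≤ n ∧ G a = 0 := fun n a => by simp [S]
  let T : ℕ → Finset {a // G a = 0} := fun n => (S n).subtype _
  have hT : Tendsto T atTop atTop := by
    refine tendsto_atTop.mpr fun F => ?_
    obtain ⟨N, hN⟩ := exists_nat_ge (∑ a ∈ F, ‖(a : ℂ)‖)
    filter_upwards [eventually_ge_atTop N] with n hn a ha
    simp only [T, Finset.mem_subtype, hS]
    refine ⟨?_, a.2⟩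
    have := Finset.single_le_sum (f := fun a : {a // G a = 0} => ‖(a : ℂ)‖)
      (fun _ _ => norm_nonneg _) ha
    exact this.trans (hN.trans (by exact_mod_cast hn))
  have hlim1 := hsum.hasSum.comp hT
  -- With R = n the error is of size n^(p-2) + n^(-2), which tends to zero because p < 2.
  have hlim2 : Tendsto (fun n => ∑ a ∈ S n,
      (analyticOrderNatAt G a : ℂ) * (1 / (z - a) + 1 / a)) atTop
      (𝓝 (logDeriv G z - logDeriv G 0)) := by
    rw [tendsto_iff_norm_sub_tendsto_zero]
    have hdecay : Tendsto (fun n : ℕ => 64 * (K * 4 ^ p * (n : ℝ) ^ (-(2 - p)) +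
        (|Real.log ‖G 0‖| + 1) * (n : ℝ) ^ (-(2 : ℝ))) * ‖z‖) atTop (𝓝 0) := by
      have t1 := (tendsto_rpow_neg_atTop (y := 2 - p) (by linarith)).comp
        (tendsto_natCast_atTop_atTop (R := ℝ))
      have t2 := (tendsto_rpow_neg_atTop (y := 2) (by norm_num)).comp
        (tendsto_natCast_atTop_atTop (R := ℝ))
      have := (((t1.const_mul (K * 4 ^ p)).add (t2.const_mul (|Real.log ‖G 0‖| + 1))).const_mul
        64).mul_const ‖z‖
      simpa using this
    refine squeeze_zero' (Eventually.of_forall fun _ => norm_nonneg _) ?_ hdecay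
    obtain ⟨N, hN⟩ := exists_nat_gt (4 * ‖z‖)
    filter_upwards [eventually_ge_atTop N, eventually_ge_atTop 1] with n hn hn1
    have hn1' : (1 : ℝ) ≤ n := by exact_mod_cast hn1
    have hnpos : (0 : ℝ) < n := by linarith
    have hnN : (N : ℝ) ≤ n := by exact_mod_cast hn
    refine (norm_sum_sub_logDeriv_le hG hG0 hK hgrow hnpos (hS n) (by linarith) hGz).trans ?_
    have h3 : (1 + 3 * (n : ℝ)) ^ p ≤ 4 ^ p * (n : ℝ) ^ p := by
      rw [← Real.mul_rpow (by norm_num) hnpos.le]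
      exact Real.rpow_le_rpow (by positivity) (by linarith) hp
    have h4 : (n : ℝ) ^ (-(2 - p)) = (n : ℝ) ^ p / (n : ℝ) ^ 2 := by
      rw [neg_sub, Real.rpow_sub hnpos, Real.rpow_two]
    rw [h4, Real.rpow_neg hnpos.le, Real.rpow_two]
    calc _ ≤ 64 * (K * (4 ^ p * (n : ℝ) ^ p) + |Real.log ‖G 0‖| + 1) / (n : ℝ) ^ 2 * ‖z‖ := by
          gcongr
      _ = _ := by field_simp; ring
  have heq : ∀ n, ∑ a ∈ T n, (analyticOrderNatAt G a : ℂ) * (1 / (z - a) + 1 / a) =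
      ∑ a ∈ S n, (analyticOrderNatAt G a : ℂ) * (1 / (z - a) + 1 / a) := by
    intro n
    exact Finset.sum_subtype_of_mem
      (fun a => (analyticOrderNatAt G a : ℂ) * (1 / (z - a) + 1 / a)) fun a ha => ((hS n a).mp ha).2
  have := tendsto_nhds_unique (hlim1.congr heq) hlim2
  rw [← this]
  exact hsum.hasSum

end EntireFunctions

/-! ### The function ξ(1/2 + z): definition, symmetry and location of zeros. -/

section XiFunction

open Set MeasureTheory HurwitzZeta

/-- The theta series is estimated termwise by e^(-y) ≤ 2/y² with y = π n² x; weakening n⁴ to n²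
leaves ζ(2) = π²/6 and the constant 2/3. The crude decay x^(-2) suffices. -/
theorem cosKernel_zero_sub_one_mem {x : ℝ} (hx : 0 < x) :
    |cosKernel 0 x - 1| ≤ 1 / x ^ 2 := by
  have h := hasSum_nat_cosKernel₀ 0 hx
  have hb : ∀ n : ℕ, |2 * Real.cos (2 * Real.pi * 0 * (n + 1)) * Real.exp (-Real.pi * (n + 1) ^ 2 * x)| ≤
      4 / (Real.pi ^ 2 * x ^ 2) * (1 / ((n + 1 : ℕ) : ℝ) ^ 2) := by
    intro n
    have hpos : 0 < Real.pi * (n + 1) ^ 2 * x := by positivity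
    have h1 := Real.quadratic_le_exp_of_nonneg hpos.le
    have h2 : Real.exp (-Real.pi * (n + 1) ^ 2 * x) ≤ 2 / (Real.pi * (n + 1) ^ 2 * x) ^ 2 := by
      rw [show -Real.pi * (n + 1) ^ 2 * x = -(Real.pi * (n + 1) ^ 2 * x) by ring, Real.exp_neg,
        inv_le_comm₀ (Real.exp_pos _) (by positivity), inv_div]
      linarith
    have h3 : (1 : ℝ) ≤ (n + 1) ^ 2 := by nlinarith [(Nat.cast_nonneg n : (0 : ℝ) ≤ n)]
    have h4 : 2 / (Real.pi * (n + 1) ^ 2 * x) ^ 2 ≤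
        2 / (Real.pi ^ 2 * x ^ 2 * ((n : ℝ) + 1) ^ 2) := by
      gcongr
      calc Real.pi ^ 2 * x ^ 2 * ((n : ℝ) + 1) ^ 2
          = Real.pi ^ 2 * x ^ 2 * ((n : ℝ) + 1) ^ 2 * 1 := by ring
        _ ≤ Real.pi ^ 2 * x ^ 2 * ((n : ℝ) + 1) ^ 2 * ((n : ℝ) + 1) ^ 2 := by gcongr
        _ = _ := by ring
    simp only [mul_zero, zero_mul, Real.cos_zero, mul_one]
    rw [abs_of_nonneg (by positivity)]
    calc _ ≤ 2 * (2 / (Real.pi ^ 2 * x ^ 2 * ((n : ℝ) + 1) ^ 2)) := by gcongr; exact h2.trans h4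
      _ = _ := by push_cast; field_simp; norm_num
  have hs : HasSum (fun n : ℕ => 4 / (Real.pi ^ 2 * x ^ 2) * (1 / ((n + 1 : ℕ) : ℝ) ^ 2))
      (4 / (Real.pi ^ 2 * x ^ 2) * (Real.pi ^ 2 / 6)) := by
    refine HasSum.mul_left _ ?_
    have := (hasSum_nat_add_iff' 1).mpr hasSum_zeta_two
    simpa using this
  have h5 := tsum_of_norm_bounded (f := fun n : ℕ => 2 * Real.cos (2 * Real.pi * 0 * (n + 1)) *
    Real.exp (-Real.pi * (n + 1) ^ 2 * x)) hs hb
  rw [h.tsum_eq] at h5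
  rw [QuotientAddGroup.mk_zero] at h5
  refine h5.trans ?_
  have : 4 / (Real.pi ^ 2 * x ^ 2) * (Real.pi ^ 2 / 6) = (2 / 3) * (1 / x ^ 2) := by
    field_simp; norm_num
  rw [this]
  have : 0 < 1 / x ^ 2 := by positivity
  linarith

theorem norm_hurwitzEvenFEPair_modif_le_of_one_lt {x : ℝ} (hx : 1 < x) :
    ‖(hurwitzEvenFEPair 0).f_modif x‖ ≤ 1 / x ^ 2 := by
  have h1 : (hurwitzEvenFEPair 0).f_modif x = ((evenKernel 0 x - 1 : ℝ) : ℂ) := by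
    simp [WeakFEPair.f_modif, hx, hx.le, hurwitzEvenFEPair]
  rw [h1, Complex.norm_real, evenKernel_eq_cosKernel_of_zero]
  exact cosKernel_zero_sub_one_mem (by linarith)

/-- The functional equation of theta rewrites the kernel near 0 as x^(-1/2) (θ(1/x) - 1), so decay
at infinity gives x^(-1/2) x². -/
theorem norm_hurwitzEvenFEPair_modif_le_of_lt_one {x : ℝ} (hx0 : 0 < x) (hx : x < 1) :
    ‖(hurwitzEvenFEPair 0).f_modif x‖ ≤ x ^ (3 / 2 : ℝ) := by
  have h1 : (hurwitzEvenFEPair 0).f_modif x =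
      ((x ^ (-(1 / 2) : ℝ) * (cosKernel 0 (1 / x) - 1) : ℝ) : ℂ) := by
    simp only [WeakFEPair.f_modif, hurwitzEvenFEPair, Pi.add_apply, indicator, mem_Ioi, hx.not_gt,
      mem_Ioo, hx0, hx, and_self, if_true, if_false, Function.comp, zero_add]
    rw [evenKernel_functional_equation, Real.rpow_neg hx0.le]
    push_cast
    simp
    ring
  rw [h1, Complex.norm_real, norm_mul]
  have h2 := cosKernel_zero_sub_one_mem (x := 1 / x) (by positivity)
  rw [← Real.norm_eq_abs] at h2
  calc _ ≤ ‖x ^ (-(1 / 2) : ℝ)‖ * (1 / (1 / x) ^ 2) := by gcongr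
    _ = x ^ (-(1 / 2) : ℝ) * x ^ (2 : ℝ) := by
      rw [Real.norm_of_nonneg (by positivity), Real.rpow_two]; simp
    _ = _ := by rw [← Real.rpow_add hx0]; norm_num

/-- In the Mellin integral the integrand is at most 1 on (0, 1) when Re s ≥ -1 and at most x^(-2) on
(1, ∞) when Re s ≤ 2; the total 2 is halved. The bound controls ξ in a strip, and being explicit it
also excludes real zeros. -/
theorem norm_completedRiemannZeta₀_le {s : ℂ} (h1 : -1 ≤ s.re) (h2 : s.re ≤ 2) :
    ‖completedRiemannZeta₀ s‖ ≤ 1 := by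
  have hb1 : IntegrableOn (fun _ : ℝ => (1 : ℝ)) (Ioc 0 1) := by simp
  have hb2 : IntegrableOn (fun x : ℝ => x ^ (-2 : ℝ)) (Ioi 1) :=
    integrableOn_Ioi_rpow_of_lt (by norm_num) one_pos
  have key : ‖∫ x in Ioi (0 : ℝ), (x : ℂ) ^ (s / 2 - 1) • (hurwitzEvenFEPair 0).f_modif x‖ ≤
      ∫ x in Ioi (0 : ℝ), ((Ioc (0 : ℝ) 1).indicator (fun _ => (1 : ℝ)) x +
        (Ioi (1 : ℝ)).indicator (fun x => x ^ (-2 : ℝ)) x) := by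
    refine norm_integral_le_of_norm_le ?_ ?_
    · exact ((integrable_indicator_iff measurableSet_Ioc).mpr hb1).integrableOn.add
        ((integrable_indicator_iff measurableSet_Ioi).mpr hb2).integrableOn
    · have hne : ∀ᵐ x : ℝ ∂volume.restrict (Ioi (0 : ℝ)), x ≠ 1 := by
        refine ae_restrict_of_ae ?_
        simp [ae_iff]
      filter_upwards [ae_restrict_mem measurableSet_Ioi, hne] with x hx0 hx1
      have hx0 : 0 < x := hx0
      have hre : (s / 2 - 1).re = s.re / 2 - 1 := by simp
      rw [norm_smul, Complex.norm_cpow_eq_rpow_re_of_pos hx0, hre]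
      rcases lt_or_gt_of_ne hx1 with hx | hx
      · simp only [indicator, mem_Ioc, hx0, hx.le, and_self, if_true, mem_Ioi, hx.not_gt, if_false,
          add_zero]
        calc _ ≤ x ^ (s.re / 2 - 1) * x ^ (3 / 2 : ℝ) := by
              gcongr; exact norm_hurwitzEvenFEPair_modif_le_of_lt_one hx0 hx
          _ = x ^ (s.re / 2 - 1 + 3 / 2) := by rw [Real.rpow_add hx0]
          _ ≤ 1 := Real.rpow_le_one hx0.le hx.le (by linarith)
      · simp only [indicator, mem_Ioc, hx.not_ge, and_false, if_false, mem_Ioi, hx, if_true,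
          zero_add]
        calc _ ≤ 1 * (1 / x ^ 2) := by
              gcongr
              · exact Real.rpow_le_one_of_one_le_of_nonpos hx.le (by linarith)
              · exact norm_hurwitzEvenFEPair_modif_le_of_one_lt hx
          _ = _ := by rw [Real.rpow_neg hx0.le, Real.rpow_two]; ring
  have hval : ∫ x in Ioi (0 : ℝ), ((Ioc (0 : ℝ) 1).indicator (fun _ => (1 : ℝ)) x +
        (Ioi (1 : ℝ)).indicator (fun x => x ^ (-2 : ℝ)) x) = 2 := by
    rw [integral_add ((integrable_indicator_iff measurableSet_Ioc).mpr hb1).integrableOn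
        ((integrable_indicator_iff measurableSet_Ioi).mpr hb2).integrableOn,
      setIntegral_indicator measurableSet_Ioc, setIntegral_indicator measurableSet_Ioi,
      inter_eq_right.mpr Ioc_subset_Ioi_self, inter_eq_right.mpr (Ioi_subset_Ioi zero_le_one),
      integral_Ioi_rpow_of_lt (by norm_num) one_pos]
    simp
    norm_num
  have hdef : completedRiemannZeta₀ s =
      (∫ x in Ioi (0 : ℝ), (x : ℂ) ^ (s / 2 - 1) • (hurwitzEvenFEPair 0).f_modif x) / 2 := rfl
  rw [hdef, norm_div]
  rw [hval] at key
  simp only [Complex.norm_ofNat]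
  linarith

/-- The entire function `ξ(1/2 + z)`, normalised to have the value `1` at `z = ± 1/2`. -/
noncomputable def xiHalf (z : ℂ) : ℂ :=
  1 + (z ^ 2 - 1 / 4) * completedRiemannZeta₀ (1 / 2 + z)

theorem differentiable_xiHalf : Differentiable ℂ xiHalf := by
  have := differentiable_completedZeta₀
  unfold xiHalf
  fun_prop

theorem xiHalf_neg (z : ℂ) : xiHalf (-z) = xiHalf z := by
  rw [xiHalf, xiHalf, neg_sq, ← completedRiemannZeta₀_one_sub (1 / 2 + z)]
  ring_nf

theorem xiHalf_eq_mul_completedRiemannZeta {z : ℂ} (h0 : z ≠ 1 / 2) (h1 : z ≠ -(1 / 2)) :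
    xiHalf z = (z ^ 2 - 1 / 4) * completedRiemannZeta (1 / 2 + z) := by
  have e0 : (1 / 2 + z) ≠ 0 := fun h => h1 (by linear_combination h)
  have e1 : 1 - (1 / 2 + z) ≠ 0 := fun h => h0 (by linear_combination -h)
  rw [xiHalf, completedRiemannZeta_eq,
    show z ^ 2 - 1 / 4 = -((1 / 2 + z) * (1 - (1 / 2 + z))) by ring]
  generalize 1 / 2 + z = s at *
  field_simp
  ring

theorem xiHalf_eq_mul_riemannZeta {z : ℂ} (h0 : z ≠ 1 / 2) (h1 : 0 < (1 / 2 + z).re) :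
    xiHalf z = (z ^ 2 - 1 / 4) * Complex.Gammaℝ (1 / 2 + z) * riemannZeta (1 / 2 + z) := by
  have e0 : (1 / 2 + z) ≠ 0 := fun h => by rw [h] at h1; simp at h1
  rw [xiHalf_eq_mul_completedRiemannZeta h0 (fun h => e0 (by rw [h]; ring)),
    riemannZeta_def_of_ne_zero e0]
  rw [mul_assoc, mul_div_cancel₀ _ (Complex.Gammaℝ_ne_zero_of_re_pos h1)]

/-- On this segment the second summand of `xiHalf` has modulus at most 1/4, so it cannot cancel the
summand 1. With real zeros excluded, each pair of opposite zeros has exactly one member in the upper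
half-plane. -/
theorem xiHalf_ofReal_ne_zero {x : ℝ} (h0 : -(1 / 2) ≤ x) (h1 : x ≤ 1 / 2) :
    xiHalf x ≠ 0 := by
  intro h
  have h2 : ‖completedRiemannZeta₀ (1 / 2 + x)‖ ≤ 1 :=
    norm_completedRiemannZeta₀_le (by simp; linarith) (by simp; linarith)
  have h3 : ‖((x : ℂ) ^ 2 - 1 / 4)‖ ≤ 1 / 4 := by
    have : ((x : ℂ) ^ 2 - 1 / 4) = ((x ^ 2 - 1 / 4 : ℝ) : ℂ) := by push_cast; ring
    rw [this, Complex.norm_real, Real.norm_eq_abs, abs_le]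
    constructor <;> nlinarith
  have h4 : ‖((x : ℂ) ^ 2 - 1 / 4) * completedRiemannZeta₀ (1 / 2 + x)‖ = 1 := by
    rw [xiHalf] at h
    rw [eq_neg_of_add_eq_zero_right h]
    simp
  rw [norm_mul] at h4
  nlinarith [norm_nonneg ((x : ℂ) ^ 2 - 1 / 4), norm_nonneg (completedRiemannZeta₀ (1 / 2 + x))]

theorem xiHalf_zero_ne_zero : xiHalf 0 ≠ 0 := by
  simpa using xiHalf_ofReal_ne_zero (x := 0) (by norm_num) (by norm_num)

theorem xiHalf_ne_zero_of_half_le_re {z : ℂ} (hz : 1 / 2 ≤ z.re) : xiHalf z ≠ 0 := by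
  rcases eq_or_ne z (1 / 2) with rfl | h0
  · norm_num [xiHalf]
  · have hre : 0 < (1 / 2 + z).re := by simp; linarith
    rw [xiHalf_eq_mul_riemannZeta h0 hre]
    refine mul_ne_zero (mul_ne_zero ?_ (Complex.Gammaℝ_ne_zero_of_re_pos hre))
      (riemannZeta_ne_zero_of_one_le_re (by simp; linarith))
    rw [show z ^ 2 - 1 / 4 = (z - 1 / 2) * (z + 1 / 2) by ring]
    refine mul_ne_zero (sub_ne_zero.mpr h0) fun h => ?_
    have := congrArg Complex.re h
    simp at this
    linarith

theorem xiHalf_eq_zero_re_lt {z : ℂ} (hz : xiHalf z = 0) : -(1 / 2) < z.re ∧ z.re < 1 / 2 := by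
  constructor
  · by_contra h
    refine xiHalf_ne_zero_of_half_le_re (z := -z) ?_ (by rwa [xiHalf_neg])
    simp only [Complex.neg_re]
    linarith
  · by_contra h
    exact xiHalf_ne_zero_of_half_le_re (not_lt.mp h) hz

theorem xiHalf_eq_zero_im_ne {z : ℂ} (hz : xiHalf z = 0) : z.im ≠ 0 := by
  intro h
  obtain ⟨h1, h2⟩ := xiHalf_eq_zero_re_lt hz
  have : z = (z.re : ℂ) := by apply Complex.ext <;> simp [h]
  rw [this] at hz
  exact xiHalf_ofReal_ne_zero h1.le h2.le hz

end XiFunction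

/-! ### Growth of ξ. -/

section XiGrowth

open Set MeasureTheory

theorem norm_Gamma_le_Gamma_re {s : ℂ} (hs : 0 < s.re) : ‖Complex.Gamma s‖ ≤ Real.Gamma s.re := by
  rw [Complex.Gamma_eq_integral hs, Real.Gamma_eq_integral hs]
  refine norm_integral_le_of_norm_le (Real.GammaIntegral_convergent hs) ?_
  filter_upwards [ae_restrict_mem measurableSet_Ioi] with x hx
  rw [norm_mul, Complex.norm_cpow_eq_rpow_re_of_pos hx, Complex.norm_real,
    Real.norm_of_nonneg (Real.exp_pos _).le]
  simp

/-- Comparison with a factorial gives Γ(x) ≤ y^y with y = x + 2, and log y ≤ y^(p-1) / (p-1). -/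
theorem Gamma_le_exp_rpow {x p : ℝ} (hx : 1 ≤ x) (hp : 1 < p) :
    Real.Gamma x ≤ Real.exp ((x + 2) ^ p / (p - 1)) := by
  have h1 : Real.Gamma x ≤ Real.Gamma (x + 1) := by
    rw [Real.Gamma_add_one (by linarith)]
    exact le_mul_of_one_le_left (Real.Gamma_pos_of_pos (by linarith)).le hx
  set n := ⌈x⌉₊ + 1 with hn
  have hnx : x ≤ ⌈x⌉₊ := Nat.le_ceil x
  have hn2 : (n : ℝ) ≤ x + 2 := by
    have := (Nat.ceil_lt_add_one (by linarith : 0 ≤ x)).le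
    rw [hn]; push_cast; linarith
  have h2 : Real.Gamma (x + 1) ≤ Real.Gamma (n + 1) := by
    refine Real.Gamma_strictMonoOn_Ici.monotoneOn ?_ ?_ ?_ <;> simp only [mem_Ici, hn] <;>
      push_cast <;> linarith
  rw [Real.Gamma_nat_eq_factorial] at h2
  have h3 : (n.factorial : ℝ) ≤ (n : ℝ) ^ n := by exact_mod_cast n.factorial_le_pow
  have h4 : (n : ℝ) ^ n ≤ (x + 2) ^ (x + 2) := by
    rw [← Real.rpow_natCast]
    calc (n : ℝ) ^ (n : ℝ) ≤ (x + 2) ^ (n : ℝ) := by gcongr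
      _ ≤ _ := Real.rpow_le_rpow_of_exponent_le (by linarith) hn2
  refine h1.trans (h2.trans (h3.trans (h4.trans ?_)))
  have hpos : 0 < x + 2 := by linarith
  rw [Real.rpow_def_of_pos hpos, Real.exp_le_exp]
  have h5 := Real.log_le_rpow_div hpos.le (sub_pos.mpr hp)
  calc Real.log (x + 2) * (x + 2) ≤ (x + 2) ^ (p - 1) / (p - 1) * (x + 2) := by gcongr
    _ = (x + 2) ^ p / (p - 1) := by
      rw [div_mul_eq_mul_div, ← Real.rpow_add_one hpos.ne']
      ring_nf

theorem exists_norm_riemannZeta_le : ∃ C : ℝ, ∀ s : ℂ, 2 ≤ s.re → ‖riemannZeta s‖ ≤ C := by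
  refine ⟨∑' n : ℕ, 1 / ((n : ℝ) + 1) ^ (2 : ℝ), fun s hs => ?_⟩
  rw [zeta_eq_tsum_one_div_nat_add_one_cpow (by linarith)]
  have hsum : Summable fun n : ℕ => 1 / ((n : ℝ) + 1) ^ (2 : ℝ) := by
    have := (summable_nat_add_iff 1).mpr (Real.summable_one_div_nat_rpow.mpr one_lt_two)
    simpa using this
  refine tsum_of_norm_bounded hsum.hasSum fun n => ?_
  have e : ((n : ℂ) + 1) = (((n : ℝ) + 1 : ℝ) : ℂ) := by push_cast; rfl
  have h0 : (0 : ℝ) ≤ n := Nat.cast_nonneg n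
  rw [norm_div, e, Complex.norm_cpow_eq_rpow_re_of_pos (by positivity), norm_one]
  gcongr
  linarith

/-- `ξ` is an entire function of order one. -/
theorem exists_norm_xiHalf_le {p : ℝ} (hp : 1 < p) :
    ∃ K : ℝ, 0 ≤ K ∧ ∀ z, ‖xiHalf z‖ ≤ Real.exp (K * (1 + ‖z‖) ^ p) := by
  obtain ⟨C, hC⟩ := exists_norm_riemannZeta_le
  have hp1 : 0 < p - 1 := sub_pos.mpr hp
  refine ⟨2 + (|C| + 3 ^ p / (p - 1)), by positivity, ?_⟩
  have hquad : ∀ y : ℝ, 0 ≤ y → 1 + (y ^ 2 + 1 / 4) ≤ Real.exp (2 * (1 + y) ^ p) := by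
    intro y hy
    have h1 := Real.add_one_le_exp (1 + y)
    have h2 : 1 + y ≤ (1 + y) ^ p := by
      calc 1 + y = (1 + y) ^ (1 : ℝ) := (Real.rpow_one _).symm
        _ ≤ _ := Real.rpow_le_rpow_of_exponent_le (by linarith) hp.le
    calc 1 + (y ^ 2 + 1 / 4) ≤ Real.exp (1 + y) * Real.exp (1 + y) := by nlinarith
      _ = Real.exp (2 * (1 + y)) := by rw [← Real.exp_add]; ring_nf
      _ ≤ _ := by gcongr
  suffices H : ∀ z : ℂ, 0 ≤ z.re →
      ‖xiHalf z‖ ≤ Real.exp ((2 + (|C| + 3 ^ p / (p - 1))) * (1 + ‖z‖) ^ p) by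
    intro z
    rcases le_total 0 z.re with h | h
    · exact H z h
    · rw [← xiHalf_neg, ← norm_neg z]
      exact H (-z) (by simpa using h)
  intro z hz
  have hz0 := norm_nonneg z
  have h1 : 1 ≤ (1 + ‖z‖) ^ p := Real.one_le_rpow (by linarith) (by linarith)
  have h2 : ‖z ^ 2 - 1 / 4‖ ≤ ‖z‖ ^ 2 + 1 / 4 := by
    refine (norm_sub_le _ _).trans ?_
    simp [norm_pow]
  have h3 := hquad ‖z‖ hz0
  -- By evenness Re z ≥ 0. Up to Re s = 2, where s = 1/2 + z, the bound for Λ₀ applies; beyond it ζ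
  -- is bounded and the gamma factor dominates.
  rcases le_total z.re (3 / 2) with h | h
  · have h4 : ‖completedRiemannZeta₀ (1 / 2 + z)‖ ≤ 1 :=
      norm_completedRiemannZeta₀_le (by simp; linarith) (by simp; linarith)
    calc ‖xiHalf z‖ ≤ ‖(1 : ℂ)‖ + ‖(z ^ 2 - 1 / 4) * completedRiemannZeta₀ (1 / 2 + z)‖ :=
          norm_add_le _ _
      _ ≤ 1 + (‖z‖ ^ 2 + 1 / 4) * 1 := by rw [norm_one, norm_mul]; gcongr
      _ ≤ Real.exp (2 * (1 + ‖z‖) ^ p) := by linarith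
      _ ≤ _ := by
        gcongr
        have : 0 ≤ 3 ^ p / (p - 1) := by positivity
        linarith [abs_nonneg C]
  · have hre : (1 / 2 + z).re = 1 / 2 + z.re := by simp
    rw [xiHalf_eq_mul_riemannZeta (fun h' => by rw [h'] at h; norm_num at h) (by rw [hre]; linarith),
      norm_mul, norm_mul, Complex.Gammaℝ_def, norm_mul]
    have hx : ((1 / 2 + z) / 2).re = (1 / 2 + z.re) / 2 := by simp
    have h4 : ‖((Real.pi : ℝ) : ℂ) ^ (-(1 / 2 + z) / 2)‖ ≤ 1 := by
      rw [Complex.norm_cpow_eq_rpow_re_of_pos Real.pi_pos]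
      refine Real.rpow_le_one_of_one_le_of_nonpos (by linarith [Real.pi_gt_three]) ?_
      rw [neg_div, Complex.neg_re, hx]
      linarith
    have h5 : ‖Complex.Gamma ((1 / 2 + z) / 2)‖ ≤ Real.exp (3 ^ p / (p - 1) * (1 + ‖z‖) ^ p) := by
      refine (norm_Gamma_le_Gamma_re (by rw [hx]; linarith)).trans ?_
      rw [hx]
      refine (Gamma_le_exp_rpow (by linarith) hp).trans ?_
      rw [Real.exp_le_exp, div_mul_eq_mul_div, ← Real.mul_rpow (by norm_num) (by linarith)]
      have := Complex.re_le_norm z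
      gcongr
      linarith
    have h6 : ‖riemannZeta (1 / 2 + z)‖ ≤ Real.exp (|C| * (1 + ‖z‖) ^ p) := by
      refine (hC _ (by rw [hre]; linarith)).trans ((le_abs_self C).trans ?_)
      refine (Real.add_one_le_exp |C|).trans' (by linarith) |>.trans ?_
      rw [Real.exp_le_exp]
      nlinarith [abs_nonneg C]
    calc _ ≤ Real.exp (2 * (1 + ‖z‖) ^ p) * (1 * Real.exp (3 ^ p / (p - 1) * (1 + ‖z‖) ^ p)) *
          Real.exp (|C| * (1 + ‖z‖) ^ p) := by
          gcongr
          exact h2.trans (by linarith)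
      _ = _ := by rw [one_mul, ← Real.exp_add, ← Real.exp_add]; ring_nf

end XiGrowth

/-! ### The zeros of ξ and the partial fractions over pairs of zeros. -/

section XiZeros

/-- In the open critical strip the factor (z² - 1/4) Γ_ℝ(1/2 + z) is analytic without zeros, so it
does not change orders of vanishing. -/
theorem analyticOrderNatAt_xiHalf_eq {z : ℂ} (h1 : 0 < (1 / 2 + z).re) (h2 : (1 / 2 + z).re < 1) :
    analyticOrderNatAt xiHalf z = analyticOrderNatAt riemannZeta (1 / 2 + z) := by
  have hne : z ≠ 1 / 2 := fun h => by rw [h] at h2; norm_num at h2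
  have hne' : z + 1 / 2 ≠ 0 := fun h => by rw [add_comm, h] at h1; simp at h1
  set F : ℂ → ℂ := fun z => (z ^ 2 - 1 / 4) * Complex.Gammaℝ (1 / 2 + z)
  have hopen : IsOpen {z : ℂ | 0 < (1 / 2 + z).re} :=
    isOpen_lt continuous_const (by fun_prop)
  have hF : AnalyticAt ℂ F z := by
    refine DifferentiableOn.analyticAt (s := {z : ℂ | 0 < (1 / 2 + z).re}) (fun w hw => ?_)
      (hopen.mem_nhds h1)
    have : DifferentiableAt ℂ Complex.Gammaℝ (1 / 2 + w) := by
      have h := (Complex.differentiable_Gammaℝ_inv (1 / 2 + w)).inv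
        (inv_ne_zero (Complex.Gammaℝ_ne_zero_of_re_pos hw))
      have e : (fun s => (Complex.Gammaℝ s)⁻¹)⁻¹ = Complex.Gammaℝ := by ext; simp
      rwa [e] at h
    exact ((by fun_prop : DifferentiableAt ℂ (fun z : ℂ => z ^ 2 - 1 / 4) w).mul
      (this.comp w (by fun_prop))).differentiableWithinAt
  have hF0 : F z ≠ 0 := by
    refine mul_ne_zero ?_ (Complex.Gammaℝ_ne_zero_of_re_pos h1)
    rw [show z ^ 2 - 1 / 4 = (z - 1 / 2) * (z + 1 / 2) by ring]
    exact mul_ne_zero (sub_ne_zero.mpr hne) hne'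
  have hs1 : 1 / 2 + z ≠ 1 := fun h => by rw [h] at h2; simp at h2
  have hζ : AnalyticAt ℂ riemannZeta (1 / 2 + z) := analyticOn_riemannZeta _ hs1
  have hg : AnalyticAt ℂ (fun z : ℂ => 1 / 2 + z) z := by fun_prop
  have hg' : deriv (fun z : ℂ => 1 / 2 + z) z ≠ 0 := by simp
  have heq : xiHalf =ᶠ[𝓝 z] F • (riemannZeta ∘ fun z : ℂ => 1 / 2 + z) := by
    filter_upwards [hopen.mem_nhds h1, isOpen_ne.mem_nhds hne] with w hw hw'
    simp [F, xiHalf_eq_mul_riemannZeta hw' hw]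
  have : analyticOrderAt xiHalf z = analyticOrderAt riemannZeta (1 / 2 + z) := by
    rw [analyticOrderAt_congr heq, analyticOrderAt_smul hF (hζ.comp hg),
      hF.analyticOrderAt_eq_zero.mpr hF0, zero_add, analyticOrderAt_comp_of_deriv_ne_zero hg hg']
  simp [analyticOrderNatAt, this]

theorem analyticOrderNatAt_xiHalf_neg (z : ℂ) :
    analyticOrderNatAt xiHalf (-z) = analyticOrderNatAt xiHalf z := by
  have h := analyticOrderAt_comp_of_deriv_ne_zero (f := xiHalf) (g := fun z : ℂ => -z) (z₀ := z)
    (by fun_prop) (by simp)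
  have e : xiHalf ∘ (fun z : ℂ => -z) = xiHalf := funext xiHalf_neg
  rw [e] at h
  simp [analyticOrderNatAt, h]

theorem upperZeros_iff {ρ : ℂ} : ρ ∈ upperZeros ↔ xiHalf (ρ - 1 / 2) = 0 ∧ 0 < ρ.im := by
  constructor
  · rintro ⟨h0, h1, h2, h3⟩
    refine ⟨?_, h3⟩
    rw [xiHalf_eq_mul_riemannZeta (fun h => by
      have := congrArg Complex.im h; simp at this; linarith) (by simpa using h1)]
    simp [h0]
  · rintro ⟨h0, h3⟩
    obtain ⟨h1, h2⟩ := xiHalf_eq_zero_re_lt h0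
    simp only [Complex.sub_re] at h1 h2
    norm_num at h1 h2
    refine ⟨?_, by linarith, by linarith, h3⟩
    have hne : ρ - 1 / 2 ≠ 1 / 2 := fun h => by
      have := congrArg Complex.im h; simp at this; linarith
    have hpos : 0 < (1 / 2 + (ρ - 1 / 2)).re := by
      rw [add_sub_cancel]
      linarith
    have hX := xiHalf_eq_mul_riemannZeta hne hpos
    rw [h0, add_sub_cancel] at hX
    rw [add_sub_cancel] at hpos
    have h4 : (ρ - 1 / 2) ^ 2 - 1 / 4 ≠ 0 := by
      rw [show (ρ - 1 / 2) ^ 2 - 1 / 4 = ρ * (ρ - 1) by ring]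
      refine mul_ne_zero (fun h => ?_) (fun h => ?_)
      · rw [h] at h3; simp at h3
      · rw [sub_eq_zero.mp h] at h3; simp at h3
    rcases mul_eq_zero.mp hX.symm with h | h
    · exact absurd h (mul_ne_zero h4 (Complex.Gammaℝ_ne_zero_of_re_pos hpos))
    · exact h

/-- The zeros of `ξ(1/2 + z)` are the points `± (ρ - 1/2)` with `ρ` in the upper half-plane. -/
noncomputable def xiZerosEquiv : upperZeros ⊕ upperZeros ≃ {a : ℂ // xiHalf a = 0} where
  toFun := Sum.elim (fun ρ => ⟨ρ - 1 / 2, (upperZeros_iff.mp ρ.2).1⟩)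
    (fun ρ => ⟨-(ρ - 1 / 2), by rw [xiHalf_neg]; exact (upperZeros_iff.mp ρ.2).1⟩)
  invFun a := if h : 0 < (a : ℂ).im
    then Sum.inl ⟨a + 1 / 2, upperZeros_iff.mpr ⟨by simpa using a.2, by simpa using h⟩⟩
    else Sum.inr ⟨-a + 1 / 2, upperZeros_iff.mpr
      ⟨by simpa [xiHalf_neg] using a.2, by
        have := lt_of_le_of_ne (not_lt.mp h) (xiHalf_eq_zero_im_ne a.2)
        simpa using this⟩⟩
  left_inv := by
    rintro (ρ | ρ)
    · have := (upperZeros_iff.mp ρ.2).2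
      simp [this]
    · have := (upperZeros_iff.mp ρ.2).2
      simp [this.not_gt]
  right_inv := by
    intro a
    by_cases h : 0 < (a : ℂ).im
    · simp [h]
    · simp [h]

/-- The multiplicity of a zero of the zeta function. -/
noncomputable abbrev zeroMult (ρ : upperZeros) : ℕ := analyticOrderNatAt riemannZeta (ρ : ℂ)

theorem analyticOrderNatAt_xiHalf_sub_half (ρ : upperZeros) :
    analyticOrderNatAt xiHalf ((ρ : ℂ) - 1 / 2) = zeroMult ρ := by
  rw [analyticOrderNatAt_xiHalf_eq] <;> rw [add_sub_cancel]
  · exact ρ.2.2.1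
  · exact ρ.2.2.2.1

theorem sub_half_eq_I_mul_tau (ρ : ℂ) : ρ - 1 / 2 = Complex.I * tau ρ := by
  rw [tau, mul_div_cancel₀ _ Complex.I_ne_zero]

theorem norm_tau (ρ : ℂ) : ‖tau ρ‖ = ‖ρ - 1 / 2‖ := by
  rw [sub_half_eq_I_mul_tau, norm_mul, Complex.norm_I, one_mul]

theorem tau_re (ρ : ℂ) : (tau ρ).re = ρ.im := by
  simp [tau, Complex.div_I]

theorem tau_im (ρ : ℂ) : (tau ρ).im = 1 / 2 - ρ.re := by
  simp [tau, Complex.div_I]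

theorem tau_re_pos (ρ : upperZeros) : 0 < (tau ρ).re := by
  rw [tau_re]; exact ρ.2.2.2.2

theorem summable_zeroMult_mul_rpow {q : ℝ} (hq : 1 < q) :
    Summable fun ρ : upperZeros => (zeroMult ρ : ℝ) * ‖tau ρ‖ ^ (-q) := by
  obtain ⟨p, hp1, hpq⟩ := exists_between hq
  obtain ⟨K, hK, hgrow⟩ := exists_norm_xiHalf_le hp1
  have h := summable_order_mul_norm_rpow differentiable_xiHalf xiHalf_zero_ne_zero hK
    (by linarith) hpq hgrow
  have h2 := (h.comp_injective xiZerosEquiv.injective).comp_injective Sum.inl_injective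
  refine h2.congr fun ρ => ?_
  simp only [xiZerosEquiv, Function.comp, Equiv.coe_fn_mk, Sum.elim_inl, norm_tau,
    analyticOrderNatAt_xiHalf_sub_half]

/-- The partial fraction expansion of the logarithmic derivative of `ξ` over pairs of zeros. -/
theorem hasSum_zeroMult_logDeriv_xiHalf {z : ℂ} (hz : xiHalf z ≠ 0) :
    HasSum (fun ρ : upperZeros => (zeroMult ρ : ℂ) * (2 * z / (z ^ 2 + tau ρ ^ 2)))
      (logDeriv xiHalf z) := by
  obtain ⟨K, hK, hgrow⟩ := exists_norm_xiHalf_le (p := 3 / 2) (by norm_num)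
  have h := hasSum_order_mul_logDeriv differentiable_xiHalf xiHalf_zero_ne_zero hK
    (by norm_num) (by norm_num) hgrow hz
  -- An even function has vanishing derivative at 0, so the normalising constant of the expansion
  -- drops out.
  have hd0 : logDeriv xiHalf 0 = 0 := by
    have h1 : deriv xiHalf 0 = 0 := by
      have h2 : deriv (fun z => xiHalf (-z)) 0 = -deriv xiHalf (-0) := deriv_comp_neg xiHalf 0
      simp only [xiHalf_neg, neg_zero] at h2
      linear_combination (1 / 2 : ℂ) * h2
    rw [logDeriv_apply, h1, zero_div]
  rw [hd0, sub_zero, ← xiZerosEquiv.hasSum_iff] at h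
  have hl := (h.summable.comp_injective Sum.inl_injective).hasSum
  have hr := (h.summable.comp_injective Sum.inr_injective).hasSum
  have hu := h.unique (hl.sum hr)
  rw [hu]
  refine (hl.add hr).congr_fun fun ρ => ?_
  have hmult := analyticOrderNatAt_xiHalf_sub_half ρ
  have hρ0 := (upperZeros_iff.mp ρ.2).1
  have h1 : z - ((ρ : ℂ) - 1 / 2) ≠ 0 := fun h => hz (by rw [sub_eq_zero.mp h, hρ0])
  have h2 : z - -((ρ : ℂ) - 1 / 2) ≠ 0 := fun h => hz (by
    rw [sub_eq_zero.mp h, xiHalf_neg, hρ0])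
  -- For a pair ± a the terms 1/a cancel and the rest is 2z / (z² - a²), with a = iτ.
  have h3 : z ^ 2 + tau ρ ^ 2 = (z - ((ρ : ℂ) - 1 / 2)) * (z - -((ρ : ℂ) - 1 / 2)) := by
    rw [sub_half_eq_I_mul_tau]
    linear_combination ((tau ρ) ^ 2) * Complex.I_sq
  simp only [xiZerosEquiv, Function.comp, Equiv.coe_fn_mk, Sum.elim_inl, Sum.elim_inr,
    analyticOrderNatAt_xiHalf_neg, hmult]
  rw [h3, one_div_neg_eq_neg_one_div]
  generalize (ρ : ℂ) - 1 / 2 = a at *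
  field_simp
  ring

end XiZeros

/-! ### The digamma series and ξ'/ξ to the right of the strip. -/

section Digamma

open Set

/-- The derivative of `log Γ` on the positive reals. -/
noncomputable def realDigamma (x : ℝ) : ℝ := deriv (Real.log ∘ Real.Gamma) x

theorem differentiableAt_log_Gamma {x : ℝ} (hx : 0 < x) :
    DifferentiableAt ℝ (Real.log ∘ Real.Gamma) x := by
  refine (Real.differentiableAt_log (Real.Gamma_pos_of_pos hx).ne').comp x
    (Real.differentiableAt_Gamma fun m h => ?_)
  have : (0 : ℝ) ≤ m := Nat.cast_nonneg m
  linarith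

theorem monotoneOn_realDigamma : MonotoneOn realDigamma (Ioi 0) :=
  Real.convexOn_log_Gamma.monotoneOn_deriv fun _ hx => differentiableAt_log_Gamma hx

theorem realDigamma_add_one {x : ℝ} (hx : 0 < x) : realDigamma (x + 1) = realDigamma x + 1 / x := by
  have h1 : HasDerivAt (fun y => (Real.log ∘ Real.Gamma) (y + 1)) (realDigamma (x + 1)) x :=
    (differentiableAt_log_Gamma (by linarith : 0 < x + 1)).hasDerivAt.comp_add_const x 1
  have h2 : HasDerivAt (fun y => (Real.log ∘ Real.Gamma) y + Real.log y)
      (realDigamma x + 1 / x) x := by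
    rw [one_div]
    exact (differentiableAt_log_Gamma hx).hasDerivAt.add (Real.hasDerivAt_log hx.ne')
  refine h1.unique (h2.congr_of_eventuallyEq ?_)
  filter_upwards [lt_mem_nhds hx] with y hy
  rw [Function.comp, Function.comp, Real.Gamma_add_one hy.ne',
    Real.log_mul hy.ne' (Real.Gamma_pos_of_pos hy).ne']
  ring

theorem realDigamma_add_nat {x : ℝ} (hx : 0 < x) (n : ℕ) :
    realDigamma (x + n) = realDigamma x + ∑ k ∈ Finset.range n, 1 / (x + k) := by
  induction n with
  | zero => simp
  | succ n ih =>
    have h0 : (0 : ℝ) ≤ n := Nat.cast_nonneg n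
    rw [Finset.sum_range_succ, ← add_assoc, ← ih, ← realDigamma_add_one (by linarith)]
    push_cast
    ring_nf

/-- Log-convexity of Γ makes the digamma function increasing. The difference is therefore
nonnegative and is at most its increment over N ≥ x - y unit steps, which is bounded by N / (y + n).
-/
theorem tendsto_realDigamma_sub {x y : ℝ} (hy : 0 < y) (hyx : y ≤ x) :
    Tendsto (fun n : ℕ => realDigamma (x + n) - realDigamma (y + n)) atTop (𝓝 0) := by
  obtain ⟨N, hN⟩ := exists_nat_ge (x - y)
  have hlim : Tendsto (fun n : ℕ => (N : ℝ) * (1 / (y + n))) atTop (𝓝 0) := by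
    have : Tendsto (fun n : ℕ => 1 / (y + (n : ℝ))) atTop (𝓝 0) := by
      simp only [one_div]
      exact (tendsto_atTop_add_const_left _ y tendsto_natCast_atTop_atTop).inv_tendsto_atTop
    simpa using this.const_mul (N : ℝ)
  refine squeeze_zero (fun n => ?_) (fun n => ?_) hlim
  · have h0 : (0 : ℝ) ≤ n := Nat.cast_nonneg n
    rw [sub_nonneg]
    exact monotoneOn_realDigamma (mem_Ioi.mpr (by linarith)) (mem_Ioi.mpr (by linarith))
      (by linarith)
  · have h0 : (0 : ℝ) ≤ n := Nat.cast_nonneg n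
    have h1 : realDigamma (x + n) ≤ realDigamma (y + n + N) :=
      monotoneOn_realDigamma (mem_Ioi.mpr (by linarith)) (mem_Ioi.mpr (by linarith))
        (by linarith)
    rw [realDigamma_add_nat (x := y + n) (by linarith)] at h1
    have h2 : ∑ k ∈ Finset.range N, 1 / (y + n + k) ≤ ∑ k ∈ Finset.range N, 1 / (y + n) := by
      refine Finset.sum_le_sum fun k _ => ?_
      have : (0 : ℝ) ≤ k := Nat.cast_nonneg k
      exact one_div_le_one_div_of_le (by linarith) (by linarith)
    simp only [Finset.sum_const, Finset.card_range, nsmul_eq_mul] at h2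
    linarith

theorem hasSum_realDigamma_sub {x y : ℝ} (hy : 0 < y) (hyx : y ≤ x) :
    HasSum (fun k : ℕ => 1 / (y + k) - 1 / (x + k)) (realDigamma x - realDigamma y) := by
  rw [hasSum_iff_tendsto_nat_of_nonneg]
  · have := (tendsto_realDigamma_sub hy hyx).const_sub (realDigamma x - realDigamma y)
    rw [sub_zero] at this
    refine this.congr fun n => ?_
    rw [realDigamma_add_nat hy, realDigamma_add_nat (hy.trans_le hyx), Finset.sum_sub_distrib]
    ring
  · intro k
    have : (0 : ℝ) ≤ k := Nat.cast_nonneg k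
    rw [sub_nonneg]
    gcongr

theorem digamma_ofReal {x : ℝ} (hx : 0 < x) : Complex.digamma x = realDigamma x := by
  have h1 : HasDerivAt Complex.Gamma (deriv Complex.Gamma x) (x : ℂ) := by
    refine (Complex.differentiableAt_Gamma _ fun m h => ?_).hasDerivAt
    have := congrArg Complex.re h
    have h0 : (0 : ℝ) ≤ m := Nat.cast_nonneg m
    simp at this
    linarith
  have h2 : HasDerivAt (fun y : ℝ => ((Real.Gamma y : ℝ) : ℂ)) (deriv Complex.Gamma x) x := by
    simpa [Complex.Gamma_ofReal] using h1.comp_ofReal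
  have h3 : HasDerivAt Real.Gamma (deriv Real.Gamma x) x := by
    refine (Real.differentiableAt_Gamma fun m h => ?_).hasDerivAt
    have h0 : (0 : ℝ) ≤ m := Nat.cast_nonneg m
    linarith
  have h4 := h2.unique h3.ofReal_comp
  have h5 : realDigamma x = deriv Real.Gamma x / Real.Gamma x :=
    (h3.log (Real.Gamma_pos_of_pos hx).ne').deriv
  rw [Complex.digamma_def, logDeriv_apply, h4, Complex.Gamma_ofReal, h5]
  push_cast
  rfl

/-- The term is 1/x - 1/(x + t) with x = 2(k + 1/4); taking out the 2 leaves half the series for a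
difference of digamma values. -/
theorem hasSum_div_two_mul_add_half {t : ℝ} (ht : 0 ≤ t) :
    HasSum (fun k : ℕ => t / ((2 * k + 1 / 2) * (t + (2 * k + 1 / 2))))
      ((realDigamma ((1 / 2 + t) / 2) - realDigamma (1 / 4)) / 2) := by
  have := (hasSum_realDigamma_sub (x := (1 / 2 + t) / 2) (y := 1 / 4) (by norm_num)
    (by linarith)).div_const 2
  refine this.congr_fun fun k => ?_
  have h0 : (0 : ℝ) ≤ k := Nat.cast_nonneg k
  have h1 : (2 * (k : ℝ) + 1 / 2) ≠ 0 := by positivity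
  have h2 : (t + (2 * (k : ℝ) + 1 / 2)) ≠ 0 := by positivity
  have h3 : (1 / 4 + (k : ℝ)) = (2 * k + 1 / 2) / 2 := by ring
  have h4 : ((1 / 2 + t) / 2 + (k : ℝ)) = (t + (2 * k + 1 / 2)) / 2 := by ring
  rw [h3, h4]
  generalize (2 * (k : ℝ) + 1 / 2) = x at *
  field_simp
  ring

theorem logDeriv_Gammaℝ {s : ℂ} (hs : 0 < s.re) :
    logDeriv Complex.Gammaℝ s = -(Real.log Real.pi : ℝ) / 2 + Complex.digamma (s / 2) / 2 := by
  have hpi : ((Real.pi : ℝ) : ℂ) ≠ 0 := by exact_mod_cast Real.pi_ne_zero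
  have hs2 : 0 < (s / 2).re := by simpa using hs
  have hdG : DifferentiableAt ℂ Complex.Gamma (s / 2) := by
    refine Complex.differentiableAt_Gamma _ fun m h => ?_
    have h0 : (0 : ℝ) ≤ m := Nat.cast_nonneg m
    rw [h] at hs2
    simp at hs2
    linarith
  have hd1 : HasDerivAt (fun s : ℂ => ((Real.pi : ℝ) : ℂ) ^ (-s / 2))
      (((Real.pi : ℝ) : ℂ) ^ (-s / 2) * Complex.log Real.pi * (-1 / 2)) s :=
    (((hasDerivAt_id s).neg.div_const 2).const_cpow (Or.inl hpi))
  have hd2 : HasDerivAt (fun s : ℂ => Complex.Gamma (s / 2))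
      (deriv Complex.Gamma (s / 2) * (1 / 2)) s :=
    hdG.hasDerivAt.comp s ((hasDerivAt_id s).div_const 2)
  have hne : ((Real.pi : ℝ) : ℂ) ^ (-s / 2) ≠ 0 := by
    rw [Ne, Complex.cpow_eq_zero_iff]; tauto
  have e : Complex.Gammaℝ =
      fun s : ℂ => ((Real.pi : ℝ) : ℂ) ^ (-s / 2) * Complex.Gamma (s / 2) := rfl
  rw [e, logDeriv_mul (f := fun s : ℂ => ((Real.pi : ℝ) : ℂ) ^ (-s / 2))
    (g := fun s : ℂ => Complex.Gamma (s / 2)) s hne (Complex.Gamma_ne_zero_of_re_pos hs2) hd1.differentiableAt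
    hd2.differentiableAt, logDeriv_apply, logDeriv_apply, hd1.deriv, hd2.deriv,
    Complex.digamma_def, logDeriv_apply, Complex.ofReal_log Real.pi_pos.le]
  field_simp

/-- The logarithmic derivative of `ξ` to the right of the critical strip. -/
theorem logDeriv_xiHalf_ofReal {t : ℝ} (ht : 1 / 2 < t) :
    logDeriv xiHalf t = 1 / ((t : ℂ) + 1 / 2) + 1 / ((t : ℂ) - 1 / 2) +
      (-(Real.log Real.pi : ℝ) / 2 + Complex.digamma ((1 / 2 + t) / 2) / 2) +
      logDeriv riemannZeta (1 / 2 + t) := by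
  have hre : (1 / 2 + (t : ℂ)).re = 1 / 2 + t := by simp
  have hne1 : (t : ℂ) - 1 / 2 ≠ 0 := fun h => by
    have := congrArg Complex.re h
    simp at this
    linarith
  have hne2 : (t : ℂ) + 1 / 2 ≠ 0 := fun h => by
    have := congrArg Complex.re h
    simp at this
    linarith
  have hpos : 0 < (1 / 2 + (t : ℂ)).re := by rw [hre]; linarith
  have hs1 : (1 / 2 + (t : ℂ)) ≠ 1 := fun h => by
    have := congrArg Complex.re h
    rw [hre] at this
    simp at this
    linarith
  have hG0 := Complex.Gammaℝ_ne_zero_of_re_pos hpos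
  have hdG : DifferentiableAt ℂ Complex.Gammaℝ (1 / 2 + (t : ℂ)) := by
    have h := (Complex.differentiable_Gammaℝ_inv (1 / 2 + (t : ℂ))).inv (inv_ne_zero hG0)
    have e : (fun s => (Complex.Gammaℝ s)⁻¹)⁻¹ = Complex.Gammaℝ := by ext; simp
    rwa [e] at h
  have hζ0 : riemannZeta (1 / 2 + (t : ℂ)) ≠ 0 :=
    riemannZeta_ne_zero_of_one_le_re (by rw [hre]; linarith)
  have hopen : IsOpen {z : ℂ | 0 < (1 / 2 + z).re} :=
    isOpen_lt continuous_const (by fun_prop)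
  have heq : xiHalf =ᶠ[𝓝 (t : ℂ)] fun z => ((z + 1 / 2) * (z - 1 / 2) *
      Complex.Gammaℝ (1 / 2 + z)) * riemannZeta (1 / 2 + z) := by
    filter_upwards [hopen.mem_nhds hpos, isOpen_ne.mem_nhds (sub_ne_zero.mp hne1)] with z hz hz'
    rw [xiHalf_eq_mul_riemannZeta hz' hz]
    ring
  have hd1 : DifferentiableAt ℂ (fun z : ℂ => Complex.Gammaℝ (1 / 2 + z)) t :=
    hdG.comp (t : ℂ) (by fun_prop)
  have hd2 : DifferentiableAt ℂ (fun z : ℂ => riemannZeta (1 / 2 + z)) t :=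
    (differentiableAt_riemannZeta hs1).comp (t : ℂ) (by fun_prop)
  have hshift : ∀ f : ℂ → ℂ, logDeriv (fun z => f (1 / 2 + z)) (t : ℂ) =
      logDeriv f (1 / 2 + t) := fun f => by
    rw [logDeriv_apply, logDeriv_apply, deriv_comp_const_add]
  have e1 : logDeriv xiHalf t = logDeriv (fun z => ((z + 1 / 2) * (z - 1 / 2) *
      Complex.Gammaℝ (1 / 2 + z)) * riemannZeta (1 / 2 + z)) (t : ℂ) := by
    rw [logDeriv_apply, logDeriv_apply, heq.deriv_eq, heq.self_of_nhds]
  rw [e1, logDeriv_mul (f := fun z : ℂ => (z + 1 / 2) * (z - 1 / 2) * Complex.Gammaℝ (1 / 2 + z))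
      (g := fun z => riemannZeta (1 / 2 + z)) (t : ℂ) (mul_ne_zero (mul_ne_zero hne2 hne1) hG0) hζ0
      ((by fun_prop : DifferentiableAt ℂ (fun z : ℂ => (z + 1 / 2) * (z - 1 / 2)) t).mul hd1) hd2,
    logDeriv_mul (f := fun z : ℂ => (z + 1 / 2) * (z - 1 / 2))
      (g := fun z => Complex.Gammaℝ (1 / 2 + z)) (t : ℂ) (mul_ne_zero hne2 hne1) hG0 (by fun_prop) hd1,
    logDeriv_mul (f := fun z : ℂ => z + 1 / 2) (g := fun z : ℂ => z - 1 / 2) (t : ℂ) hne2 hne1 (by fun_prop) (by fun_prop), hshift, hshift,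
    logDeriv_Gammaℝ hpos]
  congr 2
  simp [logDeriv_apply]

/-- `ζ'/ζ` decays exponentially to the right. -/
theorem exists_norm_logDeriv_riemannZeta_le :
    ∃ C : ℝ, 0 ≤ C ∧ ∀ t : ℝ, 1 ≤ t →
      ‖logDeriv riemannZeta (1 / 2 + t)‖ ≤ C * (2 : ℝ) ^ (-t) := by
  -- Comparison with the absolutely convergent von Mangoldt series at 3/2: for n ≥ 2 the term at 1/2
  -- + t gains the factor n^(-(t-1)) ≤ 2 · 2^(-t), and the terms n = 0, 1 vanish.
  have hsum := (ArithmeticFunction.LSeriesSummable_vonMangoldt (s := 3 / 2) (by norm_num)).norm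
  refine ⟨2 * ∑' n, ‖LSeries.term (fun n => (ArithmeticFunction.vonMangoldt n : ℂ)) (3 / 2) n‖,
    mul_nonneg zero_le_two (tsum_nonneg fun _ => norm_nonneg _), fun t ht => ?_⟩
  have hre : 1 < (1 / 2 + (t : ℂ)).re := by simp; linarith
  have h1 := ArithmeticFunction.LSeries_vonMangoldt_eq_deriv_riemannZeta_div hre
  rw [logDeriv_apply, ← norm_neg, ← neg_div, ← h1, LSeries, mul_right_comm]
  refine tsum_of_norm_bounded (hsum.hasSum.mul_left (2 * (2 : ℝ) ^ (-t))) fun n => ?_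
  rcases lt_or_ge n 2 with hn | hn
  · interval_cases n <;> simp
  · have hn0 : n ≠ 0 := by omega
    have hnpos : (0 : ℝ) < n := by positivity
    have hn2 : (2 : ℝ) ≤ n := by exact_mod_cast hn
    rw [LSeries.norm_term_eq, LSeries.norm_term_eq, if_neg hn0, if_neg hn0]
    have e : (1 / 2 + (t : ℂ)).re = 3 / 2 + (t - 1) := by simp; ring
    have e2 : (3 / 2 : ℂ).re = 3 / 2 := by norm_num
    rw [e, e2, Real.rpow_add hnpos, ← div_div, div_eq_mul_inv _ ((n : ℝ) ^ (t - 1)), mul_comm]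
    gcongr
    rw [← Real.rpow_neg hnpos.le]
    calc (n : ℝ) ^ (-(t - 1)) ≤ (2 : ℝ) ^ (-(t - 1)) :=
          Real.rpow_le_rpow_of_nonpos (by norm_num) hn2 (by linarith)
      _ = 2 * (2 : ℝ) ^ (-t) := by
          rw [show -(t - 1) = 1 + -t by ring, Real.rpow_add (by norm_num), Real.rpow_one]

theorem continuousOn_logDeriv_riemannZeta :
    ContinuousOn (fun t : ℝ => logDeriv riemannZeta (1 / 2 + t)) (Ici 1) := by
  intro t ht
  have ht : 1 ≤ t := ht
  have hre : (1 / 2 + (t : ℂ)).re = 1 / 2 + t := by simp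
  have hs1 : (1 / 2 + (t : ℂ)) ≠ 1 := fun h => by
    have := congrArg Complex.re h
    rw [hre] at this
    simp at this
    linarith
  have ha := analyticOn_riemannZeta _ hs1
  have : ContinuousAt (logDeriv riemannZeta) (1 / 2 + (t : ℂ)) :=
    (ha.deriv.div ha (riemannZeta_ne_zero_of_one_le_re (by rw [hre]; linarith))).continuousAt
  exact (this.comp (f := fun t : ℝ => 1 / 2 + (t : ℂ)) (by fun_prop)).continuousWithinAt

end Digamma

/-! ### Mellin transforms of simple fractions. -/

section StieltjesMellin

open Set MeasureTheory

theorem image_div_one_add_Ioi : (fun t : ℝ => t / (1 + t)) '' Ioi 0 = Ioo 0 1 := by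
  ext x
  constructor
  · rintro ⟨t, ht, rfl⟩
    have ht : 0 < t := ht
    refine ⟨by positivity, ?_⟩
    rw [div_lt_one (by linarith)]
    linarith
  · rintro ⟨h0, h1⟩
    have h2 : 0 < 1 - x := by linarith
    refine ⟨x / (1 - x), mem_Ioi.mpr (by positivity), ?_⟩
    field_simp
    ring

theorem hasDerivAt_div_one_add {t : ℝ} (ht : 0 < t) :
    HasDerivAt (fun t : ℝ => t / (1 + t)) (1 / (1 + t) ^ 2) t := by
  have h := (hasDerivAt_id t).div ((hasDerivAt_id t).const_add 1) (by simp; linarith)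
  convert! h using 1
  simp

theorem injOn_div_one_add : InjOn (fun t : ℝ => t / (1 + t)) (Ioi 0) := by
  intro x hx y hy h
  have hx : 0 < x := hx
  have hy : 0 < y := hy
  simp only at h
  rw [div_eq_div_iff (by linarith) (by linarith)] at h
  linarith

/-- The substitution x = t / (1 + t), with 1 - x = 1 / (1 + t), turns the integral B(a, 1 - a) into
the Mellin integral of 1 / (1 + t). The reflection formula then evaluates it. -/
theorem beta_integrand_comp {a : ℂ} {t : ℝ} (ht : 0 < t) :
    |1 / (1 + t) ^ 2| • (((t / (1 + t) : ℝ) : ℂ) ^ (a - 1) *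
      (1 - ((t / (1 + t) : ℝ) : ℂ)) ^ (1 - a - 1)) = (t : ℂ) ^ (a - 1) * (1 / (t + 1)) := by
  have h1 : 0 < 1 + t := by linarith
  have h1' : ((1 + t : ℝ) : ℂ) ≠ 0 := by exact_mod_cast h1.ne'
  have e1 : (1 - ((t / (1 + t) : ℝ) : ℂ)) = ((1 + t)⁻¹ : ℝ) := by
    push_cast at h1' ⊢
    field_simp
    ring
  rw [e1, div_eq_mul_inv t, Complex.ofReal_mul, Complex.mul_cpow_ofReal_nonneg ht.le (by positivity),
    mul_assoc, ← Complex.cpow_add _ _ (by exact_mod_cast (inv_pos.mpr h1).ne'),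
    show a - 1 + (1 - a - 1) = -1 by ring, Complex.cpow_neg_one, abs_of_nonneg (by positivity),
    Complex.real_smul]
  push_cast at h1' ⊢
  rw [inv_inv]
  rw [add_comm (t : ℂ) 1]
  field_simp

theorem integrableOn_cpow_mul_one_div_add_one {a : ℂ} (h0 : 0 < a.re) (h1 : a.re < 1) :
    IntegrableOn (fun t : ℝ => (t : ℂ) ^ (a - 1) * (1 / (t + 1))) (Ioi 0) := by
  have hb := Complex.betaIntegral_convergent (u := a) (v := 1 - a) h0 (by simpa using h1)
  rw [intervalIntegrable_iff_integrableOn_Ioo_of_le zero_le_one, ← image_div_one_add_Ioi,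
    integrableOn_image_iff_integrableOn_abs_deriv_smul measurableSet_Ioi
      (fun x hx => (hasDerivAt_div_one_add hx).hasDerivWithinAt) injOn_div_one_add] at hb
  exact hb.congr_fun (fun t ht => beta_integrand_comp ht) measurableSet_Ioi

theorem integral_cpow_mul_one_div_add_one {a : ℂ} (h0 : 0 < a.re) (h1 : a.re < 1) :
    ∫ t in Ioi (0 : ℝ), (t : ℂ) ^ (a - 1) * (1 / (t + 1)) = Real.pi / Complex.sin (Real.pi * a) := by
  have h1' : 0 < (1 - a).re := by simpa using h1
  have hG := Complex.Gamma_mul_Gamma_eq_betaIntegral h0 h1'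
  rw [add_sub_cancel, Complex.Gamma_one, one_mul, Complex.Gamma_mul_Gamma_one_sub,
    Complex.betaIntegral, intervalIntegral.integral_of_le zero_le_one,
    integral_Ioc_eq_integral_Ioo, ← image_div_one_add_Ioi,
    integral_image_eq_integral_abs_deriv_smul measurableSet_Ioi
      (fun x hx => (hasDerivAt_div_one_add hx).hasDerivWithinAt) injOn_div_one_add] at hG
  rw [hG]
  exact setIntegral_congr_fun measurableSet_Ioi fun t ht => (beta_integrand_comp ht).symm

/-- Two bounds are combined: -t avoids a ball around z₀ inside the slit plane, so ‖t + z‖ ≥ d/2,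
while ‖t + z‖ ≥ t - M handles large t. Locally uniform in z, this provides the majorants for
differentiating under the integral. -/
theorem exists_mul_one_add_le_norm_add {z₀ : ℂ} (hz : z₀ ∈ Complex.slitPlane) :
    ∃ δ c : ℝ, 0 < δ ∧ 0 < c ∧ ∀ z ∈ Metric.ball z₀ δ, ∀ t : ℝ, 0 < t →
      c * (t + 1) ≤ ‖(t : ℂ) + z‖ := by
  obtain ⟨d, hd, hball⟩ := Metric.isOpen_iff.mp Complex.isOpen_slitPlane z₀ hz
  set M := ‖z₀‖ + d
  have hM : 0 ≤ M := by positivity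
  refine ⟨d / 2, 1 / ((1 + M) * (2 / d) + 1), by positivity, by positivity, fun z hz t ht => ?_⟩
  have hdz : ‖z - z₀‖ < d / 2 := by simpa [dist_eq_norm] using hz
  have h1 : d / 2 ≤ ‖(t : ℂ) + z‖ := by
    by_contra hlt
    have hmem : (-(t : ℂ)) ∈ Metric.ball z₀ d := by
      rw [Metric.mem_ball, dist_eq_norm]
      calc ‖-(t : ℂ) - z₀‖ = ‖(z - z₀) - (t + z)‖ := by ring_nf
        _ ≤ ‖z - z₀‖ + ‖(t : ℂ) + z‖ := norm_sub_le _ _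
        _ < d := by linarith
    have := hball hmem
    rw [Complex.mem_slitPlane_iff] at this
    simp at this
    linarith
  have h2 : t - M ≤ ‖(t : ℂ) + z‖ := by
    have e1 : ‖(t : ℂ)‖ = t := by simp [abs_of_pos ht]
    have e2 : ‖z‖ ≤ M := by
      have := norm_le_norm_add_norm_sub' z z₀
      linarith
    have := norm_sub_le_norm_add (t : ℂ) z
    linarith
  rw [div_mul_eq_mul_div, one_mul, div_le_iff₀ (by positivity)]
  have h3 : (1 + M) ≤ ‖(t : ℂ) + z‖ * ((1 + M) * (2 / d)) := by
    calc 1 + M = d / 2 * ((1 + M) * (2 / d)) := by field_simp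
      _ ≤ _ := by gcongr
  linarith

theorem integrableOn_rpow_mul_one_div_add_one {x : ℝ} (h0 : 0 < x) (h1 : x < 1) :
    IntegrableOn (fun t : ℝ => t ^ (x - 1) * (1 / (t + 1))) (Ioi 0) := by
  have h := (integrableOn_cpow_mul_one_div_add_one (a := x) (by simpa) (by simpa)).norm
  refine IntegrableOn.congr_fun h (fun t ht => ?_) measurableSet_Ioi
  have ht : 0 < t := ht
  have e : (t : ℂ) + 1 = ((t + 1 : ℝ) : ℂ) := by push_cast; rfl
  rw [norm_mul, Complex.norm_cpow_eq_rpow_re_of_pos ht, e, norm_div, Complex.norm_real, norm_one,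
    Real.norm_of_nonneg (by linarith)]
  simp

theorem continuousOn_cpow_mul {a z : ℂ} (hz : z ∈ Complex.slitPlane) (n : ℕ) :
    ContinuousOn (fun t : ℝ => (t : ℂ) ^ a * (1 / (t + z) ^ n)) (Ioi 0) := by
  obtain ⟨δ, c, hδ, hc, h⟩ := exists_mul_one_add_le_norm_add hz
  refine ContinuousOn.mul ?_ (continuousOn_const.div (by fun_prop) fun t ht => ?_)
  · intro t ht
    have ht : 0 < t := ht
    exact (ContinuousAt.cpow (by fun_prop) continuousAt_const (by simp [ht])).continuousWithinAt
  · have ht : 0 < t := ht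
    have := h z (Metric.mem_ball_self hδ) t ht
    refine pow_ne_zero _ (norm_pos_iff.mp (lt_of_lt_of_le ?_ this))
    positivity

theorem norm_one_div_add_le {z : ℂ} {c t : ℝ} (hc : 0 < c) (ht : 0 < t)
    (h : c * (t + 1) ≤ ‖(t : ℂ) + z‖) : ‖1 / ((t : ℂ) + z)‖ ≤ c⁻¹ * (1 / (t + 1)) := by
  rw [norm_div, norm_one, ← one_div, div_mul_div_comm, one_mul]
  gcongr

theorem integrableOn_cpow_mul_one_div_add {a z : ℂ} (h0 : 0 < a.re) (h1 : a.re < 1)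
    (hz : z ∈ Complex.slitPlane) :
    IntegrableOn (fun t : ℝ => (t : ℂ) ^ (a - 1) * (1 / (t + z))) (Ioi 0) := by
  obtain ⟨δ, c, hδ, hc, h⟩ := exists_mul_one_add_le_norm_add hz
  refine ((integrableOn_rpow_mul_one_div_add_one h0 h1).const_mul c⁻¹).mono' ?_ ?_
  · simpa using (continuousOn_cpow_mul (a := a - 1) hz 1).aestronglyMeasurable measurableSet_Ioi
  · filter_upwards [ae_restrict_mem measurableSet_Ioi] with t ht
    have ht : 0 < t := ht
    rw [norm_mul, Complex.norm_cpow_eq_rpow_re_of_pos ht, mul_left_comm]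
    simp only [Complex.sub_re, Complex.one_re]
    gcongr
    exact norm_one_div_add_le hc ht (h z (Metric.mem_ball_self hδ) t ht)

theorem differentiableAt_integral_cpow_mul_one_div_add {a z₀ : ℂ} (h0 : 0 < a.re) (h1 : a.re < 1)
    (hz : z₀ ∈ Complex.slitPlane) :
    DifferentiableAt ℂ (fun z => ∫ t in Ioi (0 : ℝ), (t : ℂ) ^ (a - 1) * (1 / (t + z))) z₀ := by
  obtain ⟨δ, c, hδ, hc, h⟩ := exists_mul_one_add_le_norm_add hz
  have hne : ∀ z ∈ Metric.ball z₀ δ, ∀ t : ℝ, 0 < t → (t : ℂ) + z ≠ 0 := fun z hz t ht =>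
    norm_pos_iff.mp (lt_of_lt_of_le (by positivity) (h z hz t ht))
  have hmeas : ∀ᶠ z in 𝓝 z₀, AEStronglyMeasurable
      (fun t : ℝ => (t : ℂ) ^ (a - 1) * (1 / (t + z))) (volume.restrict (Ioi 0)) := by
    filter_upwards [Complex.isOpen_slitPlane.mem_nhds hz] with z hz
    simpa using (continuousOn_cpow_mul (a := a - 1) hz 1).aestronglyMeasurable measurableSet_Ioi
  have hmeas' : AEStronglyMeasurable
      (fun t : ℝ => -((t : ℂ) ^ (a - 1) * (1 / (t + z₀) ^ 2))) (volume.restrict (Ioi 0)) :=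
    ((continuousOn_cpow_mul (a := a - 1) hz 2).aestronglyMeasurable measurableSet_Ioi).neg
  refine (hasDerivAt_integral_of_dominated_loc_of_deriv_le (μ := volume.restrict (Ioi (0 : ℝ)))
    (F := fun z (t : ℝ) => (t : ℂ) ^ (a - 1) * (1 / (t + z)))
    (F' := fun z (t : ℝ) => -((t : ℂ) ^ (a - 1) * (1 / (t + z) ^ 2)))
    (bound := fun t => c⁻¹ ^ 2 * (t ^ (a.re - 1) * (1 / (t + 1))))
    (Metric.ball_mem_nhds z₀ hδ) hmeas (integrableOn_cpow_mul_one_div_add h0 h1 hz) hmeas' ?_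
    ((integrableOn_rpow_mul_one_div_add_one h0 h1).const_mul _) ?_).2.differentiableAt
  · filter_upwards [ae_restrict_mem measurableSet_Ioi] with t ht z hz
    have ht : 0 < t := ht
    have h2 := norm_one_div_add_le hc ht (h z hz t ht)
    rw [norm_neg, norm_mul, Complex.norm_cpow_eq_rpow_re_of_pos ht, mul_left_comm]
    simp only [Complex.sub_re, Complex.one_re]
    gcongr
    rw [← one_div_pow, norm_pow]
    calc _ ≤ (c⁻¹ * (1 / (t + 1))) ^ 2 := by gcongr
      _ = c⁻¹ ^ 2 * (1 / (t + 1)) * (1 / (t + 1)) := by ring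
      _ ≤ c⁻¹ ^ 2 * (1 / (t + 1)) * 1 := by
        gcongr
        rw [div_le_one (by linarith)]
        linarith
      _ = _ := mul_one _
  · filter_upwards [ae_restrict_mem measurableSet_Ioi] with t ht z hz
    have hn := hne z hz t ht
    have := (((hasDerivAt_id z).const_add (t : ℂ)).inv hn).const_mul ((t : ℂ) ^ (a - 1))
    simp only [one_div]
    convert! this using 1
    simp [div_eq_mul_inv]

/-- The Mellin transform of `t ↦ 1 / (t + z)` for `z` off the negative real axis. -/
theorem integral_cpow_mul_one_div_add {a z : ℂ} (h0 : 0 < a.re) (h1 : a.re < 1)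
    (hz : z ∈ Complex.slitPlane) :
    ∫ t in Ioi (0 : ℝ), (t : ℂ) ^ (a - 1) * (1 / (t + z)) =
      z ^ (a - 1) * (Real.pi / Complex.sin (Real.pi * a)) := by
  -- Positive real z reduces to z = 1 by scaling t.
  have hreal : ∀ r : ℝ, 0 < r → ∫ t in Ioi (0 : ℝ), (t : ℂ) ^ (a - 1) * (1 / (t + (r : ℂ))) =
      (r : ℂ) ^ (a - 1) * (Real.pi / Complex.sin (Real.pi * a)) := by
    intro r hr
    have hr' : (r : ℂ) ≠ 0 := by exact_mod_cast hr.ne'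
    have h2 := integral_comp_mul_left_Ioi
      (fun t : ℝ => (t : ℂ) ^ (a - 1) * (1 / (t + (r : ℂ)))) 0 hr
    rw [mul_zero] at h2
    have h3 : ∀ t ∈ Ioi (0 : ℝ), (((r * t : ℝ) : ℂ)) ^ (a - 1) * (1 / (((r * t : ℝ) : ℂ) + r)) =
        ((r : ℂ) ^ (a - 1) * (r : ℂ)⁻¹) * ((t : ℂ) ^ (a - 1) * (1 / (t + 1))) := by
      intro t ht
      have ht : 0 < t := ht
      have ht1 : (t : ℂ) + 1 ≠ 0 := by
        have : ((t + 1 : ℝ) : ℂ) ≠ 0 := by exact_mod_cast (by linarith : t + 1 ≠ 0)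
        simpa using this
      rw [Complex.ofReal_mul, Complex.mul_cpow_ofReal_nonneg hr.le ht.le,
        show (r : ℂ) * t + r = r * (t + 1) by ring]
      field_simp
    rw [setIntegral_congr_fun measurableSet_Ioi h3, integral_const_mul,
      integral_cpow_mul_one_div_add_one h0 h1, Complex.real_smul] at h2
    have h4 := congrArg (fun w => (r : ℂ) * w) h2
    simp only [Complex.ofReal_inv, mul_inv_cancel_left₀ hr'] at h4
    rw [← h4]
    field_simp
  have hA : AnalyticOnNhd ℂ (fun z => ∫ t in Ioi (0 : ℝ), (t : ℂ) ^ (a - 1) * (1 / (t + z)))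
      Complex.slitPlane := DifferentiableOn.analyticOnNhd (fun z hz =>
    (differentiableAt_integral_cpow_mul_one_div_add h0 h1 hz).differentiableWithinAt)
    Complex.isOpen_slitPlane
  have hB : AnalyticOnNhd ℂ (fun z : ℂ => z ^ (a - 1) * (Real.pi / Complex.sin (Real.pi * a)))
      Complex.slitPlane := DifferentiableOn.analyticOnNhd (fun z hz =>
    (((hasDerivAt_id z).cpow_const hz).differentiableAt.mul_const _).differentiableWithinAt)
    Complex.isOpen_slitPlane
  -- Identity theorem on the slit plane: the two sides agree at the points 1 + 1/(n + 1), which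
  -- accumulate at 1.
  refine hA.eqOn_of_preconnected_of_frequently_eq hB
    (Complex.starConvex_one_slitPlane.isPathConnected (by simp)).isConnected.isPreconnected
    (z₀ := 1) (by simp) ?_ hz
  have htend : Tendsto (fun n : ℕ => (((1 + 1 / ((n : ℝ) + 1) : ℝ)) : ℂ)) atTop (𝓝[≠] 1) := by
    refine tendsto_nhdsWithin_iff.mpr ⟨?_, Eventually.of_forall fun n => ?_⟩
    · have := (tendsto_one_div_add_atTop_nhds_zero_nat (𝕜 := ℝ)).const_add 1
      rw [add_zero] at this
      have h := (Complex.continuous_ofReal.tendsto 1).comp this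
      simpa [Function.comp_def] using h
    · have : (0 : ℝ) < 1 / ((n : ℝ) + 1) := by positivity
      simp only [mem_compl_iff, mem_singleton_iff]
      intro h
      have h' : (1 + 1 / ((n : ℝ) + 1) : ℝ) = 1 := by exact_mod_cast h
      linarith
  exact htend.frequently (Frequently.of_forall fun n => hreal _ (by positivity))

/-- Substitute t² for t in the transform of 1 / (t + τ²) with a = 1 - σ. Since Re τ > 0 gives |arg
τ| < π/2, the point τ² avoids the cut and its principal power -σ is τ^(-2σ). -/
theorem integral_cpow_mul_two_mul_div_sq_add {σ τ : ℂ} (h0 : 0 < σ.re) (h1 : σ.re < 1)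
    (hτ : 0 < τ.re) :
    ∫ t in Ioi (0 : ℝ), (t : ℂ) ^ (-2 * σ) * (2 * t / ((t : ℂ) ^ 2 + τ ^ 2)) =
      τ ^ (-2 * σ) * (Real.pi / Complex.sin (Real.pi * σ)) := by
  have hsl : τ ^ 2 ∈ Complex.slitPlane := by
    rw [Complex.mem_slitPlane_iff]
    by_cases h : τ.im = 0
    · left
      simp only [sq, Complex.mul_re, h, mul_zero, sub_zero]
      positivity
    · right
      simp only [sq, Complex.mul_im]
      intro h'
      have : τ.re * τ.im = 0 := by linarith
      rcases mul_eq_zero.mp this with h2 | h2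
      · exact hτ.ne' h2
      · exact h h2
  have key := integral_cpow_mul_one_div_add (a := 1 - σ) (z := τ ^ 2) (by simpa using h1)
    (by simpa using h0) hsl
  rw [← integral_comp_rpow_Ioi_of_pos (p := 2) two_pos] at key
  have harg : -(Real.pi / 2) < Complex.arg τ ∧ Complex.arg τ < Real.pi / 2 := by
    have := Complex.abs_arg_lt_pi_div_two_iff.mpr (Or.inl hτ)
    exact abs_lt.mp this
  have hpow : (τ ^ 2) ^ (1 - σ - 1) = τ ^ (-2 * σ) := by
    rw [show -2 * σ = ((2 : ℕ) : ℂ) * (1 - σ - 1) by push_cast; ring,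
      Complex.cpow_nat_mul' (by push_cast; linarith) (by push_cast; linarith)]
  rw [hpow, mul_sub, mul_one, Complex.sin_pi_sub] at key
  rw [← key]
  refine setIntegral_congr_fun measurableSet_Ioi fun t ht => ?_
  have ht : 0 < t := ht
  have ht' : (t : ℂ) ≠ 0 := by exact_mod_cast ht.ne'
  have e : (((t ^ (2 : ℝ) : ℝ) : ℂ)) = (t : ℂ) ^ 2 := by rw [Real.rpow_two]; push_cast; rfl
  have harg2 : Complex.arg (t : ℂ) = 0 := Complex.arg_ofReal_of_nonneg ht.le
  have hpow2 : ((t : ℂ) ^ 2) ^ (1 - σ - 1) = (t : ℂ) ^ (-2 * σ) := by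
    rw [show -2 * σ = ((2 : ℕ) : ℂ) * (1 - σ - 1) by push_cast; ring,
      Complex.cpow_nat_mul' (by rw [harg2]; linarith [Real.pi_pos])
        (by rw [harg2]; linarith [Real.pi_pos])]
  simp only [e, hpow2, Complex.real_smul]
  rw [show (2 : ℝ) - 1 = 1 by norm_num, Real.rpow_one]
  push_cast
  ring

end StieltjesMellin

/-! ### Domination estimates for termwise integration. -/

section TermwiseMellin

open Set MeasureTheory

variable {ι : Type*} {F : ι → ℝ → ℂ} {f : ℝ → ℂ} {w : ι → ℝ} {q : ℝ}

/-- The bound t controls the integrand near 0 because s < 1, and t^(q-1) controls it at infinity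
because q < 2s. -/
theorem integrableOn_min_mul_rpow {q s : ℝ} (hq : q < 2 * s) (hs : s < 1) :
    IntegrableOn (fun t : ℝ => min t (t ^ (q - 1)) * t ^ (-2 * s)) (Ioi 0) := by
  have hm : Measurable fun t : ℝ => min t (t ^ (q - 1)) * t ^ (-2 * s) := by fun_prop
  rw [← Ioc_union_Ioi_eq_Ioi (zero_le_one (α := ℝ)), integrableOn_union]
  constructor
  · have h : IntegrableOn (fun t : ℝ => t ^ (1 - 2 * s)) (Ioc 0 1) :=
      (intervalIntegral.intervalIntegrable_rpow' (by linarith)).1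
    refine h.mono' hm.aestronglyMeasurable ?_
    filter_upwards [ae_restrict_mem measurableSet_Ioc] with t ht
    have h0 := ht.1
    rw [Real.norm_of_nonneg (by positivity), show 1 - 2 * s = 1 + -2 * s by ring,
      Real.rpow_add h0, Real.rpow_one]
    gcongr
    exact min_le_left _ _
  · have h : IntegrableOn (fun t : ℝ => t ^ (q - 1 - 2 * s)) (Ioi 1) :=
      integrableOn_Ioi_rpow_of_lt (by linarith) one_pos
    refine h.mono' hm.aestronglyMeasurable ?_
    filter_upwards [ae_restrict_mem measurableSet_Ioi] with t ht
    have h0 : 0 < t := one_pos.trans ht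
    rw [Real.norm_of_nonneg (by positivity), show q - 1 - 2 * s = q - 1 + -2 * s by ring,
      Real.rpow_add h0]
    gcongr
    exact min_le_right _ _

theorem aestronglyMeasurable_of_hasSum [Countable ι] (hF : ∀ i, ContinuousOn (F i) (Ioi 0))
    (hf : ∀ t, 0 < t → HasSum (fun i => F i t) (f t)) :
    AEStronglyMeasurable f (volume.restrict (Ioi 0)) := by
  refine aestronglyMeasurable_of_tendsto_ae (atTop : Filter (Finset ι))
    (f := fun s t => ∑ i ∈ s, F i t) (fun s => ?_) ?_
  · exact (continuousOn_finsetSum s fun i _ => hF i).aestronglyMeasurable measurableSet_Ioi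
  · filter_upwards [ae_restrict_mem measurableSet_Ioi] with t ht
    exact hf t ht

theorem norm_le_tsum_mul_of_hasSum (hw : Summable w)
    (hb : ∀ i t, 0 < t → ‖F i t‖ ≤ w i * min t (t ^ (q - 1)))
    (hf : ∀ t, 0 < t → HasSum (fun i => F i t) (f t)) {t : ℝ} (ht : 0 < t) :
    ‖f t‖ ≤ (∑' i, w i) * min t (t ^ (q - 1)) := by
  rw [← (hf t ht).tsum_eq, ← tsum_mul_right]
  exact tsum_of_norm_bounded (hw.mul_right _).hasSum fun i => hb i t ht

/-- Termwise integration against `t ^ (-2σ)` of a series of functions that are dominated by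
`min t (t ^ (q - 1))`. -/
theorem hasSum_integral_cpow_mul [Countable ι] {σ : ℂ} (hF : ∀ i, ContinuousOn (F i) (Ioi 0)) (hw : Summable w)
    (hb : ∀ i t, 0 < t → ‖F i t‖ ≤ w i * min t (t ^ (q - 1)))
    (hf : ∀ t, 0 < t → HasSum (fun i => F i t) (f t)) (hq : q < 2 * σ.re) (hσ : σ.re < 1) :
    IntegrableOn (fun t : ℝ => (t : ℂ) ^ (-2 * σ) * f t) (Ioi 0) ∧
      HasSum (fun i => ∫ t in Ioi (0 : ℝ), (t : ℂ) ^ (-2 * σ) * F i t)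
        (∫ t in Ioi (0 : ℝ), (t : ℂ) ^ (-2 * σ) * f t) := by
  have hc : ContinuousOn (fun t : ℝ => (t : ℂ) ^ (-2 * σ)) (Ioi 0) := fun t ht =>
    (ContinuousAt.cpow (by fun_prop) continuousAt_const
      (by simp [mem_Ioi.mp ht])).continuousWithinAt
  have hn : ∀ t : ℝ, 0 < t → ‖(t : ℂ) ^ (-2 * σ)‖ = t ^ (-2 * σ.re) := fun t ht => by
    rw [Complex.norm_cpow_eq_rpow_re_of_pos ht]
    simp
  have hint := integrableOn_min_mul_rpow hq hσ
  refine ⟨(hint.const_mul (∑' i, w i)).mono'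
    ((hc.aestronglyMeasurable measurableSet_Ioi).mul (aestronglyMeasurable_of_hasSum hF hf)) ?_,
    hasSum_integral_of_dominated_convergence
      (fun i t => w i * (min t (t ^ (q - 1)) * t ^ (-2 * σ.re)))
      (fun i => (hc.mul (hF i)).aestronglyMeasurable measurableSet_Ioi)
      (fun i => ?_) (Eventually.of_forall fun t => hw.mul_right _) ?_ ?_⟩
  · filter_upwards [ae_restrict_mem measurableSet_Ioi] with t ht
    rw [norm_mul, hn t ht, mul_comm, ← mul_assoc]
    exact mul_le_mul_of_nonneg_right (norm_le_tsum_mul_of_hasSum hw hb hf ht)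
      (Real.rpow_nonneg (le_of_lt ht) _)
  · filter_upwards [ae_restrict_mem measurableSet_Ioi] with t ht
    rw [norm_mul, hn t ht, mul_comm, ← mul_assoc]
    exact mul_le_mul_of_nonneg_right (hb i t ht) (Real.rpow_nonneg (le_of_lt ht) _)
  · simp_rw [tsum_mul_right]
    exact hint.const_mul _
  · filter_upwards [ae_restrict_mem measurableSet_Ioi] with t ht
    exact (hf t ht).mul_left _

/-- The denominator dominates r² and also the weighted geometric mean r^q t^(2-q). The first gives
the bound linear in t, the second the bound in t^(q-1). -/
theorem div_sq_add_sq_le {r t q : ℝ} (hr : 0 < r) (ht : 0 < t) (hq0 : 0 ≤ q) (hq2 : q ≤ 2) :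
    t / (t ^ 2 + r ^ 2) ≤ (r ^ (-2 : ℝ) + r ^ (-q)) * min t (t ^ (q - 1)) := by
  have h1 : t / (t ^ 2 + r ^ 2) ≤ r ^ (-2 : ℝ) * t := by
    rw [div_le_iff₀ (by positivity), Real.rpow_neg hr.le, Real.rpow_two]
    have : (r ^ 2)⁻¹ * t * (t ^ 2 + r ^ 2) = (r ^ 2)⁻¹ * t * t ^ 2 + t := by field_simp
    rw [this]
    have : 0 ≤ (r ^ 2)⁻¹ * t * t ^ 2 := by positivity
    linarith
  have h2 : t / (t ^ 2 + r ^ 2) ≤ r ^ (-q) * t ^ (q - 1) := by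
    have h3 : r ^ q * t ^ (2 - q) ≤ t ^ 2 + r ^ 2 := by
      rcases le_total t r with h | h
      · calc r ^ q * t ^ (2 - q) ≤ r ^ q * r ^ (2 - q) := by
              gcongr
          _ = r ^ 2 := by rw [← Real.rpow_add hr, ← Real.rpow_two]; congr 1; ring
          _ ≤ _ := by nlinarith
      · calc r ^ q * t ^ (2 - q) ≤ t ^ q * t ^ (2 - q) := by gcongr
          _ = t ^ 2 := by rw [← Real.rpow_add ht, ← Real.rpow_two]; congr 1; ring
          _ ≤ _ := by nlinarith
    calc t / (t ^ 2 + r ^ 2) ≤ t / (r ^ q * t ^ (2 - q)) := by gcongr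
      _ = t ^ (1 : ℝ) * (r ^ (-q) * t ^ (-(2 - q))) := by
        rw [Real.rpow_neg hr.le, Real.rpow_neg ht.le, Real.rpow_one]
        field_simp
      _ = r ^ (-q) * (t ^ (1 : ℝ) * t ^ (-(2 - q))) := by ring
      _ = _ := by rw [← Real.rpow_add ht]; congr 2; ring
  rw [add_mul]
  rcases le_total t (t ^ (q - 1)) with h | h
  · rw [min_eq_left h]
    have : 0 ≤ r ^ (-q) * t := by positivity
    linarith
  · rw [min_eq_right h]
    have : 0 ≤ r ^ (-2 : ℝ) * t ^ (q - 1) := by positivity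
    linarith

theorem div_mul_add_le {x t q : ℝ} (hx : 0 < x) (ht : 0 < t) (hq1 : 1 ≤ q) (hq2 : q ≤ 2) :
    t / (x * (t + x)) ≤ (x ^ (-2 : ℝ) + x ^ (-q)) * min t (t ^ (q - 1)) := by
  have h1 : t / (x * (t + x)) ≤ x ^ (-2 : ℝ) * t := by
    rw [div_le_iff₀ (by positivity), Real.rpow_neg hx.le, Real.rpow_two]
    have : (x ^ 2)⁻¹ * t * (x * (t + x)) = t * t / x + t := by field_simp
    rw [this]
    have : 0 ≤ t * t / x := by positivity
    linarith
  have h2 : t / (x * (t + x)) ≤ x ^ (-q) * t ^ (q - 1) := by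
    have h3 : x ^ (q - 1) * t ^ (2 - q) ≤ t + x := by
      rcases le_total t x with h | h
      · calc x ^ (q - 1) * t ^ (2 - q) ≤ x ^ (q - 1) * x ^ (2 - q) := by
              gcongr
          _ = x := by rw [← Real.rpow_add hx]; conv_rhs => rw [← Real.rpow_one x]
                      congr 1; ring
          _ ≤ _ := by linarith
      · calc x ^ (q - 1) * t ^ (2 - q) ≤ t ^ (q - 1) * t ^ (2 - q) := by
              gcongr
          _ = t := by rw [← Real.rpow_add ht]; conv_rhs => rw [← Real.rpow_one t]
                      congr 1; ring
          _ ≤ _ := by linarith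
    calc t / (x * (t + x)) ≤ t / (x * (x ^ (q - 1) * t ^ (2 - q))) := by gcongr
      _ = (x ^ (-(1 : ℝ)) * x ^ (-(q - 1))) * (t ^ (1 : ℝ) * t ^ (-(2 - q))) := by
        rw [Real.rpow_neg hx.le, Real.rpow_neg hx.le, Real.rpow_neg ht.le, Real.rpow_one,
          Real.rpow_one]
        field_simp
      _ = _ := by rw [← Real.rpow_add ht, ← Real.rpow_add hx]; congr 2 <;> ring
  rw [add_mul]
  rcases le_total t (t ^ (q - 1)) with h | h
  · rw [min_eq_left h]
    have : 0 ≤ x ^ (-q) * t := by positivity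
    linarith
  · rw [min_eq_right h]
    have : 0 ≤ x ^ (-2 : ℝ) * t ^ (q - 1) := by positivity
    linarith

/-- With S = t² + ‖τ‖² one has |t² + τ²|² = S² - 4t² (Im τ)². The inequality 4t²‖τ‖² ≤ S² and the
cone condition keep the subtracted term at most κ/(1 + κ) S². -/
theorem sq_add_sq_le_mul_norm {τ : ℂ} {κ t : ℝ} (hκ : 0 ≤ κ) (h : τ.im ^ 2 ≤ κ * τ.re ^ 2) :
    t ^ 2 + ‖τ‖ ^ 2 ≤ (1 + κ) * ‖(t : ℂ) ^ 2 + τ ^ 2‖ := by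
  refine abs_le_of_sq_le_sq' ?_ (by positivity) |>.2
  rw [mul_pow, Complex.sq_norm, Complex.sq_norm, Complex.normSq_apply, Complex.normSq_apply]
  simp only [sq, Complex.add_re, Complex.mul_re, Complex.ofReal_re, Complex.ofReal_im, mul_zero,
    sub_zero, Complex.add_im, Complex.mul_im, zero_mul, add_zero, zero_add]
  set x := τ.re
  set y := τ.im
  have hS : 4 * t ^ 2 * (x ^ 2 + y ^ 2) ≤ (t ^ 2 + x ^ 2 + y ^ 2) ^ 2 := by
    nlinarith [sq_nonneg (t ^ 2 - (x ^ 2 + y ^ 2))]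
  have h2 : 4 * t ^ 2 * y ^ 2 * (1 + κ) ≤ κ * (t ^ 2 + x ^ 2 + y ^ 2) ^ 2 := by
    nlinarith [mul_le_mul_of_nonneg_left h (sq_nonneg t), mul_le_mul_of_nonneg_left hS hκ]
  have e : (t * t + (x * x - y * y)) * (t * t + (x * x - y * y)) +
      (x * y + y * x) * (x * y + y * x) = (t ^ 2 + x ^ 2 + y ^ 2) ^ 2 - 4 * t ^ 2 * y ^ 2 := by ring
  rw [e]
  have h3 : (t ^ 2 + x ^ 2 + y ^ 2) ^ 2 ≤
      (1 + κ) * ((t ^ 2 + x ^ 2 + y ^ 2) ^ 2 - 4 * t ^ 2 * y ^ 2) := by nlinarith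
  have h4 : 0 ≤ (t ^ 2 + x ^ 2 + y ^ 2) ^ 2 - 4 * t ^ 2 * y ^ 2 := by
    rw [← e]; nlinarith [sq_nonneg (t * t + (x * x - y * y)), sq_nonneg (x * y + y * x)]
  calc _ = (t ^ 2 + x ^ 2 + y ^ 2) ^ 2 := by ring
    _ ≤ _ := h3
    _ ≤ _ := by
      refine mul_le_mul_of_nonneg_right ?_ h4
      nlinarith

/-- For zeros with ‖a‖ > 1, the strip bound |Re a| < 1/2 forces (Im a)² > 3/4 and hence a ratio
below 1/3. The finitely many others enter the constant through a finite sum. All τ thus lie in one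
cone, without the Riemann Hypothesis. -/
theorem exists_tau_im_sq_le : ∃ κ : ℝ, 0 ≤ κ ∧ ∀ ρ ∈ upperZeros,
    (tau ρ).im ^ 2 ≤ κ * (tau ρ).re ^ 2 := by
  have hfin := finite_zeros_closedBall differentiable_xiHalf xiHalf_zero_ne_zero 1
  set S := hfin.toFinset
  have hnn : ∀ a ∈ S, 0 ≤ a.re ^ 2 / a.im ^ 2 := fun a _ => by positivity
  refine ⟨1 / 3 + ∑ a ∈ S, a.re ^ 2 / a.im ^ 2, by positivity, fun ρ hρ => ?_⟩
  have hz := upperZeros_iff.mp hρ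
  have hre : (tau ρ).im = -((ρ - 1 / 2).re) := by rw [tau_im]; simp
  have him : (tau ρ).re = (ρ - 1 / 2).im := by rw [tau_re]; simp
  have him0 : 0 < (ρ - 1 / 2).im := by rw [← him, tau_re]; exact hz.2
  have hlt := xiHalf_eq_zero_re_lt hz.1
  rw [hre, him]
  generalize ρ - 1 / 2 = a at *
  by_cases ha : ‖a‖ ≤ 1
  · have haS : a ∈ S := by
      simp only [S, Set.Finite.mem_toFinset]
      exact ⟨by simpa using ha, hz.1⟩
    have h1 := Finset.single_le_sum hnn haS
    have h2 : a.re ^ 2 = a.re ^ 2 / a.im ^ 2 * a.im ^ 2 := by field_simp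
    calc (-a.re) ^ 2 = a.re ^ 2 / a.im ^ 2 * a.im ^ 2 := by rw [neg_sq]; exact h2
      _ ≤ _ := by
        gcongr
        linarith
  · have h1 : 1 < a.re ^ 2 + a.im ^ 2 := by
      have h3 : ‖a‖ ^ 2 = a.re ^ 2 + a.im ^ 2 := by
        rw [Complex.sq_norm, Complex.normSq_apply]; ring
      rw [← h3]
      have := not_le.mp ha
      nlinarith
    have h2 : a.re ^ 2 < 1 / 4 := by nlinarith
    have h3 := Finset.sum_nonneg hnn
    have h4 : 0 ≤ (∑ a ∈ S, a.re ^ 2 / a.im ^ 2) * a.im ^ 2 := by positivity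
    nlinarith

instance : Countable upperZeros := by
  have h : {a : ℂ | xiHalf a = 0}.Countable := by
    have : {a : ℂ | xiHalf a = 0} ⊆ ⋃ n : ℕ, {a : ℂ | xiHalf a = 0} ∩ Metric.closedBall 0 n := by
      intro a ha
      obtain ⟨n, hn⟩ := exists_nat_ge ‖a‖
      exact mem_iUnion.mpr ⟨n, ha, by simpa using hn⟩
    refine (countable_iUnion fun n : ℕ => ?_).mono this
    refine ((finite_zeros_closedBall differentiable_xiHalf xiHalf_zero_ne_zero n).subset ?_).countable
    intro a ha
    exact ⟨ha.2, ha.1⟩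
  have : Countable {a : ℂ // xiHalf a = 0} := h.to_subtype
  exact ((xiZerosEquiv.injective).comp Sum.inl_injective).countable

end TermwiseMellin

/-! ### The series over the zeros as a Mellin transform. -/

section MellinIdentity

open Set MeasureTheory

/-- The partial fraction series `∑ t / (x (t + x))` over `x = 2k + 1/2`, in closed form. -/
noncomputable def digammaDiff (t : ℝ) : ℂ :=
  ((realDigamma ((1 / 2 + t) / 2) - realDigamma (1 / 4)) / 2 : ℝ)

/-- The difference of the partial fraction series over nontrivial and shifted trivial zeros. -/
noncomputable def zerosRemainder (t : ℝ) : ℂ := logDeriv xiHalf t - digammaDiff t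

theorem two_mul_add_half_pos (k : ℕ) : (0 : ℝ) < 2 * k + 1 / 2 := by positivity

theorem hasSum_digammaDiff {t : ℝ} (ht : 0 < t) :
    HasSum (fun k : ℕ => ((t / ((2 * k + 1 / 2) * (t + (2 * k + 1 / 2))) : ℝ) : ℂ))
      (digammaDiff t) :=
  Complex.hasSum_ofReal.mpr (hasSum_div_two_mul_add_half ht.le)

theorem xiHalf_ofReal_ne_zero_of_pos {t : ℝ} (ht : 0 < t) : xiHalf t ≠ 0 := by
  rcases le_total t (1 / 2) with h | h
  · exact xiHalf_ofReal_ne_zero (by linarith) h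
  · exact xiHalf_ne_zero_of_half_le_re (by simpa using h)

theorem summable_two_mul_add_half_rpow {q : ℝ} (hq : 1 < q) :
    Summable fun k : ℕ => (2 * (k : ℝ) + 1 / 2) ^ (-q) := by
  have h := (Real.summable_one_div_nat_add_rpow (1 / 4) q).mpr hq
  refine (h.mul_left ((2 : ℝ) ^ (-q))).congr fun k => ?_
  have hk : (0 : ℝ) < k + 1 / 4 := by positivity
  rw [abs_of_pos hk, one_div, ← Real.rpow_neg hk.le, ← Real.mul_rpow two_pos.le hk.le]
  ring_nf

theorem exists_norm_zero_summand_le {q : ℝ} (hq1 : 1 < q) (hq2 : q ≤ 2) :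
    ∃ w : upperZeros → ℝ, Summable w ∧ ∀ ρ (t : ℝ), 0 < t →
      ‖(zeroMult ρ : ℂ) * (2 * t / ((t : ℂ) ^ 2 + tau ρ ^ 2))‖ ≤ w ρ * min t (t ^ (q - 1)) := by
  obtain ⟨κ, hκ, h⟩ := exists_tau_im_sq_le
  refine ⟨fun ρ => 2 * (1 + κ) * ((zeroMult ρ : ℝ) * ‖tau ρ‖ ^ (-2 : ℝ) +
    (zeroMult ρ : ℝ) * ‖tau ρ‖ ^ (-q)), ((summable_zeroMult_mul_rpow one_lt_two).add
      (summable_zeroMult_mul_rpow hq1)).mul_left _, fun ρ t ht => ?_⟩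
  have hτ : 0 < ‖tau ρ‖ := norm_pos_iff.mpr fun h0 => by
    have := tau_re_pos ρ
    rw [h0] at this
    exact lt_irrefl _ this
  have h1 := sq_add_sq_le_mul_norm (t := t) hκ (h ρ ρ.2)
  have h2 := div_sq_add_sq_le hτ ht (by linarith) hq2
  have h3 : 0 < ‖(t : ℂ) ^ 2 + tau ρ ^ 2‖ := by
    by_contra h0
    have : 0 < t ^ 2 + ‖tau ρ‖ ^ 2 := by positivity
    nlinarith
  rw [norm_mul, norm_div, norm_mul, Complex.norm_natCast, Complex.norm_real,
    Real.norm_of_nonneg ht.le, Complex.norm_ofNat]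
  have h4 : t / ‖(t : ℂ) ^ 2 + tau ρ ^ 2‖ ≤ (1 + κ) * (t / (t ^ 2 + ‖tau ρ‖ ^ 2)) := by
    rw [mul_div_assoc', div_le_div_iff₀ h3 (by positivity)]
    nlinarith
  calc (zeroMult ρ : ℝ) * (2 * t / ‖(t : ℂ) ^ 2 + tau ρ ^ 2‖)
      = 2 * (zeroMult ρ : ℝ) * (t / ‖(t : ℂ) ^ 2 + tau ρ ^ 2‖) := by ring
    _ ≤ 2 * (zeroMult ρ : ℝ) * ((1 + κ) *
        ((‖tau ρ‖ ^ (-2 : ℝ) + ‖tau ρ‖ ^ (-q)) * min t (t ^ (q - 1)))) := by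
      refine mul_le_mul_of_nonneg_left (h4.trans ?_) (by positivity)
      exact mul_le_mul_of_nonneg_left h2 (by positivity)
    _ = _ := by ring

theorem exists_norm_digamma_summand_le {q : ℝ} (hq1 : 1 < q) (hq2 : q ≤ 2) :
    ∃ w : ℕ → ℝ, Summable w ∧ ∀ (k : ℕ) (t : ℝ), 0 < t →
      ‖((t / ((2 * k + 1 / 2) * (t + (2 * k + 1 / 2))) : ℝ) : ℂ)‖ ≤
        w k * min t (t ^ (q - 1)) := by
  refine ⟨fun k => (2 * (k : ℝ) + 1 / 2) ^ (-2 : ℝ) + (2 * (k : ℝ) + 1 / 2) ^ (-q),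
    (summable_two_mul_add_half_rpow one_lt_two).add (summable_two_mul_add_half_rpow hq1),
    fun k t ht => ?_⟩
  rw [Complex.norm_real, Real.norm_of_nonneg (by positivity)]
  exact div_mul_add_le (two_mul_add_half_pos k) ht hq1.le hq2

theorem continuousOn_zero_summand (ρ : upperZeros) :
    ContinuousOn (fun t : ℝ => (zeroMult ρ : ℂ) * (2 * t / ((t : ℂ) ^ 2 + tau ρ ^ 2)))
      (Ioi 0) := by
  refine continuousOn_const.mul (ContinuousOn.div (by fun_prop) (by fun_prop) fun t ht h0 => ?_)
  obtain ⟨κ, hκ, h⟩ := exists_tau_im_sq_le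
  have h1 := sq_add_sq_le_mul_norm (t := t) hκ (h ρ ρ.2)
  rw [h0, norm_zero, mul_zero] at h1
  have ht : 0 < t := ht
  have : 0 < t ^ 2 + ‖tau ρ‖ ^ 2 := by positivity
  linarith

theorem continuousOn_digamma_summand (k : ℕ) :
    ContinuousOn (fun t : ℝ => ((t / ((2 * k + 1 / 2) * (t + (2 * k + 1 / 2))) : ℝ) : ℂ))
      (Ioi 0) := by
  refine Complex.continuous_ofReal.comp_continuousOn
    (ContinuousOn.div (by fun_prop) (by fun_prop) fun t ht => ?_)
  have ht : 0 < t := ht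
  positivity

theorem aestronglyMeasurable_zerosRemainder :
    AEStronglyMeasurable zerosRemainder (volume.restrict (Ioi 0)) :=
  (aestronglyMeasurable_of_hasSum continuousOn_zero_summand fun _ ht =>
    hasSum_zeroMult_logDeriv_xiHalf (xiHalf_ofReal_ne_zero_of_pos ht)).sub
  (aestronglyMeasurable_of_hasSum continuousOn_digamma_summand fun _ ht => hasSum_digammaDiff ht)

/-- The exponent q = 2 turns the majorant min t (t^(q-1)) into t. -/
theorem exists_norm_zerosRemainder_le :
    ∃ C : ℝ, ∀ t : ℝ, 0 < t → ‖zerosRemainder t‖ ≤ C * t := by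
  obtain ⟨w, hw, hb⟩ := exists_norm_zero_summand_le one_lt_two le_rfl
  obtain ⟨v, hv, hb'⟩ := exists_norm_digamma_summand_le one_lt_two le_rfl
  refine ⟨∑' ρ, w ρ + ∑' k, v k, fun t ht => ?_⟩
  have h1 := norm_le_tsum_mul_of_hasSum hw hb (fun _ ht =>
    hasSum_zeroMult_logDeriv_xiHalf (xiHalf_ofReal_ne_zero_of_pos ht)) ht
  have h2 := norm_le_tsum_mul_of_hasSum hv hb' (fun _ ht => hasSum_digammaDiff ht) ht
  have e : min t (t ^ ((2 : ℝ) - 1)) = t := by norm_num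
  rw [e] at h1 h2
  rw [add_mul]
  exact (norm_sub_le _ _).trans (add_le_add h1 h2)

theorem hasSum_two_mul_add_half_cpow {s : ℂ} (hs : 1 < s.re) :
    HasSum (fun k : ℕ => ((2 * k + 1 / 2 : ℝ) : ℂ) ^ (-s))
      (2 ^ (-s) * HurwitzZeta.hurwitzZeta ((1 / 4 : ℝ) : UnitAddCircle) s) := by
  have h := HurwitzZeta.hasSum_hurwitzZeta_of_one_lt_re (a := 1 / 4)
    (by constructor <;> norm_num) hs
  refine (h.mul_left ((2 : ℂ) ^ (-s))).congr_fun fun k => ?_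
  have e1 : ((2 * k + 1 / 2 : ℝ) : ℂ) = ((2 : ℝ) : ℂ) * (((k : ℝ) + 1 / 4 : ℝ) : ℂ) := by
    push_cast; ring
  rw [e1, Complex.mul_cpow_ofReal_nonneg (by norm_num) (by positivity)]
  simp [Complex.cpow_neg]

theorem sin_pi_mul_ne_zero_of_re {σ : ℂ} (h0 : 1 / 2 < σ.re) (h1 : σ.re < 1) :
    Complex.sin (Real.pi * σ) ≠ 0 := by
  intro h
  obtain ⟨k, hk⟩ := Complex.sin_eq_zero_iff.mp h
  have hπ : (Real.pi : ℂ) ≠ 0 := by exact_mod_cast Real.pi_ne_zero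
  rw [mul_comm (k : ℂ)] at hk
  have hσ : σ = k := mul_left_cancel₀ hπ hk
  rw [hσ, Complex.intCast_re] at h0 h1
  have h2 : k < 1 := by exact_mod_cast h1
  have h3 : (k : ℝ) ≤ 0 := by exact_mod_cast Int.lt_add_one_iff.mp h2
  linarith

theorem cos_pi_mul_ne_zero {σ : ℂ} (h1 : σ.re < 1) (h : ∀ m : ℕ, σ ≠ 1 / 2 - (m : ℂ)) :
    Complex.cos (Real.pi * σ) ≠ 0 := by
  intro h0
  obtain ⟨k, hk⟩ := Complex.cos_eq_zero_iff.mp h0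
  have hπ : (Real.pi : ℂ) ≠ 0 := by exact_mod_cast Real.pi_ne_zero
  have hσ : σ = k + 1 / 2 := mul_left_cancel₀ hπ (by rw [hk]; ring)
  have h2 : (k : ℝ) < 1 := by
    rw [hσ] at h1
    simp at h1
    linarith
  have h3 : k ≤ 0 := Int.lt_add_one_iff.mp (by exact_mod_cast h2)
  obtain ⟨m, rfl⟩ := Int.exists_eq_neg_ofNat h3
  refine h m ?_
  rw [hσ]
  push_cast
  ring

/-- The fraction is t/x times 1/(t + x), so the Stieltjes formula applies with a = 2 - 2σ. The
condition 0 < Re a < 1 is the strip 1/2 < Re σ < 1, and the sign comes from sin(2π - 2πσ). -/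
theorem integral_cpow_mul_div_mul_add {σ : ℂ} {x : ℝ} (h0 : 1 / 2 < σ.re) (h1 : σ.re < 1)
    (hx : 0 < x) :
    ∫ t in Ioi (0 : ℝ), (t : ℂ) ^ (-2 * σ) * ((t / (x * (t + x)) : ℝ) : ℂ) =
      -(Real.pi / Complex.sin (2 * (Real.pi * σ))) * (x : ℂ) ^ (-(2 * σ)) := by
  have key := integral_cpow_mul_one_div_add (a := 2 - 2 * σ) (z := x)
    (by simp; linarith) (by simp; linarith) (by simp [hx])
  have hx' : (x : ℂ) ≠ 0 := by exact_mod_cast hx.ne'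
  have e : ∀ t ∈ Ioi (0 : ℝ), (t : ℂ) ^ (-2 * σ) * ((t / (x * (t + x)) : ℝ) : ℂ) =
      (x : ℂ)⁻¹ * ((t : ℂ) ^ (2 - 2 * σ - 1) * (1 / (t + x))) := by
    intro t ht
    have ht : 0 < t := ht
    have ht' : (t : ℂ) ≠ 0 := by exact_mod_cast ht.ne'
    rw [show 2 - 2 * σ - 1 = -2 * σ + 1 by ring, Complex.cpow_add _ _ ht', Complex.cpow_one]
    push_cast
    rw [div_mul_eq_div_div]
    ring
  rw [setIntegral_congr_fun measurableSet_Ioi e, integral_const_mul, key,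
    show Real.pi * (2 - 2 * σ) = 2 * Real.pi - 2 * (Real.pi * σ) by ring, Complex.sin_two_pi_sub,
    show 2 - 2 * σ - 1 = -(2 * σ) + 1 by ring, Complex.cpow_add _ _ hx', Complex.cpow_one]
  field_simp

/-- The Dirichlet series over the zeros as a Mellin transform. -/
theorem tsum_zeroTerm_mul_eq {σ : ℂ} (h0 : 1 / 2 < σ.re) (h1 : σ.re < 1) :
    IntegrableOn (fun t : ℝ => (t : ℂ) ^ (-2 * σ) * zerosRemainder t) (Ioi 0) ∧
    (∑' ρ, zeroTerm σ ρ) * (Real.pi / Complex.sin (Real.pi * σ)) =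
      -(Real.pi / Complex.sin (2 * (Real.pi * σ))) *
        (2 ^ (-(2 * σ)) * HurwitzZeta.hurwitzZeta ((1 / 4 : ℝ) : UnitAddCircle) (2 * σ)) +
      ∫ t in Ioi (0 : ℝ), (t : ℂ) ^ (-2 * σ) * zerosRemainder t := by
  -- The exponent must exceed 1 for summability of the weights and stay below 2 Re σ for
  -- integrability at infinity.
  obtain ⟨q, hq1, hq2⟩ := exists_between (show 1 < 2 * σ.re by linarith)
  obtain ⟨w, hw, hb⟩ := exists_norm_zero_summand_le hq1 (by linarith)
  obtain ⟨v, hv, hb'⟩ := exists_norm_digamma_summand_le hq1 (by linarith)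
  obtain ⟨hi, hs⟩ := hasSum_integral_cpow_mul continuousOn_zero_summand hw hb (fun _ ht =>
    hasSum_zeroMult_logDeriv_xiHalf (xiHalf_ofReal_ne_zero_of_pos ht)) hq2 h1
  obtain ⟨hi', hs'⟩ := hasSum_integral_cpow_mul continuousOn_digamma_summand hv hb'
    (fun _ ht => hasSum_digammaDiff ht) hq2 h1
  have e : ∀ t : ℝ, (t : ℂ) ^ (-2 * σ) * zerosRemainder t =
      (t : ℂ) ^ (-2 * σ) * logDeriv xiHalf t - (t : ℂ) ^ (-2 * σ) * digammaDiff t := fun t => by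
    rw [zerosRemainder, mul_sub]
  simp_rw [e]
  refine ⟨hi.sub hi', ?_⟩
  rw [integral_sub hi hi', ← tsum_mul_right]
  have hs2 : HasSum (fun ρ => zeroTerm σ ρ * (Real.pi / Complex.sin (Real.pi * σ)))
      (∫ t in Ioi (0 : ℝ), (t : ℂ) ^ (-2 * σ) * logDeriv xiHalf t) := by
    refine hs.congr_fun fun ρ => ?_
    simp_rw [mul_left_comm ((_ : ℂ) ^ (-2 * σ)) (zeroMult ρ : ℂ)]
    rw [integral_const_mul, integral_cpow_mul_two_mul_div_sq_add (by linarith) h1 (tau_re_pos ρ),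
      zeroTerm, mul_assoc]
  have hs3 := (hasSum_two_mul_add_half_cpow (s := 2 * σ) (by simp; linarith)).mul_left
    (-(Real.pi / Complex.sin (2 * (Real.pi * σ))))
  have hs4 := hs'.congr_fun fun k =>
    (integral_cpow_mul_div_mul_add h0 h1 (two_mul_add_half_pos k)).symm
  rw [hs2.tsum_eq, hs3.unique hs4]
  ring

/-- For complex exponents the modulus of the power also involves arg τ; the crude |arg τ| ≤ π gives
the exponential factor, independent of the zero. -/
theorem norm_zeroTerm_le (σ : ℂ) (ρ : upperZeros) :
    ‖zeroTerm σ ρ‖ ≤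
      (zeroMult ρ : ℝ) * ‖tau ρ‖ ^ (-(2 * σ.re)) * Real.exp (2 * Real.pi * |σ.im|) := by
  have hτ : tau ρ ≠ 0 := fun h0 => by
    have := tau_re_pos ρ
    rw [h0] at this
    exact lt_irrefl _ this
  rw [zeroTerm, norm_mul, Complex.norm_natCast, Complex.norm_cpow_of_ne_zero hτ, mul_assoc,
    div_eq_mul_inv, ← Real.exp_neg]
  have h1 : -((tau ρ).arg * (-2 * σ).im) ≤ 2 * Real.pi * |σ.im| := by
    have h2 := Complex.abs_arg_le_pi (tau ρ)
    have e : -((tau ρ).arg * (-2 * σ).im) = 2 * ((tau ρ).arg * σ.im) := by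
      simp; ring
    rw [e]
    have h3 : (tau ρ).arg * σ.im ≤ Real.pi * |σ.im| := by
      refine (le_abs_self _).trans ?_
      rw [abs_mul]
      gcongr
    linarith
  have e2 : (-2 * σ).re = -(2 * σ.re) := by simp
  rw [e2]
  gcongr

theorem summable_zeroTerm {σ : ℂ} (h : 1 / 2 < σ.re) : Summable (zeroTerm σ) :=
  Summable.of_norm_bounded ((summable_zeroMult_mul_rpow (by linarith : 1 < 2 * σ.re)).mul_right _)
    (norm_zeroTerm_le σ)

theorem differentiableAt_tsum_zeroTerm {σ : ℂ} (h : 1 / 2 < σ.re) :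
    DifferentiableAt ℂ (fun σ => ∑' ρ, zeroTerm σ ρ) σ := by
  obtain ⟨s, hs1, hs2⟩ := exists_between h
  obtain ⟨r₀, hr₀, hr⟩ := exists_pos_le_norm_zeros differentiable_xiHalf xiHalf_zero_ne_zero
  set B := |σ.im| + 1
  set U : Set ℂ := {z | s < z.re ∧ z.re < σ.re + 1 ∧ |z.im| < B}
  have hU : IsOpen U := by
    refine (isOpen_lt continuous_const Complex.continuous_re).inter
      ((isOpen_lt Complex.continuous_re continuous_const).inter
        (isOpen_lt Complex.continuous_im.abs continuous_const))
  have hσ : σ ∈ U := ⟨hs2, by linarith, by simp [B]⟩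
  -- Both ends of the strip enter the majorant, since ‖τ‖ ≥ 1 is not assumed: the left end dominates
  -- when ‖τ‖ ≥ 1, the right end when ‖τ‖ ≤ 1.
  have hsum := ((summable_zeroMult_mul_rpow (by linarith : 1 < 2 * s)).add
    (summable_zeroMult_mul_rpow (by linarith : 1 < 2 * (σ.re + 1)))).mul_right
      (Real.exp (2 * Real.pi * B))
  refine (Complex.differentiableOn_tsum_of_summable_norm hsum (fun ρ z hz => ?_) hU
    fun ρ z hz => ?_).differentiableAt (hU.mem_nhds hσ)
  · have hτ : tau ρ ≠ 0 := fun h0 => by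
      have := tau_re_pos ρ
      rw [h0] at this
      exact lt_irrefl _ this
    unfold zeroTerm
    exact ((((differentiableAt_id.const_mul (-2)).const_cpow (Or.inl hτ))).const_mul
      _).differentiableWithinAt
  · refine (norm_zeroTerm_le z ρ).trans ?_
    have hτ : 0 < ‖tau ρ‖ := norm_pos_iff.mpr fun h0 => by
      have := tau_re_pos ρ
      rw [h0] at this
      exact lt_irrefl _ this
    rw [← mul_add]
    gcongr
    · rcases le_total 1 ‖tau ρ‖ with h1 | h1
      · refine (Real.rpow_le_rpow_of_exponent_le h1 (by linarith [hz.1] :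
          -(2 * z.re) ≤ -(2 * s))).trans ?_
        linarith [Real.rpow_pos_of_pos hτ (-(2 * (σ.re + 1)))]
      · refine (Real.rpow_le_rpow_of_exponent_ge hτ h1 (by linarith [hz.2.1] :
          -(2 * (σ.re + 1)) ≤ -(2 * z.re))).trans ?_
        linarith [Real.rpow_pos_of_pos hτ (-(2 * s))]
    · exact hz.2.2.le

end MellinIdentity

/-! ### Continuation of the pieces of the remainder integral. -/

section RemainderPieces

open Set MeasureTheory Asymptotics

theorem mellin_indicator (s : Set ℝ) (hs : MeasurableSet s) (hs0 : s ⊆ Ioi 0) (f : ℝ → ℂ) (w : ℂ) :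
    mellin (s.indicator f) (1 - w) = ∫ t in s, (t : ℂ) ^ (-w) * f t := by
  have e : ∀ t : ℝ, (t : ℂ) ^ (1 - w - 1) • s.indicator f t =
      s.indicator (fun t : ℝ => (t : ℂ) ^ (-w) * f t) t := fun t => by
    by_cases h : t ∈ s
    · simp only [indicator_of_mem h, smul_eq_mul]
      ring_nf
    · simp [indicator_of_notMem h]
  rw [mellin]
  simp_rw [e]
  rw [setIntegral_indicator hs, inter_eq_self_of_subset_right hs0]

/-- Cut off below 1, the function vanishes near 0 and decays exponentially, so its Mellin transform
has no abscissa on either side. -/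
theorem differentiable_integral_Ioi_cpow_mul {f : ℝ → ℂ} (hf : ContinuousOn f (Ici 1)) {C a : ℝ}
    (ha : 0 < a) (hb : ∀ t, 1 ≤ t → ‖f t‖ ≤ C * Real.exp (-a * t)) :
    (∀ w : ℂ, IntegrableOn (fun t : ℝ => (t : ℂ) ^ (-w) * f t) (Ioi 1)) ∧
      Differentiable ℂ fun w : ℂ => ∫ t in Ioi (1 : ℝ), (t : ℂ) ^ (-w) * f t := by
  have hsub : Ioi (1 : ℝ) ⊆ Ioi 0 := Ioi_subset_Ioi zero_le_one
  have hint : IntegrableOn f (Ioi 1) := by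
    refine Integrable.mono' ((integrableOn_exp_mul_Ioi (neg_neg_of_pos ha) 1).const_mul C)
      ((hf.mono Ioi_subset_Ici_self).aestronglyMeasurable measurableSet_Ioi) ?_
    filter_upwards [ae_restrict_mem measurableSet_Ioi] with t ht
    exact hb t (le_of_lt ht)
  have hloc : LocallyIntegrableOn ((Ioi 1).indicator f) (Ioi 0) :=
    ((integrable_indicator_iff measurableSet_Ioi).mpr hint).integrableOn.locallyIntegrableOn
  have htop : (Ioi 1).indicator f =O[atTop] fun t => Real.exp (-a * t) := by
    refine IsBigO.of_bound C ?_
    filter_upwards [eventually_gt_atTop 1] with t ht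
    rw [indicator_of_mem (mem_Ioi.mpr ht), Real.norm_of_nonneg (Real.exp_pos _).le]
    exact hb t ht.le
  have hbot : ∀ b : ℝ, (Ioi 1).indicator f =O[𝓝[>] 0] (· ^ (-b)) := fun b => by
    refine IsBigO.of_bound 1 ?_
    filter_upwards [mem_nhdsWithin_of_mem_nhds (Iio_mem_nhds zero_lt_one)] with t ht
    rw [indicator_of_notMem (by simpa using (le_of_lt ht)), norm_zero]
    positivity
  constructor
  · intro w
    have h := mellinConvergent_of_isBigO_rpow_exp ha hloc htop (hbot ((1 - w).re - 1))
      (by linarith)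
    refine (IntegrableOn.mono_set h hsub).congr_fun (fun t ht => ?_) measurableSet_Ioi
    simp only [indicator_of_mem ht, smul_eq_mul]
    ring_nf
  · intro w
    have h := mellin_differentiableAt_of_isBigO_rpow_exp ha hloc htop (hbot ((1 - w).re - 1))
      (s := 1 - w) (by linarith)
    have h2 := h.comp w ((differentiableAt_id (x := w)).const_sub 1)
    refine h2.congr_of_eventuallyEq (Eventually.of_forall fun z => ?_)
    exact (mellin_indicator _ measurableSet_Ioi hsub f z).symm

/-- Cut off above 1, only the behaviour O(t) at 0 limits the Mellin transform; in the variable w =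
2σ it yields the half-plane Re σ < 1. -/
theorem differentiableAt_integral_Ioc_cpow_mul {f : ℝ → ℂ}
    (hf : AEStronglyMeasurable f (volume.restrict (Ioi 0))) {C : ℝ}
    (hb : ∀ t, 0 < t → ‖f t‖ ≤ C * t) {w : ℂ} (hw : w.re < 2) :
    DifferentiableAt ℂ (fun w : ℂ => ∫ t in Ioc (0 : ℝ) 1, (t : ℂ) ^ (-w) * f t) w := by
  have hsub : Ioc (0 : ℝ) 1 ⊆ Ioi 0 := Ioc_subset_Ioi_self
  have hC : 0 ≤ C := by simpa using (norm_nonneg _).trans (hb 1 one_pos)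
  have hint : IntegrableOn f (Ioc 0 1) := by
    refine Integrable.of_bound (hf.mono_measure (Measure.restrict_mono hsub le_rfl)) C ?_
    filter_upwards [ae_restrict_mem measurableSet_Ioc] with t ht
    exact (hb t ht.1).trans (mul_le_of_le_one_right hC ht.2)
  have hloc : LocallyIntegrableOn ((Ioc 0 1).indicator f) (Ioi 0) :=
    ((integrable_indicator_iff measurableSet_Ioc).mpr hint).integrableOn.locallyIntegrableOn
  have htop : ∀ a : ℝ, (Ioc 0 1).indicator f =O[atTop] (· ^ (-a)) := fun a => by
    refine IsBigO.of_bound 1 ?_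
    filter_upwards [eventually_gt_atTop 1] with t ht
    rw [indicator_of_notMem (by simp [ht]), norm_zero]
    positivity
  have hbot : (Ioc 0 1).indicator f =O[𝓝[>] 0] (· ^ (-(-1 : ℝ))) := by
    refine IsBigO.of_bound C ?_
    filter_upwards [self_mem_nhdsWithin] with t ht
    have ht : 0 < t := ht
    rw [neg_neg, Real.rpow_one, Real.norm_of_nonneg ht.le]
    exact (norm_indicator_le_norm_self _ _).trans (hb t ht)
  have h := mellin_differentiableAt_of_isBigO_rpow hloc (htop ((1 - w).re + 1)) (by linarith) hbot
    (s := 1 - w) (by simp; linarith)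
  have h2 := h.comp w ((differentiableAt_id (x := w)).const_sub 1)
  refine h2.congr_of_eventuallyEq (Eventually.of_forall fun z => ?_)
  exact (mellin_indicator _ measurableSet_Ioc hsub f z).symm

theorem integral_Ioi_one_cpow {a : ℂ} (ha : a.re < -1) :
    ∫ t in Ioi (1 : ℝ), (t : ℂ) ^ a = -1 / (a + 1) := by
  rw [integral_Ioi_cpow_of_lt ha one_pos, Complex.ofReal_one, Complex.one_cpow]

/-- The sum is 2t / (t² - 1/4), a geometric series of ratio 1/(4t²). -/
theorem hasSum_one_div_add_half_add {t : ℝ} (ht : 1 < t) :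
    HasSum (fun j : ℕ => (1 / 4 : ℂ) ^ j * (2 * (t : ℂ) ^ (-(2 * (j : ℂ) + 1))))
      (1 / ((t : ℂ) + 1 / 2) + 1 / ((t : ℂ) - 1 / 2)) := by
  have ht0 : 0 < t := one_pos.trans ht
  have ht' : (t : ℂ) ≠ 0 := by exact_mod_cast ht0.ne'
  have h1 : (t : ℂ) + 1 / 2 ≠ 0 := by
    have : ((t + 1 / 2 : ℝ) : ℂ) ≠ 0 := by exact_mod_cast (by linarith : t + 1 / 2 ≠ 0)
    simpa using this
  have h2 : (t : ℂ) - 1 / 2 ≠ 0 := by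
    have : ((t - 1 / 2 : ℝ) : ℂ) ≠ 0 := by
      exact_mod_cast (by linarith : (0 : ℝ) < t - 1 / 2).ne'
    simpa using this
  have hr : ‖(1 / 4 : ℂ) * ((t : ℂ) ^ 2)⁻¹‖ < 1 := by
    rw [norm_mul, norm_inv, norm_pow, Complex.norm_real, Real.norm_of_nonneg ht0.le]
    norm_num
    have : (t ^ 2)⁻¹ ≤ 1 := inv_le_one_of_one_le₀ (by nlinarith)
    linarith
  have h3 : 1 - (1 / 4 : ℂ) * ((t : ℂ) ^ 2)⁻¹ = (t + 1 / 2) * (t - 1 / 2) / t ^ 2 := by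
    field_simp
    ring
  have h := (hasSum_geometric_of_norm_lt_one hr).mul_left (2 / (t : ℂ))
  rw [h3] at h
  convert! h.congr_fun fun j => ?_ using 1
  · rw [div_add_div _ _ h1 h2, inv_div, div_mul_div_comm, div_eq_div_iff (mul_ne_zero h1 h2)
      (mul_ne_zero ht' (mul_ne_zero h1 h2))]
    ring
  · rw [show -(2 * (j : ℂ) + 1) = -((2 * j + 1 : ℕ) : ℂ) by push_cast; ring, Complex.cpow_neg,
      Complex.cpow_natCast, pow_succ, pow_mul, mul_pow, inv_pow]
    field_simp

/-- Each term integrates to 2 / (2σ + 2j), and the factor 4^(-j) makes the integrals of the norms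
summable. The resulting series shows where the rational part has poles: only at nonpositive
integers. -/
theorem hasSum_integral_one_div_add_half_add {σ : ℂ} (h0 : 1 / 2 < σ.re) :
    HasSum (fun j : ℕ => (1 / 4 : ℂ) ^ j * (1 / (σ + j)))
      (∫ t in Ioi (1 : ℝ), (t : ℂ) ^ (-(2 * σ)) *
        (1 / ((t : ℂ) + 1 / 2) + 1 / ((t : ℂ) - 1 / 2))) := by
  set F : ℕ → ℝ → ℂ := fun j t => (1 / 4 : ℂ) ^ j * (2 * (t : ℂ) ^ (-(2 * σ) - (2 * (j : ℂ) + 1)))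
  have hre : ∀ j : ℕ, (-(2 * σ) - (2 * (j : ℂ) + 1)).re < -1 := fun j => by
    have : (0 : ℝ) ≤ j := Nat.cast_nonneg j
    simp
    linarith
  have hi : ∀ j, IntegrableOn (F j) (Ioi 1) := fun j =>
    ((integrableOn_Ioi_cpow_of_lt (hre j) one_pos).const_mul 2).const_mul _
  have hb : ∀ j, ∫ t in Ioi (1 : ℝ), ‖F j t‖ ≤ (1 / 4 : ℝ) ^ j * (2 *
      ∫ t in Ioi (1 : ℝ), t ^ (-(2 * σ.re) - 1)) := fun j => by
    rw [← integral_const_mul, ← integral_const_mul]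
    refine setIntegral_mono_on (hi j).norm ?_ measurableSet_Ioi fun t ht => ?_
    · exact ((integrableOn_Ioi_rpow_of_lt (by linarith) one_pos).const_mul 2).const_mul _
    · have ht0 : 0 < t := one_pos.trans ht
      have : (0 : ℝ) ≤ j := Nat.cast_nonneg j
      simp only [F]
      rw [norm_mul, norm_mul, norm_pow, Complex.norm_cpow_eq_rpow_re_of_pos ht0]
      simp only [norm_div, norm_one, Complex.norm_ofNat]
      gcongr
      · exact le_of_lt ht
      · simp
  have hs : Summable fun j => ∫ t in Ioi (1 : ℝ), ‖F j t‖ := by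
    refine Summable.of_nonneg_of_le (fun j => integral_nonneg fun t => norm_nonneg _) hb ?_
    exact (summable_geometric_of_lt_one (by norm_num) (by norm_num)).mul_right _
  have h := hasSum_integral_of_summable_integral_norm hi hs
  have e1 : ∫ t in Ioi (1 : ℝ), ∑' j, F j t = ∫ t in Ioi (1 : ℝ), (t : ℂ) ^ (-(2 * σ)) *
        (1 / ((t : ℂ) + 1 / 2) + 1 / ((t : ℂ) - 1 / 2)) := by
    refine setIntegral_congr_fun measurableSet_Ioi fun t ht => ?_
    have ht0 : (t : ℂ) ≠ 0 := by exact_mod_cast (one_pos.trans ht).ne'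
    refine HasSum.tsum_eq ?_
    refine ((hasSum_one_div_add_half_add ht).mul_left ((t : ℂ) ^ (-(2 * σ)))).congr_fun fun j => ?_
    simp only [F]
    rw [sub_eq_add_neg, Complex.cpow_add _ _ ht0]
    ring
  rw [e1] at h
  refine h.congr_fun fun j => ?_
  simp only [F]
  have hne : σ + j ≠ 0 := fun h0' => by
    have := congrArg Complex.re h0'
    have : (0 : ℝ) ≤ j := Nat.cast_nonneg j
    simp at *
    linarith
  rw [integral_const_mul, integral_const_mul, integral_Ioi_one_cpow (hre j),
    show -(2 * σ) - (2 * (j : ℂ) + 1) + 1 = -2 * (σ + j) by ring]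
  field_simp

/-- The entire function `sin (π σ) / (σ + j)`. -/
noncomputable def sinQuotient (j : ℕ) : ℂ → ℂ :=
  dslope (fun z => Complex.sin (Real.pi * z)) (-(j : ℂ))

theorem differentiable_sin_pi_mul : Differentiable ℂ fun z : ℂ => Complex.sin (Real.pi * z) := by
  fun_prop

theorem differentiable_sinQuotient (j : ℕ) : Differentiable ℂ (sinQuotient j) := by
  rw [← differentiableOn_univ]
  exact (Complex.differentiableOn_dslope univ_mem).mpr differentiable_sin_pi_mul.differentiableOn

theorem sinQuotient_eq {j : ℕ} {z : ℂ} (hz : z + j ≠ 0) :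
    sinQuotient j z = Complex.sin (Real.pi * z) * (1 / (z + j)) := by
  have hz' : z ≠ -(j : ℂ) := fun h => hz (by rw [h, neg_add_cancel])
  have h0 : Complex.sin (Real.pi * -(j : ℂ)) = 0 := by
    rw [mul_neg, Complex.sin_neg, mul_comm, Complex.sin_nat_mul_pi, neg_zero]
  rw [sinQuotient, dslope_of_ne _ hz', slope_def_field, h0, sub_zero, sub_neg_eq_add]
  ring

/-- The quotient is a difference quotient of sin πz based at its zero -j, so the mean value
inequality in a horizontal strip bounds it uniformly in j. -/
theorem norm_sinQuotient_le (j : ℕ) {z : ℂ} {R : ℝ} (hz : |z.im| < R) :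
    ‖sinQuotient j z‖ ≤ Real.pi * Real.exp (Real.pi * R) := by
  have hd : ∀ z : ℂ, HasDerivAt (fun z : ℂ => Complex.sin (Real.pi * z))
      (Complex.cos (Real.pi * z) * Real.pi) z := fun z => by
    have := ((hasDerivAt_id z).const_mul (Real.pi : ℂ)).csin
    simpa using this
  have hb : ∀ z ∈ {z : ℂ | |z.im| < R}, ‖Complex.cos (Real.pi * z) * Real.pi‖ ≤
      Real.pi * Real.exp (Real.pi * R) := by
    intro z hz
    have hz : |z.im| < R := hz
    have h1 : ‖Complex.cos (Real.pi * z)‖ ≤ Real.exp (Real.pi * R) := by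
      have hi : ∀ w : ℂ, |w.im| ≤ Real.pi * R → ‖Complex.exp (w * Complex.I)‖ ≤
          Real.exp (Real.pi * R) := fun w hw => by
        rw [Complex.norm_exp]
        gcongr
        simp only [Complex.mul_re, Complex.I_re, mul_zero, Complex.I_im, mul_one, zero_sub]
        exact (neg_le_abs _).trans hw
      have hw : |((Real.pi : ℂ) * z).im| ≤ Real.pi * R := by
        simp only [Complex.mul_im, Complex.ofReal_re, Complex.ofReal_im, zero_mul, add_zero]
        rw [abs_mul, abs_of_pos Real.pi_pos]
        have := Real.pi_pos
        gcongr
      rw [Complex.cos, norm_div, Complex.norm_ofNat]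
      have := norm_add_le (Complex.exp (Real.pi * z * Complex.I))
        (Complex.exp (-(Real.pi * z) * Complex.I))
      have h2 := hi _ hw
      have h3 := hi (-(Real.pi * z)) (by rw [Complex.neg_im, abs_neg]; exact hw)
      linarith
    rw [norm_mul, Complex.norm_real, Real.norm_of_nonneg Real.pi_pos.le, mul_comm]
    gcongr
  have hR : 0 < R := (abs_nonneg _).trans_lt hz
  have hconv : Convex ℝ {z : ℂ | |z.im| < R} := by
    have : {z : ℂ | |z.im| < R} = Complex.imLm ⁻¹' (Ioo (-R) R) := by
      ext z
      simp [abs_lt]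
    rw [this]
    exact (convex_Ioo _ _).linear_preimage _
  have hj : (-(j : ℂ)) ∈ {z : ℂ | |z.im| < R} := by simpa using hR
  by_cases h : z = -(j : ℂ)
  · rw [h, sinQuotient, dslope_same, (hd _).deriv]
    exact hb _ hj
  · have h1 := hconv.norm_image_sub_le_of_norm_hasDerivWithin_le
      (fun x _ => (hd x).hasDerivWithinAt) hb hj hz
    rw [sinQuotient, dslope_of_ne _ h, slope_def_field, norm_div]
    exact div_le_of_le_mul₀ (norm_nonneg _) (by positivity) h1

/-- The entire function `∑ 4⁻ʲ sin (π σ) / (σ + j)`. -/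
noncomputable def sinQuotientSum (z : ℂ) : ℂ := ∑' j : ℕ, (1 / 4 : ℂ) ^ j * sinQuotient j z

theorem differentiable_sinQuotientSum : Differentiable ℂ sinQuotientSum := by
  intro z
  have hU : IsOpen {w : ℂ | |w.im| < |z.im| + 1} :=
    isOpen_lt Complex.continuous_im.abs continuous_const
  have hs : Summable fun j : ℕ => (1 / 4 : ℝ) ^ j *
      (Real.pi * Real.exp (Real.pi * (|z.im| + 1))) :=
    (summable_geometric_of_lt_one (by norm_num) (by norm_num)).mul_right _
  refine (Complex.differentiableOn_tsum_of_summable_norm hs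
    (fun j => ((differentiable_sinQuotient j).const_mul _).differentiableOn) hU
    fun j w hw => ?_).differentiableAt (hU.mem_nhds (by simp))
  rw [norm_mul, norm_pow, norm_div, norm_one, Complex.norm_ofNat]
  gcongr
  exact norm_sinQuotient_le j hw

theorem sinQuotientSum_eq {σ : ℂ} (h0 : 1 / 2 < σ.re) :
    sinQuotientSum σ = Complex.sin (Real.pi * σ) * ∫ t in Ioi (1 : ℝ), (t : ℂ) ^ (-(2 * σ)) *
      (1 / ((t : ℂ) + 1 / 2) + 1 / ((t : ℂ) - 1 / 2)) := by
  refine HasSum.tsum_eq ?_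
  refine ((hasSum_integral_one_div_add_half_add h0).mul_left _).congr_fun fun j => ?_
  have hne : σ + j ≠ 0 := fun h0' => by
    have := congrArg Complex.re h0'
    have : (0 : ℝ) ≤ j := Nat.cast_nonneg j
    simp at *
    linarith
  rw [sinQuotient_eq hne]
  ring

end RemainderPieces

/-! ### The continuation and its poles. -/

section Continuation

open Set MeasureTheory

/-- The constant term of `zerosRemainder` at infinity. -/
noncomputable def remainderConst : ℂ := -(Real.log Real.pi) / 2 + realDigamma (1 / 4) / 2

/-- The digamma function from the gamma factor cancels the one in `digammaDiff`, leaving only its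
value at 1/4 and -log π, both halved, as a constant. -/
theorem zerosRemainder_eq {t : ℝ} (ht : 1 / 2 < t) :
    zerosRemainder t = (1 / ((t : ℂ) + 1 / 2) + 1 / ((t : ℂ) - 1 / 2)) + remainderConst +
      logDeriv riemannZeta (1 / 2 + t) := by
  have h := digamma_ofReal (x := (1 / 2 + t) / 2) (by linarith)
  push_cast at h
  rw [zerosRemainder, logDeriv_xiHalf_ofReal ht, h, digammaDiff, remainderConst]
  push_cast
  ring

/-- The analytic continuation to `Re σ < 1` of the Dirichlet series over the zeros. -/
noncomputable def zerosZetaLeft (σ : ℂ) : ℂ :=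
  -(2 ^ (-(2 * σ)) * HurwitzZeta.hurwitzZeta ((1 / 4 : ℝ) : UnitAddCircle) (2 * σ)) /
      (2 * Complex.cos (Real.pi * σ)) +
    Complex.sin (Real.pi * σ) / Real.pi *
      ((∫ t in Ioc (0 : ℝ) 1, (t : ℂ) ^ (-(2 * σ)) * zerosRemainder t) +
        remainderConst / (2 * σ - 1) +
        ∫ t in Ioi (1 : ℝ), (t : ℂ) ^ (-(2 * σ)) * logDeriv riemannZeta (1 / 2 + t)) +
    sinQuotientSum σ / Real.pi

theorem mellin_logDeriv_riemannZeta :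
    (∀ w : ℂ, IntegrableOn (fun t : ℝ => (t : ℂ) ^ (-w) * logDeriv riemannZeta (1 / 2 + t))
      (Ioi 1)) ∧
    Differentiable ℂ fun w : ℂ =>
      ∫ t in Ioi (1 : ℝ), (t : ℂ) ^ (-w) * logDeriv riemannZeta (1 / 2 + t) := by
  obtain ⟨C, hC, h⟩ := exists_norm_logDeriv_riemannZeta_le
  refine differentiable_integral_Ioi_cpow_mul continuousOn_logDeriv_riemannZeta
    (Real.log_pos one_lt_two) (C := C) fun t ht => ?_
  refine (h t ht).trans_eq ?_
  rw [Real.rpow_def_of_pos two_pos]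
  ring_nf

theorem integral_cpow_mul_zerosRemainder {σ : ℂ} (h0 : 1 / 2 < σ.re) (h1 : σ.re < 1) :
    ∫ t in Ioi (0 : ℝ), (t : ℂ) ^ (-(2 * σ)) * zerosRemainder t =
      (∫ t in Ioc (0 : ℝ) 1, (t : ℂ) ^ (-(2 * σ)) * zerosRemainder t) +
      ((∫ t in Ioi (1 : ℝ), (t : ℂ) ^ (-(2 * σ)) *
        (1 / ((t : ℂ) + 1 / 2) + 1 / ((t : ℂ) - 1 / 2))) + remainderConst / (2 * σ - 1) +
      ∫ t in Ioi (1 : ℝ), (t : ℂ) ^ (-(2 * σ)) * logDeriv riemannZeta (1 / 2 + t)) := by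
  have hi := (tsum_zeroTerm_mul_eq h0 h1).1
  rw [neg_mul] at hi
  have hre : (-(2 * σ)).re < -1 := by simp; linarith
  have hsub : Ioi (1 : ℝ) ⊆ Ioi 0 := Ioi_subset_Ioi zero_le_one
  rw [← Ioc_union_Ioi_eq_Ioi (zero_le_one (α := ℝ)), setIntegral_union
    (t := Ioi (1 : ℝ)) (Set.disjoint_left.mpr fun x hx hx' => not_lt.mpr hx.2 hx') measurableSet_Ioi
    (hi.mono_set Ioc_subset_Ioi_self) (hi.mono_set hsub)]
  congr 1
  have i1 : IntegrableOn (fun t : ℝ => (t : ℂ) ^ (-(2 * σ)) * remainderConst) (Ioi 1) :=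
    (integrableOn_Ioi_cpow_of_lt hre one_pos).mul_const _
  have i2 := mellin_logDeriv_riemannZeta.1 (2 * σ)
  have i0 : IntegrableOn (fun t : ℝ => (t : ℂ) ^ (-(2 * σ)) *
      (1 / ((t : ℂ) + 1 / 2) + 1 / ((t : ℂ) - 1 / 2))) (Ioi 1) := by
    refine (((hi.mono_set hsub).sub i1).sub i2).congr_fun (fun t ht => ?_) measurableSet_Ioi
    have ht : 1 < t := ht
    simp only [Pi.sub_apply]
    rw [zerosRemainder_eq (by linarith)]
    ring
  have e : ∫ t in Ioi (1 : ℝ), (t : ℂ) ^ (-(2 * σ)) * remainderConst =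
      remainderConst / (2 * σ - 1) := by
    rw [integral_mul_const, integral_Ioi_one_cpow hre, show -(2 * σ) + 1 = -(2 * σ - 1) by ring,
      neg_div_neg_eq]
    ring
  rw [← e, ← integral_add i0 i1, ← integral_add (by exact i0.add i1) i2]
  refine setIntegral_congr_fun measurableSet_Ioi fun t ht => ?_
  have ht : 1 < t := ht
  rw [zerosRemainder_eq (by linarith)]
  ring

theorem tsum_zeroTerm_eq_zerosZetaLeft {σ : ℂ} (h0 : 1 / 2 < σ.re) (h1 : σ.re < 1) :
    ∑' ρ, zeroTerm σ ρ = zerosZetaLeft σ := by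
  have h := (tsum_zeroTerm_mul_eq h0 h1).2
  simp only [neg_mul (2 : ℂ)] at h
  rw [integral_cpow_mul_zerosRemainder h0 h1] at h
  have hs := sin_pi_mul_ne_zero_of_re h0 h1
  have hc : Complex.cos (Real.pi * σ) ≠ 0 := by
    refine cos_pi_mul_ne_zero h1 fun m hm => ?_
    have := congrArg Complex.re hm
    have h2 : (0 : ℝ) ≤ m := Nat.cast_nonneg m
    simp at this
    linarith
  have hπ : (Real.pi : ℂ) ≠ 0 := by exact_mod_cast Real.pi_ne_zero
  rw [zerosZetaLeft, sinQuotientSum_eq h0]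
  rw [Complex.sin_two_mul] at h
  have h2 : ∑' ρ, zeroTerm σ ρ = (∑' ρ, zeroTerm σ ρ) * (Real.pi / Complex.sin (Real.pi * σ)) *
      (Complex.sin (Real.pi * σ) / Real.pi) := by
    field_simp
  rw [h2, h]
  generalize Complex.sin (Real.pi * σ) = s at *
  generalize Complex.cos (Real.pi * σ) = c at *
  field_simp
  ring

/-- The meromorphic continuation of the Dirichlet series over the zeros. -/
noncomputable def zerosZeta (σ : ℂ) : ℂ :=
  open Classical in if 1 / 2 < σ.re then ∑' ρ, zeroTerm σ ρ else zerosZetaLeft σ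

theorem zerosZeta_of_half_lt_re {σ : ℂ} (h : 1 / 2 < σ.re) :
    zerosZeta σ = ∑' ρ, zeroTerm σ ρ := if_pos h

/-- The two definitions agree on the overlap 1/2 < Re σ < 1, so near any point one of the two
formulas is valid. -/
theorem zerosZeta_of_re_lt_one {σ : ℂ} (h : σ.re < 1) : zerosZeta σ = zerosZetaLeft σ := by
  by_cases h0 : 1 / 2 < σ.re
  · rw [zerosZeta_of_half_lt_re h0, tsum_zeroTerm_eq_zerosZetaLeft h0 h]
  · exact if_neg h0

theorem zerosZeta_eventuallyEq {σ : ℂ} (h : σ.re < 1) : zerosZeta =ᶠ[𝓝 σ] zerosZetaLeft := by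
  filter_upwards [(isOpen_lt Complex.continuous_re continuous_const).mem_nhds h] with z hz
  exact zerosZeta_of_re_lt_one hz

/-- The part of `zerosZetaLeft` without the Hurwitz zeta term and the pole of the constant. -/
noncomputable def zerosZetaRegular (σ : ℂ) : ℂ :=
    Complex.sin (Real.pi * σ) / Real.pi *
      ((∫ t in Ioc (0 : ℝ) 1, (t : ℂ) ^ (-(2 * σ)) * zerosRemainder t) +
        ∫ t in Ioi (1 : ℝ), (t : ℂ) ^ (-(2 * σ)) * logDeriv riemannZeta (1 / 2 + t)) +
    sinQuotientSum σ / Real.pi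

theorem differentiableAt_zerosZetaRegular {σ : ℂ} (h : σ.re < 1) :
    DifferentiableAt ℂ zerosZetaRegular σ := by
  obtain ⟨C, hC⟩ := exists_norm_zerosRemainder_le
  have h1 := (differentiableAt_integral_Ioc_cpow_mul aestronglyMeasurable_zerosRemainder hC
    (w := 2 * σ) (by simp; linarith)).comp σ ((differentiableAt_id (x := σ)).const_mul 2)
  have h2 := (mellin_logDeriv_riemannZeta.2 (2 * σ)).comp σ
    ((differentiableAt_id (x := σ)).const_mul 2)
  exact (((differentiable_sin_pi_mul σ).div_const _).mul (h1.add h2)).add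
    ((differentiable_sinQuotientSum σ).div_const _)

theorem zerosZetaLeft_eq (σ : ℂ) : zerosZetaLeft σ =
    -(2 ^ (-(2 * σ)) * HurwitzZeta.hurwitzZeta ((1 / 4 : ℝ) : UnitAddCircle) (2 * σ)) /
      (2 * Complex.cos (Real.pi * σ)) +
    Complex.sin (Real.pi * σ) / Real.pi * (remainderConst / (2 * σ - 1)) +
    zerosZetaRegular σ := by
  rw [zerosZetaLeft, zerosZetaRegular]
  ring

theorem differentiableAt_two_cpow_mul (σ : ℂ) :
    DifferentiableAt ℂ (fun σ : ℂ => (2 : ℂ) ^ (-(2 * σ))) σ :=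
  ((differentiableAt_id.const_mul 2).neg).const_cpow (Or.inl (by norm_num))

theorem differentiableAt_hurwitzZeta_two_mul {σ : ℂ} (h : σ ≠ 1 / 2) :
    DifferentiableAt ℂ
      (fun σ : ℂ => HurwitzZeta.hurwitzZeta ((1 / 4 : ℝ) : UnitAddCircle) (2 * σ)) σ := by
  have h' : 2 * σ ≠ 1 := fun h0 => h (by linear_combination h0 / 2)
  exact (HurwitzZeta.differentiableAt_hurwitzZeta _ h').comp σ
    ((differentiableAt_id (x := σ)).const_mul 2)

theorem hasDerivAt_cos_pi_mul (σ : ℂ) : HasDerivAt (fun z : ℂ => Complex.cos (Real.pi * z))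
    (-Complex.sin (Real.pi * σ) * Real.pi) σ := by
  have := ((hasDerivAt_id σ).const_mul (Real.pi : ℂ)).ccos
  simpa using this

theorem differentiableAt_zerosZeta {σ : ℂ} (h : ∀ m : ℕ, σ ≠ 1 / 2 - (m : ℂ)) :
    DifferentiableAt ℂ zerosZeta σ := by
  by_cases h0 : 1 / 2 < σ.re
  · refine (differentiableAt_tsum_zeroTerm h0).congr_of_eventuallyEq ?_
    filter_upwards [(isOpen_lt continuous_const Complex.continuous_re).mem_nhds h0] with z hz
    exact zerosZeta_of_half_lt_re hz
  · have h1 : σ.re < 1 := by linarith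
    refine DifferentiableAt.congr_of_eventuallyEq ?_ (zerosZeta_eventuallyEq h1)
    rw [show zerosZetaLeft = _ from funext zerosZetaLeft_eq]
    have hne : σ ≠ 1 / 2 := by simpa using h 0
    have hne' : 2 * σ - 1 ≠ 0 := fun h0 => hne (by linear_combination h0 / 2)
    refine DifferentiableAt.add (DifferentiableAt.add ?_ ?_) (differentiableAt_zerosZetaRegular h1)
    · refine DifferentiableAt.div ((differentiableAt_two_cpow_mul σ).mul
        (differentiableAt_hurwitzZeta_two_mul hne)).neg
        ((hasDerivAt_cos_pi_mul σ).differentiableAt.const_mul 2)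
        (mul_ne_zero two_ne_zero (cos_pi_mul_ne_zero h1 h))
    · refine ((differentiable_sin_pi_mul σ).div_const _).mul
        (DifferentiableAt.div (differentiableAt_const _) (by fun_prop) hne')

/-- Candidate poles are at mutual distance at least 1, so an open ball of radius 1/2 contains at
most one. -/
theorem eventually_ne_half_sub_nat (σ : ℂ) :
    ∀ᶠ z in 𝓝[≠] σ, ∀ m : ℕ, z ≠ 1 / 2 - (m : ℂ) := by
  by_cases hσ : ∃ m : ℕ, 1 / 2 - (m : ℂ) ∈ Metric.ball σ (1 / 2)
  · obtain ⟨m, hm⟩ := hσ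
    have hne : ∀ᶠ z in 𝓝[≠] σ, z ≠ 1 / 2 - (m : ℂ) := by
      by_cases h : σ = 1 / 2 - (m : ℂ)
      · rw [h]
        exact self_mem_nhdsWithin
      · exact mem_nhdsWithin_of_mem_nhds (isOpen_ne.mem_nhds h)
    filter_upwards [hne,
      mem_nhdsWithin_of_mem_nhds (Metric.ball_mem_nhds σ one_half_pos)] with z hz hz1 k hk
    have h1 : ‖((m : ℤ) : ℂ) - ((k : ℤ) : ℂ)‖ < 1 := by
      have h2 := dist_triangle_right z (1 / 2 - (m : ℂ)) σ
      rw [dist_eq_norm, hk] at h2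
      rw [Metric.mem_ball] at hm hz1
      rw [hk] at hz1
      have e : ((m : ℤ) : ℂ) - ((k : ℤ) : ℂ) = 1 / 2 - (k : ℂ) - (1 / 2 - (m : ℂ)) := by
        push_cast
        ring
      rw [e]
      linarith
    rw [← Int.cast_sub, Complex.norm_intCast] at h1
    have h2 : |(m : ℤ) - k| < 1 := by exact_mod_cast h1
    have h3 : (m : ℤ) - k = 0 := Int.abs_lt_one_iff.mp h2
    have h4 : m = k := by omega
    exact hz (by rw [hk, h4])
  · push Not at hσ
    filter_upwards [mem_nhdsWithin_of_mem_nhds (Metric.ball_mem_nhds σ one_half_pos)]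
      with z hz k hk
    exact hσ k (hk ▸ hz)

theorem analyticAt_zerosZeta {σ : ℂ} (h : ∀ m : ℕ, σ ≠ 1 / 2 - (m : ℂ)) :
    AnalyticAt ℂ zerosZeta σ :=
  Complex.analyticAt_of_differentiable_on_punctured_nhds_of_continuousAt
    ((eventually_ne_half_sub_nat σ).mono fun _ hz => differentiableAt_zerosZeta hz)
    (differentiableAt_zerosZeta h).continuousAt

/-- The function (z - x)^n g has a removable singularity, and a nonzero limit makes the order
exactly -n. -/
theorem meromorphicOrderAt_of_tendsto_pow_mul {g : ℂ → ℂ} {x L : ℂ} {n : ℕ}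
    (hd : ∀ᶠ z in 𝓝[≠] x, DifferentiableAt ℂ g z)
    (hl : Tendsto (fun z => (z - x) ^ n * g z) (𝓝[≠] x) (𝓝 L)) (hL : L ≠ 0) :
    MeromorphicAt g x ∧ meromorphicOrderAt g x = ((-n : ℤ) : WithTop ℤ) := by
  set G := Function.update (fun z => (z - x) ^ n * g z) x L
  have hc : ContinuousAt G x := continuousAt_update_same.mpr hl
  have hG : AnalyticAt ℂ G x := by
    refine Complex.analyticAt_of_differentiable_on_punctured_nhds_of_continuousAt ?_ hc
    filter_upwards [hd, self_mem_nhdsWithin] with z hz hzx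
    refine DifferentiableAt.congr_of_eventuallyEq (f := fun z => (z - x) ^ n * g z)
      (by fun_prop) ?_
    filter_upwards [isOpen_ne.mem_nhds hzx] with y hy
    exact Function.update_of_ne hy _ _
  have he : ∀ᶠ z in 𝓝[≠] x, g z = (z - x) ^ (-n : ℤ) • G z := by
    filter_upwards [self_mem_nhdsWithin] with z hz
    have hz' : z - x ≠ 0 := sub_ne_zero.mpr hz
    rw [show G z = (z - x) ^ n * g z from Function.update_of_ne hz _ _, smul_eq_mul, zpow_neg,
      zpow_natCast, inv_mul_cancel_left₀ (pow_ne_zero _ hz')]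
  have hm : MeromorphicAt g x := by
    have h1 : MeromorphicAt (fun z => (z - x) ^ (-n : ℤ) • G z) x := by fun_prop
    exact h1.congr (he.mono fun z hz => hz.symm)
  refine ⟨hm, (meromorphicOrderAt_eq_int_iff hm).mpr ⟨G, hG, ?_, he⟩⟩
  simpa [G] using hL

/-- This is the reciprocal of the derivative of cos πσ at its simple zero, namely of -π (-1)^m. -/
theorem tendsto_sub_div_cos_pi_mul (m : ℕ) :
    Tendsto (fun σ : ℂ => (σ - (1 / 2 - (m : ℂ))) / Complex.cos (Real.pi * σ))
      (𝓝[≠] (1 / 2 - (m : ℂ))) (𝓝 (-((-1) ^ m / Real.pi))) := by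
  have hπ : (Real.pi : ℂ) ≠ 0 := by exact_mod_cast Real.pi_ne_zero
  have h := (hasDerivAt_cos_pi_mul (1 / 2 - (m : ℂ))).tendsto_slope
  have e : (Real.pi : ℂ) * (1 / 2 - (m : ℂ)) = Real.pi / 2 - m * Real.pi := by ring
  have hs : Complex.sin (Real.pi * (1 / 2 - (m : ℂ))) = (-1) ^ m := by
    rw [e, Complex.sin_pi_div_two_sub]
    exact_mod_cast congrArg (fun x : ℝ => (x : ℂ)) (Real.cos_nat_mul_pi m)
  have hc : Complex.cos (Real.pi * (1 / 2 - (m : ℂ))) = 0 := by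
    rw [e, Complex.cos_pi_div_two_sub, Complex.sin_nat_mul_pi]
  rw [hs] at h
  have hne : (-(-1) ^ m * (Real.pi : ℂ)) ≠ 0 := by simp [hπ]
  have h2 := h.inv₀ hne
  have e2 : (-(-1) ^ m * (Real.pi : ℂ))⁻¹ = -((-1) ^ m / Real.pi) := by
    rcases neg_one_pow_eq_or ℂ m with h | h <;> rw [h] <;> field_simp
  rw [e2] at h2
  refine h2.congr fun z => ?_
  rw [slope_def_field, hc, sub_zero, inv_div]

/-- The residue of the continuation at `1/2 - m`. -/
theorem tendsto_sub_mul_zerosZeta {m : ℕ} (hm : 1 ≤ m) :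
    Tendsto (fun σ : ℂ => (σ - (1 / 2 - (m : ℂ))) * zerosZeta σ) (𝓝[≠] (1 / 2 - (m : ℂ)))
      (𝓝 ((-1) ^ m * (2 ^ (-(1 - 2 * (m : ℂ))) *
        HurwitzZeta.hurwitzZeta ((1 / 4 : ℝ) : UnitAddCircle) (1 - 2 * (m : ℂ))) /
          (2 * Real.pi))) := by
  set s : ℂ := 1 / 2 - (m : ℂ)
  have hm' : (1 : ℝ) ≤ m := by exact_mod_cast hm
  have hre : s.re < 1 := by simp [s]; linarith
  have hs : s ≠ 1 / 2 := fun h => by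
    have := congrArg Complex.re h
    simp [s] at this
    linarith
  have hs' : 2 * s - 1 ≠ 0 := fun h0 => hs (by linear_combination h0 / 2)
  have h1 := (tendsto_sub_div_cos_pi_mul m).mul
    (((differentiableAt_two_cpow_mul s).mul
      (differentiableAt_hurwitzZeta_two_mul hs)).continuousAt.tendsto.mono_left
        (nhdsWithin_le_nhds (s := {s}ᶜ)))
  have h0 : Tendsto (fun σ : ℂ => σ - s) (𝓝[≠] s) (𝓝 0) := by
    have : Tendsto (fun σ : ℂ => σ - s) (𝓝 s) (𝓝 (s - s)) := (continuous_sub_right s).tendsto s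
    rw [sub_self] at this
    exact this.mono_left nhdsWithin_le_nhds
  have hr : ContinuousAt (fun σ => Complex.sin (Real.pi * σ) / Real.pi *
      (remainderConst / (2 * σ - 1)) + zerosZetaRegular σ) s :=
    ((((differentiable_sin_pi_mul s).div_const _).mul
      (DifferentiableAt.div (differentiableAt_const _) (by fun_prop) hs')).add
      (differentiableAt_zerosZetaRegular hre)).continuousAt
  -- The factor -1/2 comes from the denominator 2 cos πσ and the sign before the Hurwitz term;
  -- everything else is regular at this point and is annihilated by σ - s.
  have h2 := (h1.mul_const (-(1 / 2))).add (h0.mul (hr.tendsto.mono_left nhdsWithin_le_nhds))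
  have e : 2 * s = 1 - 2 * (m : ℂ) := by simp only [s]; ring
  rw [zero_mul, add_zero, Pi.mul_apply, e] at h2
  have e3 : ∀ X : ℂ, -((-1) ^ m / (Real.pi : ℂ)) * X * (-(1 / 2)) =
      (-1) ^ m * X / (2 * Real.pi) := fun X => by ring
  rw [e3] at h2
  refine h2.congr' ?_
  filter_upwards [mem_nhdsWithin_of_mem_nhds (zerosZeta_eventuallyEq hre)] with z hz
  rw [hz, zerosZetaLeft_eq]
  simp only [Pi.mul_apply]
  ring

/-- The leading coefficient of the double pole of the continuation at `1/2`. -/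
theorem tendsto_sub_sq_mul_zerosZeta :
    Tendsto (fun σ : ℂ => (σ - 1 / 2) ^ 2 * zerosZeta σ) (𝓝[≠] (1 / 2))
      (𝓝 (1 / (8 * (Real.pi : ℂ)))) := by
  have hre : (1 / 2 : ℂ).re < 1 := by norm_num
  have h1 := tendsto_sub_div_cos_pi_mul 0
  simp only [Nat.cast_zero, sub_zero, pow_zero] at h1
  have hmap : Tendsto (fun σ : ℂ => 2 * σ) (𝓝[≠] (1 / 2)) (𝓝[≠] 1) := by
    refine tendsto_nhdsWithin_iff.mpr ⟨?_, ?_⟩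
    · have : Tendsto (fun σ : ℂ => 2 * σ) (𝓝 (1 / 2)) (𝓝 (2 * (1 / 2))) :=
        (continuous_const_mul 2).tendsto _
      rw [mul_one_div_cancel two_ne_zero] at this
      exact this.mono_left nhdsWithin_le_nhds
    · filter_upwards [self_mem_nhdsWithin] with z hz h
      exact hz (by
        have h : 2 * z = 1 := h
        simp only [mem_singleton_iff]
        linear_combination h / 2)
  have h2 := (HurwitzZeta.hurwitzZeta_residue_one ((1 / 4 : ℝ) : UnitAddCircle)).comp hmap
  have h3 := (differentiableAt_two_cpow_mul (1 / 2)).continuousAt.tendsto.mono_left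
    (nhdsWithin_le_nhds (s := {(1 / 2 : ℂ)}ᶜ))
  have h0 : Tendsto (fun σ : ℂ => σ - 1 / 2) (𝓝[≠] (1 / 2)) (𝓝 0) := by
    have : Tendsto (fun σ : ℂ => σ - 1 / 2) (𝓝 (1 / 2)) (𝓝 (1 / 2 - 1 / 2)) :=
      (continuous_sub_right _).tendsto _
    rw [sub_self] at this
    exact this.mono_left nhdsWithin_le_nhds
  have hr := (differentiableAt_zerosZetaRegular hre).continuousAt.tendsto.mono_left
    (nhdsWithin_le_nhds (s := {(1 / 2 : ℂ)}ᶜ))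
  have hsin := (differentiable_sin_pi_mul (1 / 2)).continuousAt.tendsto.mono_left
    (nhdsWithin_le_nhds (s := {(1 / 2 : ℂ)}ᶜ))
  -- One factor σ - 1/2 is spent on the cosine, the other, written (2σ - 1)/2, on the Hurwitz pole;
  -- hence -1/4 = -(1/2)(1/2). The constant term has only a simple pole and disappears in the limit.
  have h4 := (((h1.mul h2).mul h3).mul_const (-(1 / 4))).add
    ((h0.mul (hsin.mul_const (remainderConst / (2 * Real.pi)))).add ((h0.pow 2).mul hr))
  have e : -(1 / (Real.pi : ℂ)) * 1 * 2 ^ (-(2 * (1 / 2 : ℂ))) * -(1 / 4) +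
      (0 * (Complex.sin (Real.pi * (1 / 2)) * (remainderConst / (2 * Real.pi))) +
        0 ^ 2 * zerosZetaRegular (1 / 2)) = 1 / (8 * Real.pi) := by
    rw [mul_one_div_cancel two_ne_zero, Complex.cpow_neg_one]
    ring
  rw [e] at h4
  refine h4.congr' ?_
  filter_upwards [mem_nhdsWithin_of_mem_nhds (zerosZeta_eventuallyEq hre),
    self_mem_nhdsWithin] with z hz hz1
  have hz2 : 2 * z - 1 ≠ 0 := fun h => hz1 (by
    simp only [mem_singleton_iff]
    linear_combination h / 2)
  have e2 : z - 1 / 2 = (2 * z - 1) / 2 := by ring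
  rw [hz, zerosZetaLeft_eq, Function.comp, e2]
  have hπ : (Real.pi : ℂ) ≠ 0 := by exact_mod_cast Real.pi_ne_zero
  have e5 : ((2 * z - 1) / 2) ^ 2 * (Complex.sin (Real.pi * z) / Real.pi *
      (remainderConst / (2 * z - 1))) =
      (2 * z - 1) / 2 * (Complex.sin (Real.pi * z) * (remainderConst / (2 * Real.pi))) := by
    field_simp
  rw [mul_add, mul_add, e5]
  ring

end Continuation

/-! ### Bernoulli numbers and the value of the residue. -/

section BernoulliValues

theorem hasSum_iff_eq_of_two_mul {f : ℕ → ℝ} {a b : ℝ} (hf : HasSum f a)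
    (h : HasSum (fun n => f (2 * n)) b) (h0 : ∀ n, f (2 * n + 1) = 0) : a = b := by
  have h1 : HasSum (fun n => f (2 * n + 1)) 0 := by simp only [h0]; exact hasSum_zero
  simpa using hf.unique (h.even_add_odd h1)

/-- In the Fourier series ∑ cos(2πnx) / n^(2m) at x = 1/4 only even n survive, giving 2^(-2m) times
the series at 1/2. Adding the series at 1/2 and at 0 again leaves the even n, each doubled, which
determines the value at 1/2. -/
theorem eval_bernoulli_one_quarter {m : ℕ} (hm : m ≠ 0) :
    ((Polynomial.bernoulli (2 * m)).map (algebraMap ℚ ℝ)).eval (1 / 4 : ℝ) =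
      (1 / 2) ^ (2 * m) * (2 * (1 / 2) ^ (2 * m) - 1) * (bernoulli (2 * m) : ℝ) := by
  have hx : ∀ x : ℝ, 0 ≤ x → x ≤ 1 → x ∈ Set.Icc (0 : ℝ) 1 := fun x h0 h1 => ⟨h0, h1⟩
  have s0 := hasSum_one_div_nat_pow_mul_cos hm (hx 0 le_rfl zero_le_one)
  have s2 := hasSum_one_div_nat_pow_mul_cos hm (hx (1 / 2) (by norm_num) (by norm_num))
  have s4 := hasSum_one_div_nat_pow_mul_cos hm (hx (1 / 4) (by norm_num) (by norm_num))
  set K : ℝ := (-1 : ℝ) ^ (m + 1) * (2 * Real.pi) ^ (2 * m) / 2 / (2 * m).factorial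
  set b : ℝ → ℝ := fun x => ((Polynomial.bernoulli (2 * m)).map (algebraMap ℚ ℝ)).eval x
  have hK : K ≠ 0 := by
    have := Real.pi_pos
    have h1 : ((2 * m).factorial : ℝ) ≠ 0 := by exact_mod_cast Nat.factorial_ne_zero _
    simp only [K]
    positivity
  have h4 : K * b (1 / 4) = (1 / 2) ^ (2 * m) * (K * b (1 / 2)) := by
    refine hasSum_iff_eq_of_two_mul s4 ((s2.mul_left ((1 / 2 : ℝ) ^ (2 * m))).congr_fun
      fun n => ?_) fun n => ?_
    · rw [← mul_assoc, ← one_div_pow, ← one_div_pow, ← mul_pow]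
      push_cast
      congr 2
      · rw [one_div_mul_one_div]
      · ring
    · have : Real.cos (2 * Real.pi * ((2 * n + 1 : ℕ) : ℝ) * (1 / 4)) = 0 := by
        rw [Real.cos_eq_zero_iff]
        exact ⟨n, by push_cast; ring⟩
      rw [this, mul_zero]
  have h2 : K * b (1 / 2) + K * b 0 = 2 * ((1 / 2) ^ (2 * m) * (K * b 0)) := by
    have hc : ∀ n : ℕ, Real.cos (2 * Real.pi * n * (1 / 2)) = (-1) ^ n := fun n => by
      rw [← Real.cos_nat_mul_pi]
      ring_nf
    refine hasSum_iff_eq_of_two_mul (s2.add s0)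
      (((s0.mul_left ((1 / 2 : ℝ) ^ (2 * m))).mul_left 2).congr_fun fun n => ?_) fun n => ?_
    · rw [hc, pow_mul (-1)]
      simp only [mul_zero, Real.cos_zero, neg_one_sq, one_pow, mul_one, Nat.cast_mul,
        Nat.cast_ofNat]
      rw [← one_div_pow, ← one_div_pow, ← mul_pow, one_div_mul_one_div]
      ring
    · rw [hc, pow_succ, pow_mul]
      simp
  have h0 : b 0 = bernoulli (2 * m) := by
    simp only [b]
    rw [Polynomial.eval_zero_map, Polynomial.bernoulli_eval_zero]
    simp
  rw [h0] at h2
  refine mul_left_cancel₀ hK ?_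
  linear_combination h4 + (1 / 2) ^ (2 * m) * h2

/-- Otherwise Euler's formula would give ζ(2m) = 0, contrary to nonvanishing on Re s ≥ 1. -/
theorem bernoulli_two_mul_ne_zero {m : ℕ} (hm : m ≠ 0) : bernoulli (2 * m) ≠ 0 := by
  intro h
  have h1 := riemannZeta_two_mul_nat hm
  rw [h] at h1
  simp only [Rat.cast_zero, mul_zero, zero_div] at h1
  refine riemannZeta_ne_zero_of_one_le_re ?_ h1
  have : (1 : ℝ) ≤ m := by exact_mod_cast Nat.one_le_iff_ne_zero.mpr hm
  simp
  linarith

theorem hurwitzZeta_one_quarter_one_sub {m : ℕ} (hm : m ≠ 0) :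
    HurwitzZeta.hurwitzZeta ((1 / 4 : ℝ) : UnitAddCircle) (1 - 2 * (m : ℂ)) =
      -1 / (2 * m) * ((1 / 2) ^ (2 * m) * (2 * (1 / 2) ^ (2 * m) - 1) *
        ((bernoulli (2 * m) : ℚ) : ℂ)) := by
  have h := HurwitzZeta.hurwitzZeta_neg_nat (k := 2 * m - 1) (x := 1 / 4) (by omega)
    (by constructor <;> norm_num)
  have e : ((2 * m - 1 : ℕ) : ℂ) = 2 * m - 1 := by
    rw [Nat.cast_sub (by omega)]
    push_cast
    ring
  rw [e, neg_sub, show 2 * m - 1 + 1 = 2 * m by omega, sub_add_cancel] at h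
  rw [h]
  congr 1
  have h2 := congrArg (fun x : ℝ => (x : ℂ)) (eval_bernoulli_one_quarter hm)
  push_cast at h2
  rw [← h2, Polynomial.eval_map_algebraMap, Polynomial.eval_map_algebraMap]
  have h3 := Polynomial.aeval_algebraMap_apply ℂ (1 / 4 : ℝ) (Polynomial.bernoulli (2 * m))
  simpa using h3

/-- The added power restores the term (1/2)^(-s), at s = 1 - 2m, by which the Hurwitz function at
1/4 exceeds the one at 5/4. -/
theorem shadowZeta_one_sub_add {m : ℕ} :
    shadowZeta (1 - 2 * (m : ℂ)) + (2 : ℂ) ^ (1 - 2 * (m : ℤ)) =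
      2 ^ (-(1 - 2 * (m : ℂ))) *
        HurwitzZeta.hurwitzZeta ((1 / 4 : ℝ) : UnitAddCircle) (1 - 2 * (m : ℂ)) := by
  have e : -(1 - 2 * (m : ℂ)) = ((2 * (m : ℤ) - 1 : ℤ) : ℂ) := by push_cast; ring
  rw [shadowZeta, e, Complex.cpow_intCast, Complex.cpow_intCast, mul_sub, ← mul_zpow,
    show (2 : ℂ) * (1 / 4) = 2⁻¹ by norm_num, inv_zpow', neg_sub]
  ring

theorem residue_eq_bernoulli {m : ℕ} (hm : m ≠ 0) :
    (-1) ^ m * (shadowZeta (1 - 2 * (m : ℂ)) + (2 : ℂ) ^ (1 - 2 * (m : ℤ))) /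
        (2 * (Real.pi : ℂ)) =
      (-1) ^ m * (1 - (2 : ℂ) ^ (1 - 2 * (m : ℤ))) * ((bernoulli (2 * m) : ℚ) : ℂ) /
        (8 * (Real.pi : ℂ) * (m : ℂ)) := by
  have hm' : (m : ℂ) ≠ 0 := by exact_mod_cast hm
  have hπ : (Real.pi : ℂ) ≠ 0 := by exact_mod_cast Real.pi_ne_zero
  have e1 : (2 : ℂ) ^ (-(1 - 2 * (m : ℂ))) = 2 ^ (2 * m) / 2 := by
    rw [show -(1 - 2 * (m : ℂ)) = ((2 * m : ℕ) : ℂ) - 1 by push_cast; ring,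
      Complex.cpow_sub _ _ two_ne_zero, Complex.cpow_natCast, Complex.cpow_one]
  have e2 : (2 : ℂ) ^ (1 - 2 * (m : ℤ)) = 2 * (1 / 2) ^ (2 * m) := by
    rw [zpow_sub₀ two_ne_zero, zpow_one, one_div_pow]
    norm_cast
    ring_nf
  rw [shadowZeta_one_sub_add, hurwitzZeta_one_quarter_one_sub hm, e1, e2, one_div_pow]
  have h2 : (2 : ℂ) ^ (2 * m) ≠ 0 := pow_ne_zero _ two_ne_zero
  field_simp
  ring

/-- This makes the order at 1/2 - m exactly -1: the power of 2 is strictly below 1 and the Bernoulli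
number is nonzero. -/
theorem residue_ne_zero {m : ℕ} (hm : m ≠ 0) :
    (-1) ^ m * (1 - (2 : ℂ) ^ (1 - 2 * (m : ℤ))) * ((bernoulli (2 * m) : ℚ) : ℂ) /
        (8 * (Real.pi : ℂ) * (m : ℂ)) ≠ 0 := by
  have hm' : (m : ℂ) ≠ 0 := by exact_mod_cast hm
  have hπ : (Real.pi : ℂ) ≠ 0 := by exact_mod_cast Real.pi_ne_zero
  have hb : ((bernoulli (2 * m) : ℚ) : ℂ) ≠ 0 := by exact_mod_cast bernoulli_two_mul_ne_zero hm
  have h1 : 1 - (2 : ℂ) ^ (1 - 2 * (m : ℤ)) ≠ 0 := by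
    intro h
    have h2 : ((2 : ℝ) : ℂ) ^ (1 - 2 * (m : ℤ)) = ((1 : ℝ) : ℂ) := by
      push_cast
      linear_combination -h
    have h3 : (2 : ℝ) ^ (1 - 2 * (m : ℤ)) = 1 := by exact_mod_cast h2
    have h4 : (2 : ℝ) ^ (1 - 2 * (m : ℤ)) < 1 :=
      zpow_lt_one_of_neg₀ one_lt_two (by omega)
    exact h4.ne h3
  refine div_ne_zero (mul_ne_zero (mul_ne_zero (pow_ne_zero _ (by norm_num)) h1) hb) ?_
  exact mul_ne_zero (mul_ne_zero (by norm_num) hπ) hm'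

end BernoulliValues

/-! ### Assembly of the theorem. -/

theorem mainTheorem4 :
    ∃ Z : ℂ → ℂ,
      MeromorphicOn Z Set.univ ∧
      (∀ σ : ℂ, 1 / 2 < σ.re → HasSum (zeroTerm σ) (Z σ)) ∧
      (∀ σ : ℂ, (∀ m : ℕ, σ ≠ 1 / 2 - (m : ℂ)) → AnalyticAt ℂ Z σ) ∧
      meromorphicOrderAt Z (1 / 2) = ((-2 : ℤ) : WithTop ℤ) ∧
      ∀ m : ℕ, 1 ≤ m →
        meromorphicOrderAt Z (1 / 2 - (m : ℂ)) = ((-1 : ℤ) : WithTop ℤ) ∧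
        Tendsto (fun σ : ℂ => (σ - (1 / 2 - (m : ℂ))) * Z σ) (𝓝[≠] (1 / 2 - (m : ℂ)))
          (𝓝 ((-1) ^ m * (shadowZeta (1 - 2 * (m : ℂ)) + (2 : ℂ) ^ (1 - 2 * (m : ℤ)))
            / (2 * (Real.pi : ℂ)))) ∧
        (-1) ^ m * (shadowZeta (1 - 2 * (m : ℂ)) + (2 : ℂ) ^ (1 - 2 * (m : ℤ)))
            / (2 * (Real.pi : ℂ)) =
          (-1) ^ m * (1 - (2 : ℂ) ^ (1 - 2 * (m : ℤ))) * ((bernoulli (2 * m) : ℚ) : ℂ)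
            / (8 * (Real.pi : ℂ) * (m : ℂ)) := by
  have hd : ∀ σ : ℂ, ∀ᶠ z in 𝓝[≠] σ, DifferentiableAt ℂ zerosZeta z := fun σ =>
    (eventually_ne_half_sub_nat σ).mono fun _ hz => differentiableAt_zerosZeta hz
  have hres : ∀ m : ℕ, 1 ≤ m →
      Tendsto (fun σ : ℂ => (σ - (1 / 2 - (m : ℂ))) * zerosZeta σ) (𝓝[≠] (1 / 2 - (m : ℂ)))
        (𝓝 ((-1) ^ m * (shadowZeta (1 - 2 * (m : ℂ)) + (2 : ℂ) ^ (1 - 2 * (m : ℤ))) /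
          (2 * (Real.pi : ℂ)))) := fun m hm => by
    rw [shadowZeta_one_sub_add]
    exact tendsto_sub_mul_zerosZeta hm
  have h2 := meromorphicOrderAt_of_tendsto_pow_mul (hd (1 / 2)) tendsto_sub_sq_mul_zerosZeta
    (by simp)
  have h1 : ∀ m : ℕ, 1 ≤ m → MeromorphicAt zerosZeta (1 / 2 - (m : ℂ)) ∧
      meromorphicOrderAt zerosZeta (1 / 2 - (m : ℂ)) = ((-(1 : ℕ) : ℤ) : WithTop ℤ) :=
    fun m hm => by
      have hm' := Nat.one_le_iff_ne_zero.mp hm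
      refine meromorphicOrderAt_of_tendsto_pow_mul (hd _) ?_
        ((residue_eq_bernoulli hm').trans_ne (residue_ne_zero hm'))
      simpa only [pow_one] using hres m hm
  refine ⟨zerosZeta, fun σ _ => ?_, fun σ hσ => ?_, fun σ hσ => analyticAt_zerosZeta hσ, h2.2,
    fun m hm => ⟨(h1 m hm).2, hres m hm, residue_eq_bernoulli (Nat.one_le_iff_ne_zero.mp hm)⟩⟩
  · by_cases h : ∀ m : ℕ, σ ≠ 1 / 2 - (m : ℂ)
    · exact (analyticAt_zerosZeta h).meromorphicAt
    · push Not at h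
      obtain ⟨m, rfl⟩ := h
      rcases Nat.eq_zero_or_pos m with rfl | hm
      · simpa using h2.1
      · exact (h1 m hm).1
  · rw [zerosZeta_of_half_lt_re hσ]
    exact (summable_zeroTerm hσ).hasSum
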